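/- Let $(\Omega,\mathcal A,\mathbb P)$ be a probability space, $T:\Omega\to\Omega$ a bijective bimeasurable transformation preserving $\mathbb P$, and $\mathcal F_0\subseteq\mathcal A$ a $\sigma$-algebra with $\mathcal F_0\subseteq T^{-1}(\mathcal F_0)$. Put $\mathcal F_i=T^{-i}(\mathcal F_0)$ and $X_i=X_0\circ T^i$ for $i\in\mathbb Z$, where $X_0$ is a real random variable such that $(X_i)_{i\in\mathbb Z}$ is a martingale difference sequence with respect to $(\mathcal F_i)_{i\in\mathbb Z}$ (each $X_i$ is integrable and $\mathcal F_i$-measurable, and $\mathbb E(X_i\mid\mathcal F_{i-1})=0$ a.s.). Let $S_n=X_1+\cdots+X_n$, let $\sigma$ be the standard deviation of $X_0$, and let $p\in\,]2,3]$ be such that $\mathbb E|X_0|^p<\infty$. For a random variable $X$ let $Q_X(u)=\inf\{t\ge 0:\mathbb P(|X|>t)\le u\}$, let $\Phi$ be the distribution function of $N(0,1)$, and set $$\Vert X\Vert_{1,\Phi,p}=\int_0^1\bigl(1\vee\Phi^{-1}(1-u/2)\bigr)^{p-2}Q_X(u)\,du .$$ Assume that $$\sum_{n=1}^\infty\frac1{n^{2-p/2}}\Bigl\Vert\mathbb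 E\Bigl(\frac{S_n^2}{n}\Bigm|\mathcal F_0\Bigr)-\sigma^2\Bigr\Vert_{1,\Phi,p}<\infty\qquad\text{and}\qquad\sum_{n=1}^\infty\frac1{n^{2/p}}\Bigl\Vert\mathbb E\Bigl(\frac{S_n^2}{n}\Bigm|\mathcal F_0\Bigr)-\sigma^2\Bigr\Vert_{p/2}<\infty ,$$ where $\Vert\cdot\Vert_{p/2}$ is the norm of $\mathbb L^{p/2}(\mathbb P)$. For $r>0$, let $l$ be the natural integer with $l<r\le l+1$, let $\Lambda_r$ be the class of $l$-times continuously differentiable $f:\mathbb R\to\mathbb R$ such that $|f^{(l)}(x)-f^{(l)}(y)|\le|x-y|^{r-l}$ for all $x,y\in\mathbb R$, and let $\zeta_r(\mu,\nu)=\sup\{\int f\,d\mu-\int f\,d\nu: f\in\Lambda_r\}$. Let $P_{n^{-1/2}S_n}$ be the law of $n^{-1/2}S_n$ and $G_{\sigma^2}$ the normal law $N(0,\sigma^2)$ (the Dirac mass at $0$ if $\sigma=0$). Then: 1. for every $r\in[p-2,p]$ with $(r,p)\ne(1,3)$, $\ \zeta_r(P_{n^{-1/2}S_n},G_{\sigma^2})=O(n^{1-p/2})$,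 that is, there is a constant $C$ such that $\zeta_r(P_{n^{-1/2}S_n},G_{\sigma^2})\le C\,n^{1-p/2}$ for all $n\ge1$; 2. if $p=3$, $\ \zeta_1(P_{n^{-1/2}S_n},G_{\sigma^2})=O(n^{-1/2}\log n)$, that is, there is a constant $C$ such that $\zeta_1(P_{n^{-1/2}S_n},G_{\sigma^2})\le C\,n^{-1/2}\log n$ for all $n\ge2$. -/

import Mathlib

open MeasureTheory ProbabilityTheory
open scoped ENNReal

/-- The filtration `ℱ_i = T^{-i}(ℱ₀)`, `i ∈ ℤ`, of a bijection `T`. -/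
@[reducible]
def shiftFiltration {Ω : Type*} (T : Equiv.Perm Ω) (F₀ : MeasurableSpace Ω) (i : ℤ) :
    MeasurableSpace Ω :=
  F₀.comap (T ^ i : Equiv.Perm Ω)

/-- The stationary sequence `X_i = X₀ ∘ T^i`, `i ∈ ℤ`. -/
def shiftSeq {Ω : Type*} (T : Equiv.Perm Ω) (X₀ : Ω → ℝ) (i : ℤ) (ω : Ω) : ℝ :=
  X₀ ((T ^ i : Equiv.Perm Ω) ω)

/-- A sequence `(X_i)_{i ∈ ℤ}` of martingale differences with respect to `(ℱ_i)_{i ∈ ℤ}`. -/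
structure IsMartingaleDiffSeq {Ω : Type*} [MeasurableSpace Ω] (μ : Measure Ω)
    (F : ℤ → MeasurableSpace Ω) (X : ℤ → Ω → ℝ) : Prop where
  adapted : ∀ i, Measurable[F i] (X i)
  integrable : ∀ i, Integrable (X i) μ
  condExp_eq_zero : ∀ i, μ[X i | F (i - 1)] =ᵐ[μ] 0

/-- The partial sum `S_n = X_1 + ⋯ + X_n`. -/
noncomputable def partialSum {Ω : Type*} (X : ℤ → Ω → ℝ) (n : ℕ) (ω : Ω) : ℝ :=
  ∑ k ∈ Finset.Icc 1 n, X (k : ℤ) ω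

/-- The quantile function of `|X|`: the cadlag inverse `Q_X(u) = inf {t ≥ 0 : ℙ(|X| > t) ≤ u}`,
`0 < u < 1`, of the tail function of `|X|`. -/
noncomputable def absQuantile {Ω : Type*} [MeasurableSpace Ω] (μ : Measure Ω) (X : Ω → ℝ)
    (u : ℝ) : ℝ :=
  sInf {t : ℝ | 0 ≤ t ∧ μ {ω | t < |X ω|} ≤ ENNReal.ofReal u}

/-- The inverse `Φ⁻¹(v)`, `0 < v < 1`, of the distribution function `Φ` of `N(0,1)`. -/
noncomputable def stdNormalQuantile (v : ℝ) : ℝ :=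
  sInf {x : ℝ | v ≤ cdf (gaussianReal 0 1) x}

/-- The envelope norm `‖X‖_{1,Φ,p} = ∫₀¹ (1 ∨ Φ⁻¹(1 - u/2))^{p-2} Q_X(u) du`, with values in
`[0, ∞]`. -/
noncomputable def envelopeNorm {Ω : Type*} [MeasurableSpace Ω] (p : ℝ) (X : Ω → ℝ)
    (μ : Measure Ω) : ℝ≥0∞ :=
  ∫⁻ u in Set.Ioo (0 : ℝ) 1,
    ENNReal.ofReal ((max 1 (stdNormalQuantile (1 - u / 2))) ^ (p - 2) * absQuantile μ X u)

/-- The class `Λ_r`: with `l` the natural number such that `l < r ≤ l + 1`, the functions of class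
`C^l` whose `l`-th derivative is `(r - l)`-Hölder with constant `1`. -/
def zolotarevClass (r : ℝ) : Set (ℝ → ℝ) :=
  {f | ∃ l : ℕ, (l : ℝ) < r ∧ r ≤ l + 1 ∧ ContDiff ℝ l f ∧
    ∀ x y : ℝ, |iteratedDeriv l f x - iteratedDeriv l f y| ≤ |x - y| ^ (r - l)}

/-- The Zolotarev distance `ζ_r(ν₁, ν₂) = sup {∫ f dν₁ - ∫ f dν₂ : f ∈ Λ_r}`, as an extended real,
for probability measures with finite absolute moments of order `r > 0`. -/
noncomputable def zolotarevDist (r : ℝ) (ν₁ ν₂ : Measure ℝ) : EReal :=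
  ⨆ f ∈ zolotarevClass r, ((∫ x, f x ∂ν₁ - ∫ x, f x ∂ν₂ : ℝ) : EReal)

/-! If `σ = 0`, the sums vanish almost surely. Otherwise, by homogeneity of `Λ_r`
(`zolotarevDist_map_le`), it is enough to compare `E f(S_n)` with `E f(σ√n Y)`, `Y` standard normal,
for `f ∈ Λ_r`: an error `E` there becomes `n^(-r/2) E` for the normalized sums, so the target is
`n^(1-(p-r)/2)`, with an additional `log n` when `r = 1`, `p = 3`.

Write `P_s` for `gaussSmooth (σ * √s)`. Lindeberg's interpolation `a_k = E (P_{n-k} g)(S_k)` goes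
from the normal value to `E g(S_n)`. One replacement (`abs_replacement_le`) leaves a Taylor
remainder, measured by the modulus of continuity `ψ_t`, `t = n - k`, of the second derivative of
`P_{t-1} g`, and half of `E[(P_{n-k-1} g₂)(S_k) (X_{k+1}² - σ²)]`, where `g₂ = g''`. The latter does
not vanish, because the conditional variance is random.

The hypotheses control conditional variances over blocks only, so these second order terms are
regrouped dyadically (`abs_sum_prefix_le`): on a block the factor is frozen at a time preceding it.
Moving the freezing time over `m` steps costs `ψ_t` of an increment of `S` of length `m`, paired
with the variance defect of the following block of length `N` (`abs_sum_block_diff_le`). By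
stationarity everything reduces to `E[(1 + |S|^(p-2)) |N D_N|]`, where `S` is a sum of `m ≤ N` past
variables and `D_N = E(S_N²/N | F₀) - σ²`.

To bound this moment (`exists_lintegral_pastSum_mul_varDefect_le`), decompose `|S|^(p-2)` over
dyadic tail events `A` and use a rearrangement inequality: the integral of `|N D_N|` over `A` is
controlled by integrals of quantile functions over `(0, P(A))`. If the tails of `S` were normal,
summing over levels would produce exactly the weight `(1 ∨ Φ⁻¹(1-u/2))^(p-2)` of `envelopeNorm`. The
excess over normal tails is controlled by the normal approximation of `S` itself, tested on
functions with `(p-2)`-Hölder second derivative (`exists_sum_tail_excess_le`), and Hölder's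
inequality turns it into the `L^(p/2)` norm of the defects.

This is circular, but it closes (`exists_normalApprox`): an error at most `D m` for all `m < n`
implies an error at most `(M + K₀ + K₁ D^((p-2)/p)) n` for `n`. The exponent is less than `1`, so a
suitable `D` reproduces itself.

With the moments under control, the error is governed by `∑ ψ_t`. After one preliminary smoothing at
scale `σ` when `r ≤ 2`, `ψ_t(u)` is of order `t^((r-p)/2) (1 + u^(p-2))`, which sums to
`n^(1-(p-r)/2)` for `r > p-2`. For `r = p-2` this would give a logarithm. If `p < 3`, the sharper
`min (t^((p-5)/2) u) (t^((p-4)/2))` sums to `O(1 + u^(p-2))` uniformly in `n`; if `p = 3` the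
logarithm remains. -/

/-! ### Gaussian smoothing -/

/-- At most exponential growth. -/
def ExpGrowth (f : ℝ → ℝ) : Prop := ∃ A : ℝ, ∀ x, |f x| ≤ A * Real.exp |x|

/-- The smoothing of `f` by a centred normal variable of standard deviation `|s|`. -/
noncomputable def gaussSmooth (s : ℝ) (f : ℝ → ℝ) (x : ℝ) : ℝ :=
  ∫ y, f (x + s * y) ∂(gaussianReal 0 1)

theorem ExpGrowth.exists_nonneg {f : ℝ → ℝ} (hf : ExpGrowth f) :
    ∃ A : ℝ, 0 ≤ A ∧ ∀ x, |f x| ≤ A * Real.exp |x| := by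
  obtain ⟨A, hA⟩ := hf
  refine ⟨|A|, abs_nonneg _, fun x => (hA x).trans ?_⟩
  gcongr
  exact le_abs_self A

theorem integrable_exp_mul_abs_gaussianReal (c : ℝ) :
    Integrable (fun y : ℝ => Real.exp (c * |y|)) (gaussianReal 0 1) := by
  refine Integrable.mono' ((integrable_exp_mul_gaussianReal c).add
    (integrable_exp_mul_gaussianReal (-c))) (by fun_prop) (ae_of_all _ fun y => ?_)
  simp only [Real.norm_eq_abs, Real.abs_exp, Pi.add_apply]
  rcases abs_cases y with ⟨h, _⟩ | ⟨h, _⟩ <;> rw [h]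
  · linarith [Real.exp_pos (-c * y)]
  · rw [mul_neg, ← neg_mul]
    linarith [Real.exp_pos (c * y)]

theorem expGrowth_const (c : ℝ) : ExpGrowth fun _ => c :=
  ⟨|c|, fun _ => le_mul_of_one_le_right (abs_nonneg _) (Real.one_le_exp (abs_nonneg _))⟩

theorem expGrowth_of_abs_le_pow {f : ℝ → ℝ} {A : ℝ} {k : ℕ} (hA : 0 ≤ A)
    (h : ∀ x, |f x| ≤ A * (1 + |x|) ^ k) : ExpGrowth f := by
  refine ⟨A * (k.factorial * Real.exp 1), fun x => (h x).trans ?_⟩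
  rw [mul_assoc, mul_assoc, ← Real.exp_add]
  gcongr
  have := Real.pow_div_factorial_le_exp (1 + |x|) (by positivity) k
  rwa [div_le_iff₀' (by positivity)] at this

theorem expGrowth_of_abs_le_rpow {f : ℝ → ℝ} {A q : ℝ} {k : ℕ} (hA : 0 ≤ A) (hq : q ≤ k)
    (h : ∀ x, |f x| ≤ A * (1 + |x|) ^ q) : ExpGrowth f := by
  refine expGrowth_of_abs_le_pow (k := k) hA fun x => (h x).trans ?_
  gcongr
  rw [← Real.rpow_natCast]
  exact Real.rpow_le_rpow_of_exponent_le (by linarith [abs_nonneg x]) hq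

theorem abs_add_mul_exp_le (x s y : ℝ) :
    Real.exp |x + s * y| ≤ Real.exp |x| * Real.exp (|s| * |y|) := by
  rw [← Real.exp_add, Real.exp_le_exp, ← abs_mul]
  exact abs_add_le _ _

theorem integrable_comp_mul_gaussianReal {f P : ℝ → ℝ} (hf : Measurable f) (hP : Measurable P)
    (hfg : ExpGrowth f) (hPg : ExpGrowth P) (x s : ℝ) :
    Integrable (fun y => f (x + s * y) * P y) (gaussianReal 0 1) := by
  obtain ⟨A, hA0, hA⟩ := hfg.exists_nonneg
  obtain ⟨B, hB0, hB⟩ := hPg.exists_nonneg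
  refine Integrable.mono' ((integrable_exp_mul_abs_gaussianReal (|s| + 1)).const_mul
    (A * Real.exp |x| * B)) (by fun_prop) (ae_of_all _ fun y => ?_)
  rw [Real.norm_eq_abs, abs_mul]
  calc |f (x + s * y)| * |P y| ≤ (A * (Real.exp |x| * Real.exp (|s| * |y|))) * (B * Real.exp |y|) := by
        gcongr
        · exact (hA _).trans (by gcongr; exact abs_add_mul_exp_le x s y)
        · exact hB y
    _ = A * Real.exp |x| * B * Real.exp ((|s| + 1) * |y|) := by
        rw [add_mul, one_mul, Real.exp_add]; ring

theorem integrable_comp_gaussianReal {f : ℝ → ℝ} (hf : Measurable f)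
    (hfg : ExpGrowth f) (x s : ℝ) :
    Integrable (fun y => f (x + s * y)) (gaussianReal 0 1) := by
  simpa using integrable_comp_mul_gaussianReal hf (measurable_const (a := (1:ℝ))) hfg
    (expGrowth_const 1) x s

theorem measurable_gaussSmooth {f : ℝ → ℝ} (hf : Measurable f) (s : ℝ) :
    Measurable (gaussSmooth s f) := by
  have : StronglyMeasurable (Function.uncurry fun x y : ℝ => f (x + s * y)) := by
    apply Measurable.stronglyMeasurable
    exact hf.comp (by fun_prop)
  exact this.integral_prod_right.measurable

theorem expGrowth_gaussSmooth {f : ℝ → ℝ} (hfg : ExpGrowth f) (s : ℝ) :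
    ExpGrowth (gaussSmooth s f) := by
  obtain ⟨A, hA0, hA⟩ := hfg.exists_nonneg
  refine ⟨A * ∫ y, Real.exp (|s| * |y|) ∂(gaussianReal 0 1), fun x => ?_⟩
  have : ‖gaussSmooth s f x‖ ≤ ∫ y, A * Real.exp |x| * Real.exp (|s| * |y|) ∂(gaussianReal 0 1) := by
    refine norm_integral_le_of_norm_le ((integrable_exp_mul_abs_gaussianReal _).const_mul _)
      (ae_of_all _ fun y => ?_)
    rw [Real.norm_eq_abs, mul_assoc]
    exact (hA _).trans (by gcongr; exact abs_add_mul_exp_le x s y)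
  rw [integral_const_mul] at this
  rw [← Real.norm_eq_abs]
  linarith

/-- Differentiation under the integral, on the smoothed function. -/
theorem hasDerivAt_gaussSmooth {f f' : ℝ → ℝ} (hf : ∀ x, HasDerivAt f (f' x) x)
    (hf' : Measurable f') (hfg : ExpGrowth f) (hfg' : ExpGrowth f') (s x : ℝ) :
    HasDerivAt (gaussSmooth s f) (gaussSmooth s f' x) x := by
  have hfm : Measurable f :=
    (continuous_iff_continuousAt.2 fun x => (hf x).continuousAt).measurable
  obtain ⟨A, hA0, hA⟩ := hfg'.exists_nonneg
  refine (hasDerivAt_integral_of_dominated_loc_of_deriv_le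
    (F := fun x y => f (x + s * y)) (F' := fun x y => f' (x + s * y))
    (bound := fun y => A * Real.exp (|x| + 1) * Real.exp (|s| * |y|))
    (Metric.ball_mem_nhds x one_pos) (.of_forall fun x => (hfm.comp (by fun_prop)).aestronglyMeasurable)
    (integrable_comp_gaussianReal hfm hfg x s) (hf'.comp (by fun_prop)).aestronglyMeasurable
    (ae_of_all _ fun y z hz => ?_)
    ((integrable_exp_mul_abs_gaussianReal _).const_mul _) (ae_of_all _ fun y z hz => ?_)).2
  · rw [Real.norm_eq_abs, mul_assoc]
    refine (hA _).trans ?_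
    gcongr
    refine (abs_add_mul_exp_le z s y).trans ?_
    gcongr
    have := Metric.mem_ball.1 hz
    rw [Real.dist_eq] at this
    have := abs_sub_abs_le_abs_sub z x
    linarith
  · exact (hf _).comp_add_const z _

/-- Cameron–Martin formula: translate by `d` under Lebesgue measure; the exponential factor is the
ratio of the two normal densities. -/
theorem integral_gaussianReal_shift (F : ℝ → ℝ) (d : ℝ) :
    ∫ y, F y ∂(gaussianReal 0 1) =
      ∫ y, F (y - d) * Real.exp (y * d - d ^ 2 / 2) ∂(gaussianReal 0 1) := by
  rw [integral_gaussianReal_eq_integral_smul one_ne_zero,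
    integral_gaussianReal_eq_integral_smul one_ne_zero,
    ← integral_sub_right_eq_self _ d]
  refine integral_congr_ae (ae_of_all _ fun y => ?_)
  simp only [gaussianPDFReal, smul_eq_mul, sub_zero, NNReal.coe_one, mul_one]
  have : Real.exp (-(y - d) ^ 2 / 2) = Real.exp (-y ^ 2 / 2) * Real.exp (y * d - d ^ 2 / 2) := by
    rw [← Real.exp_add]; ring_nf
  rw [this]; ring

/-- The derivative of a smoothed function falls on the Gaussian weight. -/
theorem hasDerivAt_integral_weight {g P P' : ℝ → ℝ} (hg : Measurable g) (hgg : ExpGrowth g)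
    (hP : ∀ y, HasDerivAt P (P' y) y) (hP' : Measurable P') (hPg : ExpGrowth P)
    (hPg' : ExpGrowth P') {s : ℝ} (hs : 0 < s) (x : ℝ) :
    HasDerivAt (fun x => ∫ y, g (x + s * y) * P y ∂(gaussianReal 0 1))
      (s⁻¹ * ∫ y, g (x + s * y) * (y * P y - P' y) ∂(gaussianReal 0 1)) x := by
  have hPm : Measurable P :=
    (continuous_iff_continuousAt.2 fun x => (hP x).continuousAt).measurable
  obtain ⟨A, hA0, hA⟩ := hgg.exists_nonneg
  obtain ⟨B, hB0, hB⟩ := hPg.exists_nonneg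
  obtain ⟨B', hB0', hB'⟩ := hPg'.exists_nonneg
  -- `g` is merely measurable and cannot be differentiated. A displacement `s * d` of `x` is moved
  -- by `integral_gaussianReal_shift` onto `P` and the density, which are smooth, and the derivative
  -- is taken in `d` at `0`.
  set W : ℝ → ℝ → ℝ := fun d y =>
    g (x + s * y) * (P (y - d) * Real.exp (y * d - d ^ 2 / 2)) with hW
  set W' : ℝ → ℝ → ℝ := fun d y =>
    g (x + s * y) * (((y - d) * P (y - d) - P' (y - d)) * Real.exp (y * d - d ^ 2 / 2)) with hW'
  have key : HasDerivAt (fun d => ∫ y, W d y ∂(gaussianReal 0 1))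
      (∫ y, W' 0 y ∂(gaussianReal 0 1)) 0 := by
    refine (hasDerivAt_integral_of_dominated_loc_of_deriv_le
      -- For `|d| ≤ 1` the exponential rate is `|s|` from `g`, `2` from `(y - d) * P (y - d)` and
      -- `1` from the density ratio.
      (bound := fun y => A * Real.exp |x| * (Real.exp 2 * B + Real.exp 1 * B') *
        Real.exp ((|s| + 3) * |y|))
      (Metric.ball_mem_nhds 0 one_pos) (.of_forall fun d => by fun_prop) ?_ (by fun_prop)
      (ae_of_all _ fun y d hd => ?_) ((integrable_exp_mul_abs_gaussianReal _).const_mul _)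
      (ae_of_all _ fun y d hd => ?_)).2
    · simpa [hW] using integrable_comp_mul_gaussianReal hg hPm hgg hPg x s
    · have hd' : |d| ≤ 1 := by
        have := Metric.mem_ball.1 hd
        rw [Real.dist_eq, sub_zero] at this
        exact this.le
      have hyd : |y - d| ≤ |y| + 1 := (abs_sub y d).trans (by linarith)
      have hexp : Real.exp (y * d - d ^ 2 / 2) ≤ Real.exp |y| := by
        rw [Real.exp_le_exp]
        have h1 : y * d ≤ |y| * |d| := by rw [← abs_mul]; exact le_abs_self _
        have h2 : |y| * |d| ≤ |y| * 1 := by gcongr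
        nlinarith [sq_nonneg d]
      have hlin : |y - d| ≤ Real.exp (|y| + 1) := by
        have := Real.add_one_le_exp (|y| + 1); linarith
      have h3 : |(y - d) * P (y - d) - P' (y - d)| ≤
          (Real.exp 2 * B + Real.exp 1 * B') * Real.exp (2 * |y|) := by
        calc _ ≤ |y - d| * |P (y - d)| + |P' (y - d)| := by
              rw [← abs_mul]; exact abs_sub _ _
          _ ≤ Real.exp (|y| + 1) * (B * Real.exp (|y| + 1)) + B' * Real.exp (|y| + 1) := by
              gcongr
              · exact (hB _).trans (by gcongr)
              · exact (hB' _).trans (by gcongr)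
          _ ≤ (Real.exp 2 * B + Real.exp 1 * B') * Real.exp (2 * |y|) := by
              have e1 : Real.exp (|y| + 1) * Real.exp (|y| + 1) = Real.exp 2 * Real.exp (2 * |y|) := by
                rw [← Real.exp_add, ← Real.exp_add]; ring_nf
              have e2 : Real.exp (|y| + 1) ≤ Real.exp 1 * Real.exp (2 * |y|) := by
                rw [← Real.exp_add, Real.exp_le_exp]; linarith [abs_nonneg y]
              nlinarith [mul_le_mul_of_nonneg_left e2 hB0']
      rw [Real.norm_eq_abs, hW', abs_mul, abs_mul, Real.abs_exp]
      calc _ ≤ (A * (Real.exp |x| * Real.exp (|s| * |y|))) *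
            ((Real.exp 2 * B + Real.exp 1 * B') * Real.exp (2 * |y|) * Real.exp |y|) := by
            gcongr
            exact (hA _).trans (by gcongr; exact abs_add_mul_exp_le x s y)
        _ = _ := by
            have : Real.exp ((|s| + 3) * |y|) =
                Real.exp (|s| * |y|) * Real.exp (2 * |y|) * Real.exp |y| := by
              rw [← Real.exp_add, ← Real.exp_add]; ring_nf
            rw [this]; ring
    · refine HasDerivAt.const_mul _ ?_
      have h1 : HasDerivAt (fun d => P (y - d)) (-P' (y - d)) d := (hP _).comp_const_sub y d
      have h2 : HasDerivAt (fun d => Real.exp (y * d - d ^ 2 / 2))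
          (Real.exp (y * d - d ^ 2 / 2) * (y - d)) d := by
        have : HasDerivAt (fun d => y * d - d ^ 2 / 2) (y - d) d := by
          have := ((hasDerivAt_id d).const_mul y).sub (((hasDerivAt_id d).pow 2).div_const 2)
          refine this.congr_deriv ?_
          simp only [id]
          ring
        exact this.exp
      refine (h1.fun_mul h2).congr_deriv ?_
      ring
  have hrw : ∀ z, ∫ y, g (z + s * y) * P y ∂(gaussianReal 0 1) =
      ∫ y, W ((z - x) / s) y ∂(gaussianReal 0 1) := by
    intro z
    rw [integral_gaussianReal_shift _ ((z - x) / s)]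
    refine integral_congr_ae (ae_of_all _ fun y => ?_)
    have : z + s * (y - (z - x) / s) = x + s * y := by field_simp; ring
    simp only [hW, this]
    ring
  have hlin : HasDerivAt (fun z => (z - x) / s) (1 / s) x :=
    ((hasDerivAt_id x).sub_const x).div_const s
  have key' : HasDerivAt (fun d => ∫ y, W d y ∂(gaussianReal 0 1))
      (∫ y, W' 0 y ∂(gaussianReal 0 1)) ((x - x) / s) := by simpa using key
  have := key'.comp x hlin
  rw [show (fun x => ∫ y, g (x + s * y) * P y ∂(gaussianReal 0 1)) =
    (fun d => ∫ y, W d y ∂(gaussianReal 0 1)) ∘ (fun z => (z - x) / s) from funext hrw]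
  refine this.congr_deriv ?_
  rw [mul_comm, one_div]
  congr 1
  refine integral_congr_ae (ae_of_all _ fun y => ?_)
  simp [hW']

/-- The semigroup property of Gaussian smoothing. -/
theorem gaussSmooth_gaussSmooth {f : ℝ → ℝ} (hf : Measurable f) (hfg : ExpGrowth f) (s s' : ℝ) :
    gaussSmooth s (gaussSmooth s' f) = gaussSmooth √(s ^ 2 + s' ^ 2) f := by
  ext x
  have hmap : ∀ a : ℝ, (gaussianReal 0 1).map (fun y => a * y) =
      gaussianReal 0 (a ^ 2).toNNReal := by
    intro a
    have h := gaussianReal_map_const_mul (μ := 0) (v := 1) a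
    rw [mul_zero, mul_one] at h
    rw [Real.toNNReal_of_nonneg (sq_nonneg a)]
    exact h
  have hint : ∀ a : ℝ, ∀ F : ℝ → ℝ, Measurable F → ∫ y, F (a * y) ∂(gaussianReal 0 1) =
      ∫ y, F y ∂(gaussianReal 0 (a ^ 2).toNNReal) := by
    intro a F hF
    rw [← hmap, integral_map (by fun_prop) (by fun_prop)]
  have hv : (√(s ^ 2 + s' ^ 2) ^ 2).toNNReal =
      (s ^ 2).toNNReal + (s' ^ 2).toNNReal := by
    rw [Real.sq_sqrt (by positivity), Real.toNNReal_add (sq_nonneg _) (sq_nonneg _)]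
  have hG : gaussSmooth √(s ^ 2 + s' ^ 2) f x =
      ∫ z, f (x + z) ∂(gaussianReal 0 (s ^ 2).toNNReal ∗
        gaussianReal 0 (s' ^ 2).toNNReal) := by
    rw [gaussianReal_conv_gaussianReal, add_zero, ← hv,
      ← hint _ (fun z => f (x + z)) (by fun_prop)]
    rfl
  have hintg : Integrable (fun z => f (x + z)) (gaussianReal 0 (s ^ 2).toNNReal ∗
        gaussianReal 0 (s' ^ 2).toNNReal) := by
    have hfx : Measurable fun z => f (x + z) := by fun_prop
    rw [gaussianReal_conv_gaussianReal, add_zero, ← hv, ← hmap,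
      integrable_map_measure hfx.aestronglyMeasurable (by fun_prop)]
    exact integrable_comp_gaussianReal hf hfg x _
  rw [hG, integral_conv hintg]
  rw [← hint s (fun w => ∫ y, f (x + (w + y)) ∂(gaussianReal 0 (s' ^ 2).toNNReal))]
  · refine integral_congr_ae (ae_of_all _ fun y => ?_)
    simp only
    rw [← hint s' (fun z => f (x + (s * y + z))) (by fun_prop)]
    simp only [gaussSmooth, add_assoc]
  · have : StronglyMeasurable (Function.uncurry fun w y : ℝ => f (x + (w + y))) := by
      apply Measurable.stronglyMeasurable
      exact hf.comp (by fun_prop)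
    exact this.integral_prod_right.measurable

theorem expGrowth_abs_rpow {q : ℝ} (hq : 0 ≤ q) : ExpGrowth fun y : ℝ => |y| ^ q := by
  obtain ⟨k, hk⟩ := exists_nat_ge q
  refine expGrowth_of_abs_le_rpow (A := 1) zero_le_one hk fun x => ?_
  rw [one_mul, abs_of_nonneg (by positivity)]
  gcongr
  linarith

theorem integrable_abs_rpow_gaussianReal {q : ℝ} (hq : 0 ≤ q) :
    Integrable (fun y : ℝ => |y| ^ q) (gaussianReal 0 1) := by
  simpa using integrable_comp_gaussianReal (f := fun y : ℝ => |y| ^ q)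
    (by fun_prop) (expGrowth_abs_rpow hq) 0 1

/-- Take `g = 1` in `hasDerivAt_integral_weight`: the integral does not depend on `x`. This centres
the Hermite weights. -/
theorem integral_weight_eq_zero {P P' : ℝ → ℝ} (hP : ∀ y, HasDerivAt P (P' y) y)
    (hP' : Measurable P') (hPg : ExpGrowth P) (hPg' : ExpGrowth P') :
    ∫ y, (y * P y - P' y) ∂(gaussianReal 0 1) = 0 := by
  have h := hasDerivAt_integral_weight (g := fun _ => 1) measurable_const (expGrowth_const 1)
    hP hP' hPg hPg' one_pos 0
  simp only [one_mul, inv_one] at h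
  exact h.unique (hasDerivAt_const _ _)

theorem abs_gaussSmooth_sub_le {g : ℝ → ℝ} (hg : Measurable g) (hgg : ExpGrowth g) (s : ℝ)
    {x y b : ℝ} (h : ∀ z, |g (x + z) - g (y + z)| ≤ b) :
    |gaussSmooth s g x - gaussSmooth s g y| ≤ b := by
  rw [gaussSmooth, gaussSmooth, ← integral_sub (integrable_comp_gaussianReal hg hgg x s)
    (integrable_comp_gaussianReal hg hgg y s), ← Real.norm_eq_abs]
  refine (norm_integral_le_of_norm_le_const (ae_of_all _ fun z => h (s * z))).trans ?_
  simp

theorem continuous_of_holder {g : ℝ → ℝ} {α : ℝ} (hα : 0 < α)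
    (hg : ∀ x y, |g x - g y| ≤ |x - y| ^ α) : Continuous g := by
  refine continuous_iff_continuousAt.2 fun x => ?_
  rw [ContinuousAt, tendsto_iff_dist_tendsto_zero]
  have h0 : Filter.Tendsto (fun y => |y - x| ^ α) (nhds x) (nhds 0) := by
    have : Continuous fun y : ℝ => |y - x| ^ α :=
      (by fun_prop : Continuous fun y : ℝ => |y - x|).rpow_const fun _ => Or.inr hα.le
    have h := this.tendsto x
    simpa [Real.zero_rpow hα.ne'] using h
  exact squeeze_zero (fun _ => dist_nonneg) (fun y => by rw [Real.dist_eq]; exact hg y x) h0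

theorem abs_le_of_holder {g : ℝ → ℝ} {α : ℝ} (hα : 0 < α)
    (hg : ∀ x y, |g x - g y| ≤ |x - y| ^ α) (x : ℝ) :
    |g x| ≤ (|g 0| + 1) * (1 + |x|) ^ α := by
  have h1 := hg x 0
  rw [sub_zero] at h1
  have h2 : |x| ^ α ≤ (1 + |x|) ^ α := by gcongr; linarith
  have h3 : 1 ≤ (1 + |x|) ^ α := Real.one_le_rpow (by linarith [abs_nonneg x]) hα.le
  have h4 := abs_sub_abs_le_abs_sub (g x) (g 0)
  nlinarith [abs_nonneg (g 0)]

theorem expGrowth_of_holder {g : ℝ → ℝ} {α : ℝ} (hα : 0 < α) 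
    (hg : ∀ x y, |g x - g y| ≤ |x - y| ^ α) : ExpGrowth g := by
  obtain ⟨k, hk⟩ := exists_nat_ge α
  exact expGrowth_of_abs_le_rpow (by positivity) hk (abs_le_of_holder hα hg)

/-- The weight has mean zero, so `g (x + s * y)` may be replaced by `g (x + s * y) - g x`, which is
at most `s ^ α * |y| ^ α`. -/
theorem abs_integral_weight_le {g P : ℝ → ℝ} {α : ℝ} (hα : 0 < α)
    (hg : ∀ x y, |g x - g y| ≤ |x - y| ^ α) (hP : Measurable P) (hPg : ExpGrowth P)
    (hP0 : ∫ y, P y ∂(gaussianReal 0 1) = 0) {s : ℝ} (hs : 0 < s) (x : ℝ) :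
    |∫ y, g (x + s * y) * P y ∂(gaussianReal 0 1)| ≤
      s ^ α * ∫ y, |y| ^ α * |P y| ∂(gaussianReal 0 1) := by
  have hgm := (continuous_of_holder hα hg).measurable
  have hgg := expGrowth_of_holder hα hg
  have hPi : Integrable P (gaussianReal 0 1) := by
    simpa using integrable_comp_gaussianReal hP hPg 0 1
  have h1 : ∫ y, g (x + s * y) * P y ∂(gaussianReal 0 1) =
      ∫ y, (g (x + s * y) - g x) * P y ∂(gaussianReal 0 1) := by
    simp only [sub_mul]
    rw [integral_sub (integrable_comp_mul_gaussianReal hgm hP hgg hPg x s) (hPi.const_mul _),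
      integral_const_mul, hP0, mul_zero, sub_zero]
  rw [h1, ← integral_const_mul, ← Real.norm_eq_abs]
  refine norm_integral_le_of_norm_le (Integrable.const_mul ?_ _) (ae_of_all _ fun y => ?_)
  · obtain ⟨A, hA0, hA⟩ := hPg.exists_nonneg
    have h := integrable_comp_mul_gaussianReal (f := fun y : ℝ => |y| ^ α) (P := fun y => |P y|)
      (by fun_prop) (by fun_prop)
      (expGrowth_abs_rpow hα.le) ⟨A, fun x => by simpa using hA x⟩ 0 1
    simpa using h
  · rw [Real.norm_eq_abs, abs_mul, ← mul_assoc]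
    gcongr
    refine (hg _ _).trans (le_of_eq ?_)
    rw [add_sub_cancel_left, abs_mul, abs_of_pos hs, Real.mul_rpow hs.le (abs_nonneg _)]

/-- Derivatives of the smoothing of a Hölder function, with their bounds. -/
theorem exists_gaussSmooth_deriv_bounds {α : ℝ} (hα : 0 < α) :
    ∃ c : ℝ, 0 ≤ c ∧ ∀ g : ℝ → ℝ, (∀ x y, |g x - g y| ≤ |x - y| ^ α) → ∀ s : ℝ, 0 < s →
      ∃ d₁ d₂ d₃ : ℝ → ℝ, (∀ x, HasDerivAt (gaussSmooth s g) (d₁ x) x) ∧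
        (∀ x, HasDerivAt d₁ (d₂ x) x) ∧ (∀ x, HasDerivAt d₂ (d₃ x) x) ∧
        (∀ x, |d₁ x| ≤ c * s ^ (α - 1)) ∧ (∀ x, |d₂ x| ≤ c * s ^ (α - 2)) ∧
        (∀ x, |d₃ x| ≤ c * s ^ (α - 3)) := by
  have e0 : ExpGrowth fun _ : ℝ => (0 : ℝ) := expGrowth_const 0
  have e1 : ExpGrowth fun _ : ℝ => (1 : ℝ) := expGrowth_const 1
  have e2 : ExpGrowth fun y : ℝ => y :=
    expGrowth_of_abs_le_pow (A := 1) (k := 1) zero_le_one fun x => by simp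
  have e3 : ExpGrowth fun y : ℝ => y ^ 2 - 1 :=
    expGrowth_of_abs_le_pow (A := 1) (k := 2) zero_le_one fun x => by
      rw [one_mul, add_sq, sq_abs, abs_le]
      constructor <;> nlinarith [abs_nonneg x, sq_nonneg x]
  have e4 : ExpGrowth fun y : ℝ => y ^ 3 - 3 * y :=
    expGrowth_of_abs_le_pow (A := 1) (k := 3) zero_le_one fun x => by
      have h : |x ^ 3 - 3 * x| ≤ |x| ^ 3 + 3 * |x| := by
        refine (abs_sub _ _).trans ?_
        rw [abs_pow, abs_mul]; simp
      nlinarith [abs_nonneg x, sq_nonneg |x|]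
  have e5 : ExpGrowth fun y : ℝ => 2 * y :=
    expGrowth_of_abs_le_pow (A := 2) (k := 1) zero_le_two fun x => by
      rw [abs_mul]; simp
  have D1 : ∀ y : ℝ, HasDerivAt (fun _ : ℝ => (1 : ℝ)) 0 y := fun y => hasDerivAt_const y 1
  have D2 : ∀ y : ℝ, HasDerivAt (fun y : ℝ => y) 1 y := fun y => hasDerivAt_id y
  have D3 : ∀ y : ℝ, HasDerivAt (fun y : ℝ => y ^ 2 - 1) (2 * y) y := fun y => by
    simpa using (hasDerivAt_pow 2 y).sub_const 1
  -- The weights are the Hermite polynomials `y`, `y ^ 2 - 1`, `y ^ 3 - 3 * y`, generated from `1`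
  -- by `P ↦ y * P - P'`; each derivative brings one factor `s⁻¹`.
  have Z1 : ∫ y, y ∂(gaussianReal 0 1) = 0 := by
    simp
  have Z2 : ∫ y, (y ^ 2 - 1) ∂(gaussianReal 0 1) = 0 := by
    simpa [sq] using integral_weight_eq_zero D2 measurable_const e2 e1
  have r3 : ∀ y : ℝ, y * (y ^ 2 - 1) - 2 * y = y ^ 3 - 3 * y := fun y => by ring
  have Z3 : ∫ y, (y ^ 3 - 3 * y) ∂(gaussianReal 0 1) = 0 := by
    simpa only [r3] using integral_weight_eq_zero D3 (by fun_prop) e3 e5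
  set c₁ := ∫ y, |y| ^ α * |y| ∂(gaussianReal 0 1)
  set c₂ := ∫ y, |y| ^ α * |y ^ 2 - 1| ∂(gaussianReal 0 1)
  set c₃ := ∫ y, |y| ^ α * |y ^ 3 - 3 * y| ∂(gaussianReal 0 1)
  have hc₁ : 0 ≤ c₁ := integral_nonneg fun y => by positivity
  have hc₂ : 0 ≤ c₂ := integral_nonneg fun y => by positivity
  have hc₃ : 0 ≤ c₃ := integral_nonneg fun y => by positivity
  refine ⟨c₁ + c₂ + c₃, by positivity, fun g hg s hs => ?_⟩
  have hgm := (continuous_of_holder hα hg).measurable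
  have hgg := expGrowth_of_holder hα hg
  refine ⟨fun x => s⁻¹ * ∫ y, g (x + s * y) * y ∂(gaussianReal 0 1),
    fun x => s⁻¹ * (s⁻¹ * ∫ y, g (x + s * y) * (y ^ 2 - 1) ∂(gaussianReal 0 1)),
    fun x => s⁻¹ * (s⁻¹ * (s⁻¹ * ∫ y, g (x + s * y) * (y ^ 3 - 3 * y) ∂(gaussianReal 0 1))),
    fun x => ?_, fun x => ?_, fun x => ?_, fun x => ?_, fun x => ?_, fun x => ?_⟩
  · have h := hasDerivAt_integral_weight hgm hgg D1 measurable_const e1 e0 hs x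
    simp only [mul_one, sub_zero] at h
    exact h
  · have h := hasDerivAt_integral_weight hgm hgg D2 measurable_const e2 e1 hs x
    simpa [sq] using h.const_mul s⁻¹
  · have h := hasDerivAt_integral_weight hgm hgg D3 (by fun_prop) e3 e5 hs x
    simp only [r3] at h
    exact (h.const_mul s⁻¹).const_mul s⁻¹
  · have h := abs_integral_weight_le hα hg measurable_id e2 Z1 hs x
    simp only [id] at h
    rw [abs_mul, abs_of_pos (inv_pos.2 hs), Real.rpow_sub hs, Real.rpow_one]
    calc _ ≤ s⁻¹ * (s ^ α * c₁) := by gcongr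
      _ ≤ s⁻¹ * (s ^ α * (c₁ + c₂ + c₃)) := by gcongr; linarith
      _ = _ := by field_simp
  · have h := abs_integral_weight_le hα hg (by fun_prop) e3 Z2 hs x
    rw [abs_mul, abs_mul, abs_of_pos (inv_pos.2 hs), Real.rpow_sub hs, Real.rpow_ofNat]
    calc _ ≤ s⁻¹ * (s⁻¹ * (s ^ α * c₂)) := by gcongr
      _ ≤ s⁻¹ * (s⁻¹ * (s ^ α * (c₁ + c₂ + c₃))) := by gcongr; linarith
      _ = _ := by field_simp
  · have h := abs_integral_weight_le hα hg (by fun_prop) e4 Z3 hs x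
    rw [abs_mul, abs_mul, abs_mul, abs_of_pos (inv_pos.2 hs), Real.rpow_sub hs, Real.rpow_ofNat]
    calc _ ≤ s⁻¹ * (s⁻¹ * (s⁻¹ * (s ^ α * c₃))) := by gcongr
      _ ≤ s⁻¹ * (s⁻¹ * (s⁻¹ * (s ^ α * (c₁ + c₂ + c₃)))) := by gcongr; linarith
      _ = _ := by field_simp

/-! ### Taylor bounds and growth -/

theorem abs_sub_zero_le_of_deriv_le {g g' : ℝ → ℝ} (hg : ∀ x, HasDerivAt g (g' x) x) {u C : ℝ}
    (hC : ∀ v, |v| ≤ |u| → |g' v| ≤ C) : |g u - g 0| ≤ C * |u| := by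
  have h := (convex_closedBall (0 : ℝ) |u|).norm_image_sub_le_of_norm_hasDerivWithin_le
    (f := g) (f' := g') (C := C) (x := 0) (y := u) (fun x _ => (hg x).hasDerivWithinAt)
    (fun x hx => hC x (by simpa using hx)) (by simp) (by simp)
  simpa using h

theorem abs_taylor_one_le {f f' : ℝ → ℝ} (hf : ∀ x, HasDerivAt f (f' x) x) {x u ω : ℝ}
    (hω : ∀ v, |v| ≤ |u| → |f' (x + v) - f' x| ≤ ω) :
    |f (x + u) - f x - f' x * u| ≤ ω * |u| := by
  have h := abs_sub_zero_le_of_deriv_le (g := fun v => f (x + v) - f' x * v)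
    (g' := fun v => f' (x + v) - f' x) (u := u) (C := ω) (fun v => ?_) hω
  · simp only [add_zero, mul_zero, sub_zero] at h
    rwa [sub_right_comm]
  · have h1 : HasDerivAt (fun v => f (x + v)) (f' (x + v)) v := (hf _).comp_const_add x v
    simpa using h1.fun_sub ((hasDerivAt_id v).const_mul (f' x))

theorem abs_taylor_two_le {f f₁ f₂ : ℝ → ℝ} (hf : ∀ x, HasDerivAt f (f₁ x) x)
    (hf₁ : ∀ x, HasDerivAt f₁ (f₂ x) x) {x u ω : ℝ}
    (hω : ∀ v, |v| ≤ |u| → |f₂ (x + v) - f₂ x| ≤ ω) :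
    |f (x + u) - f x - f₁ x * u - f₂ x * u ^ 2 / 2| ≤ ω * u ^ 2 := by
  have hω0 : 0 ≤ ω := (abs_nonneg _).trans (hω 0 (by simp))
  have h := abs_sub_zero_le_of_deriv_le (g := fun v => f (x + v) - f₁ x * v - f₂ x * v ^ 2 / 2)
    (g' := fun v => f₁ (x + v) - f₁ x - f₂ x * v) (u := u) (C := ω * |u|) (fun v => ?_)
    (fun v hv => ?_)
  · simp only [add_zero, mul_zero, sub_zero, ne_eq, OfNat.ofNat_ne_zero, not_false_eq_true,
      zero_pow, zero_div] at h
    rw [mul_assoc, ← sq, sq_abs] at h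
    convert h using 2
    ring
  · have h1 : HasDerivAt (fun v => f (x + v)) (f₁ (x + v)) v := (hf _).comp_const_add x v
    have h2 := (h1.fun_sub ((hasDerivAt_id v).const_mul (f₁ x))).fun_sub
      (((hasDerivAt_pow 2 v).const_mul (f₂ x)).div_const 2)
    refine h2.congr_deriv ?_
    simp
    ring
  · have h1 := abs_taylor_one_le hf₁ (x := x) (u := v) (ω := ω) fun w hw => hω w (hw.trans hv)
    exact h1.trans (by gcongr)

theorem abs_le_rpow_succ_of_deriv_le {g g' : ℝ → ℝ} (hg : ∀ x, HasDerivAt g (g' x) x) {A q : ℝ}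
    (hA : 0 ≤ A) (hq : 0 ≤ q) (h : ∀ x, |g' x| ≤ A * (1 + |x|) ^ q) (x : ℝ) :
    |g x| ≤ (|g 0| + A) * (1 + |x|) ^ (q + 1) := by
  have h1 := abs_sub_zero_le_of_deriv_le hg (u := x) (C := A * (1 + |x|) ^ q)
    fun v hv => (h v).trans (by gcongr)
  have h2 : 1 ≤ (1 + |x|) ^ (q + 1) :=
    Real.one_le_rpow (by linarith [abs_nonneg x]) (by linarith)
  have h3 : (1 + |x|) ^ (q + 1) = (1 + |x|) ^ q * (1 + |x|) := by
    rw [Real.rpow_add (by positivity), Real.rpow_one]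
  have h4 := abs_sub_abs_le_abs_sub (g x) (g 0)
  have h5 : A * (1 + |x|) ^ q * |x| ≤ A * (1 + |x|) ^ (q + 1) := by
    rw [h3, mul_assoc]; gcongr; linarith
  nlinarith [abs_nonneg (g 0)]

/-- Growth of a `C²` function whose second derivative has increments of order `|x|^q`. -/
theorem exists_growth_of_increment_le {f f₁ f₂ : ℝ → ℝ} (hf : ∀ x, HasDerivAt f (f₁ x) x)
    (hf₁ : ∀ x, HasDerivAt f₁ (f₂ x) x) {κ q : ℝ} (hκ : 0 ≤ κ) (hq : 0 ≤ q)
    (h : ∀ x, |f₂ x - f₂ 0| ≤ κ * (1 + |x| ^ q)) :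
    ∃ A, 0 ≤ A ∧ (∀ x, |f x| ≤ A * (1 + |x|) ^ (q + 2)) ∧
      (∀ x, |f₁ x| ≤ A * (1 + |x|) ^ (q + 1)) ∧ (∀ x, |f₂ x| ≤ A * (1 + |x|) ^ q) := by
  have a2 : ∀ x, |f₂ x| ≤ (|f₂ 0| + 2 * κ) * (1 + |x|) ^ q := fun x => by
    have h1 := abs_sub_abs_le_abs_sub (f₂ x) (f₂ 0)
    have h2 : 1 ≤ (1 + |x|) ^ q := Real.one_le_rpow (by linarith [abs_nonneg x]) hq
    have h3 : |x| ^ q ≤ (1 + |x|) ^ q := by gcongr; linarith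
    nlinarith [h x, abs_nonneg (f₂ 0)]
  have a1 := abs_le_rpow_succ_of_deriv_le hf₁ (by positivity) hq a2
  have a0 := abs_le_rpow_succ_of_deriv_le hf (by positivity) (by positivity) a1
  refine ⟨|f 0| + (|f₁ 0| + (|f₂ 0| + 2 * κ)), by positivity, fun x => ?_, fun x => ?_,
    fun x => ?_⟩
  · convert a0 x using 3; ring
  · refine (a1 x).trans ?_
    refine mul_le_mul_of_nonneg_right ?_ (by positivity)
    linarith [abs_nonneg (f 0)]
  · refine (a2 x).trans ?_
    refine mul_le_mul_of_nonneg_right ?_ (by positivity)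
    linarith [abs_nonneg (f 0), abs_nonneg (f₁ 0)]

/-! ### Distance of a function to its smoothing -/

theorem abs_gaussSmooth_sub_self_le {f : ℝ → ℝ} {α : ℝ} (hα : 0 < α)
    (hf : ∀ x y, |f x - f y| ≤ |x - y| ^ α) (s x : ℝ) :
    |gaussSmooth s f x - f x| ≤ |s| ^ α * ∫ y, |y| ^ α ∂(gaussianReal 0 1) := by
  have h1 : gaussSmooth s f x - f x = ∫ y, (f (x + s * y) - f x) ∂(gaussianReal 0 1) := by
    rw [integral_sub (integrable_comp_gaussianReal (continuous_of_holder hα hf).measurable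
      (expGrowth_of_holder hα hf) x s) (integrable_const _)]
    simp [gaussSmooth]
  rw [h1, ← integral_const_mul, ← Real.norm_eq_abs]
  refine norm_integral_le_of_norm_le ((integrable_abs_rpow_gaussianReal hα.le).const_mul _)
    (ae_of_all _ fun y => ?_)
  rw [Real.norm_eq_abs]
  refine (hf _ _).trans (le_of_eq ?_)
  rw [add_sub_cancel_left, abs_mul, Real.mul_rpow (abs_nonneg _) (abs_nonneg _)]

theorem expGrowth_of_deriv_holder {f f' : ℝ → ℝ} {α : ℝ} (hα : 0 < α)
    (hd : ∀ x, HasDerivAt f (f' x) x) (hf : ∀ x y, |f' x - f' y| ≤ |x - y| ^ α) :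
    ExpGrowth f := by
  obtain ⟨k, hk⟩ := exists_nat_ge (α + 1)
  exact expGrowth_of_abs_le_rpow (by positivity) hk
    (abs_le_rpow_succ_of_deriv_le hd (by positivity) hα.le (abs_le_of_holder hα hf))

/-- The first order Taylor term has zero Gaussian mean, so only the remainder, of order `|s * y| ^
(α + 1)`, contributes. -/
theorem abs_gaussSmooth_sub_self_le_of_deriv {f f' : ℝ → ℝ} {α : ℝ} (hα : 0 < α)
    (hd : ∀ x, HasDerivAt f (f' x) x) (hf : ∀ x y, |f' x - f' y| ≤ |x - y| ^ α) (s x : ℝ) :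
    |gaussSmooth s f x - f x| ≤ |s| ^ (α + 1) * ∫ y, |y| ^ (α + 1) ∂(gaussianReal 0 1) := by
  have hfm : Measurable f :=
    (continuous_iff_continuousAt.2 fun x => (hd x).continuousAt).measurable
  have hi := integrable_comp_gaussianReal hfm (expGrowth_of_deriv_holder hα hd hf) x s
  have hy : Integrable (fun y : ℝ => y) (gaussianReal 0 1) := by
    simpa [Function.id_def] using (memLp_id_gaussianReal (μ := 0) (v := 1) 1).integrable le_rfl
  have h1 : gaussSmooth s f x - f x =
      ∫ y, (f (x + s * y) - f x - f' x * (s * y)) ∂(gaussianReal 0 1) := by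
    rw [integral_sub (f := fun y => f (x + s * y) - f x) (hi.sub (integrable_const _)) ((hy.const_mul s).const_mul _),
      integral_sub hi (integrable_const _), integral_const_mul, integral_const_mul,
      integral_id_gaussianReal]
    simp [gaussSmooth]
  rw [h1, ← integral_const_mul, ← Real.norm_eq_abs]
  refine norm_integral_le_of_norm_le ((integrable_abs_rpow_gaussianReal (by positivity)).const_mul _)
    (ae_of_all _ fun y => ?_)
  rw [Real.norm_eq_abs]
  refine (abs_taylor_one_le hd (ω := |s * y| ^ α) fun v hv => (hf _ _).trans ?_).trans
    (le_of_eq ?_)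
  · rw [add_sub_cancel_left]; gcongr
  · rw [← Real.mul_rpow (abs_nonneg _) (abs_nonneg _), ← abs_mul,
      Real.rpow_add_one' (abs_nonneg _) (by positivity)]

/-! ### Dyadic summation by parts -/

/-- In the application, `e a k` pairs a factor frozen at time `a` with the square at time `k + 1`.
The block is halved: on its second half the freezing time first moves from `a` to the midpoint, at
the price of one `δ L`, and then induction applies to both halves. -/
theorem abs_sum_block_le {n : ℕ} {e : ℕ → ℕ → ℝ} {δ : ℕ → ℕ → ℝ}
    (hδ0 : ∀ j t, 0 ≤ δ j t)
    (hδ : ∀ j s t, 1 ≤ s → s ≤ t → δ j t ≤ δ j s)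
    (hblock : ∀ j b, b + 2 * 2 ^ j ≤ n →
      |∑ k ∈ Finset.range (2 ^ j), (e (b + 2 ^ j) (b + 2 ^ j + k) - e b (b + 2 ^ j + k))| ≤
        δ j (n - (b + 2 ^ j))) (L : ℕ) :
    ∀ a, a + 2 ^ L ≤ n → |∑ k ∈ Finset.range (2 ^ L), (e (a + k) (a + k) - e a (a + k))| ≤
      ∑ j ∈ Finset.range L, ((2 : ℝ) ^ j)⁻¹ * ∑ t ∈ Finset.Ioc (n - (a + 2 ^ L)) (n - a), δ j t := by
  induction L with
  | zero => intro a _; simp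
  | succ L ih =>
    intro a ha
    have hpow : 2 ^ (L + 1) = 2 ^ L + 2 ^ L := by rw [pow_succ]; ring
    rw [hpow] at ha ⊢
    have hpos : 0 < 2 ^ L := by positivity
    generalize hN : 2 ^ L = N at *
    have hN' : (2 : ℝ) ^ L = N := by rw [← hN]; push_cast; rfl
    have h1 := ih a (by omega)
    have h2 := ih (a + N) (by omega)
    have h3 := hblock L a (by omega)
    rw [hN] at h3
    have hsplit : ∑ k ∈ Finset.range (N + N), (e (a + k) (a + k) - e a (a + k)) =
        ∑ k ∈ Finset.range N, (e (a + k) (a + k) - e a (a + k)) +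
        (∑ k ∈ Finset.range N, (e (a + N + k) (a + N + k) - e (a + N) (a + N + k)) +
        ∑ k ∈ Finset.range N, (e (a + N) (a + N + k) - e a (a + N + k))) := by
      rw [Finset.sum_range_add, ← Finset.sum_add_distrib (s := Finset.range N)
        (f := fun k => e (a + N + k) (a + N + k) - e (a + N) (a + N + k))]
      congr 1
      refine Finset.sum_congr rfl fun k _ => ?_
      rw [← add_assoc]; ring
    -- As `δ L` is antitone, its value at `n - (a + N)` is at most its average over the `N` integers
    -- ending there. This replaces a single value by a sum over the remaining times in the second
    -- half, and such sums add up over consecutive blocks.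
    have h4 : δ L (n - (a + N)) ≤ ((2 : ℝ) ^ L)⁻¹ *
        ∑ t ∈ Finset.Ioc (n - (a + (N + N))) (n - a), δ L t := by
      rw [hN', le_inv_mul_iff₀ (by positivity)]
      calc (N : ℝ) * δ L (n - (a + N)) =
            ∑ t ∈ Finset.Ioc (n - (a + (N + N))) (n - (a + N)), δ L (n - (a + N)) := by
            rw [Finset.sum_const, Nat.card_Ioc, nsmul_eq_mul]
            congr 2
            omega
        _ ≤ ∑ t ∈ Finset.Ioc (n - (a + (N + N))) (n - (a + N)), δ L t := by
            refine Finset.sum_le_sum fun t ht => ?_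
            rw [Finset.mem_Ioc] at ht
            exact hδ L t _ (by omega) ht.2
        _ ≤ _ := by
            refine Finset.sum_le_sum_of_subset_of_nonneg
              (Finset.Ioc_subset_Ioc_right (by omega)) fun t _ _ => hδ0 L t
    rw [hsplit, Finset.sum_range_succ]
    refine (abs_add_le _ _).trans ?_
    refine (add_le_add h1 ((abs_add_le _ _).trans (add_le_add h2 (h3.trans h4)))).trans ?_
    rw [← add_assoc, ← Finset.sum_add_distrib]
    gcongr with j hj
    rw [← mul_add, add_assoc a N N, add_comm (∑ t ∈ Finset.Ioc _ (n - a), δ j t),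
      Finset.sum_Ioc_consecutive _ (by omega) (by omega)]

/-- Dyadic decomposition of a sum of adapted increments: differences of the first argument over
dyadic blocks of length `2 ^ j` are controlled by `δ j`, those from the origin by `η j`. -/
theorem abs_sum_prefix_le {n : ℕ} {e : ℕ → ℕ → ℝ} {δ : ℕ → ℕ → ℝ} {η : ℕ → ℝ}
    (hδ0 : ∀ j t, 0 ≤ δ j t) (hη0 : ∀ j, 0 ≤ η j)
    (hδ : ∀ j s t, 1 ≤ s → s ≤ t → δ j t ≤ δ j s)
    (hblock : ∀ j b, b + 2 * 2 ^ j ≤ n →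
      |∑ k ∈ Finset.range (2 ^ j), (e (b + 2 ^ j) (b + 2 ^ j + k) - e b (b + 2 ^ j + k))| ≤
        δ j (n - (b + 2 ^ j)))
    (hprefix : ∀ j m, m < 2 ^ j → m + 2 ^ j ≤ n →
      |∑ k ∈ Finset.range (2 ^ j), (e m (m + k) - e 0 (m + k))| ≤ η j) (J : ℕ) :
    ∀ m, m < 2 ^ J → m ≤ n → |∑ k ∈ Finset.range m, (e k k - e 0 k)| ≤
      ∑ j ∈ Finset.range J, (((2 : ℝ) ^ j)⁻¹ * ∑ t ∈ Finset.Ioc (n - m) n, δ j t + η j) := by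
  induction J with
  | zero =>
    intro m hm _
    obtain rfl : m = 0 := by simpa using hm
    simp
  | succ J ih =>
    intro m hm hmn
    rw [Finset.sum_range_succ]
    have hnn : 0 ≤ ((2 : ℝ) ^ J)⁻¹ * ∑ t ∈ Finset.Ioc (n - m) n, δ J t :=
      mul_nonneg (by positivity) (Finset.sum_nonneg fun t _ => hδ0 J t)
    by_cases hmJ : m < 2 ^ J
    · have := ih m hmJ hmn
      linarith [hη0 J]
    · rw [pow_succ] at hm
      -- The leading binary digit of `m` is used last: a prefix `m' < 2 ^ J` is followed by a block
      -- of length `2 ^ J`, whose freezing time is moved to `m'` by `abs_sum_block_le` and then to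
      -- `0` by `hprefix`.
      obtain ⟨m', rfl⟩ : ∃ m', m = m' + 2 ^ J := ⟨m - 2 ^ J, by omega⟩
      have h1 := ih m' (by omega) (by omega)
      have h2 := abs_sum_block_le hδ0 hδ hblock J m' hmn
      have h3 := hprefix J m' (by omega) hmn
      have hsplit : ∑ k ∈ Finset.range (m' + 2 ^ J), (e k k - e 0 k) =
          ∑ k ∈ Finset.range m', (e k k - e 0 k) +
          (∑ k ∈ Finset.range (2 ^ J), (e (m' + k) (m' + k) - e m' (m' + k)) +
          ∑ k ∈ Finset.range (2 ^ J), (e m' (m' + k) - e 0 (m' + k))) := by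
        rw [Finset.sum_range_add, ← Finset.sum_add_distrib (s := Finset.range (2 ^ J))
          (f := fun k => e (m' + k) (m' + k) - e m' (m' + k))]
        congr 1
        exact Finset.sum_congr rfl fun k _ => by ring
      rw [hsplit]
      refine (abs_add_le _ _).trans ?_
      refine (add_le_add h1 ((abs_add_le _ _).trans (add_le_add h2 h3))).trans ?_
      rw [← add_assoc, ← add_assoc, ← Finset.sum_add_distrib]
      refine add_le_add (le_add_of_le_of_nonneg ?_ hnn) le_rfl
      refine Finset.sum_le_sum fun j _ => le_of_eq ?_
      rw [add_right_comm, ← mul_add, add_comm (∑ t ∈ Finset.Ioc (n - m') n, δ j t),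
        Finset.sum_Ioc_consecutive _ (by omega) (by omega)]

/-! ### Sums of powers -/

/-- Comparison with the integral of `t ^ (-a)`; the induction step is Bernoulli's inequality for the
exponent `1 - a ∈ (0, 1]`. -/
theorem sum_Ioc_rpow_neg_le {a : ℝ} (ha0 : 0 ≤ a) (ha1 : a < 1) (n : ℕ) :
    ∑ t ∈ Finset.Ioc 0 n, (t : ℝ) ^ (-a) ≤ (1 - a)⁻¹ * (n : ℝ) ^ (1 - a) := by
  induction n with
  | zero => simp [Real.zero_rpow (show 1 - a ≠ 0 by linarith)]
  | succ n ih =>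
    rw [Finset.sum_Ioc_succ_top (Nat.zero_le n)]
    refine (add_le_add ih le_rfl).trans ?_
    have hx : (0 : ℝ) < n + 1 := by positivity
    have hb : (1 + -(1 / ((n : ℝ) + 1))) ^ (1 - a) ≤ 1 + (1 - a) * -(1 / ((n : ℝ) + 1)) :=
      rpow_one_add_le_one_add_mul_self
        (by rw [neg_le_neg_iff, div_le_one hx]; linarith [(Nat.cast_nonneg n : (0 : ℝ) ≤ n)])
        (by linarith) (by linarith)
    have h1 : (n : ℝ) = (n + 1) * (1 + -(1 / ((n : ℝ) + 1))) := by field_simp; ring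
    have h2 : (n : ℝ) ^ (1 - a) ≤
        ((n : ℝ) + 1) ^ (1 - a) * (1 + (1 - a) * -(1 / ((n : ℝ) + 1))) := by
      rw [h1, Real.mul_rpow hx.le (by rw [← sub_eq_add_neg, sub_nonneg, div_le_one (by linarith)]; linarith [(Nat.cast_nonneg n : (0 : ℝ) ≤ n)]),
        ← h1]
      gcongr
    have h3 : ((n : ℝ) + 1) ^ (1 - a) = ((n : ℝ) + 1) * ((n : ℝ) + 1) ^ (-a) := by
      rw [sub_eq_add_neg, Real.rpow_add hx, Real.rpow_one]
    have h4 : ((n : ℝ) + 1) ^ (1 - a) * (1 + (1 - a) * -(1 / ((n : ℝ) + 1))) =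
        ((n : ℝ) + 1) ^ (1 - a) - (1 - a) * ((n : ℝ) + 1) ^ (-a) := by
      rw [h3]; field_simp; ring
    have h1a : 0 < 1 - a := by linarith
    push_cast
    rw [← sub_nonneg]
    have : 0 ≤ (1 - a)⁻¹ * (((n : ℝ) + 1) ^ (1 - a) - (1 - a) * ((n : ℝ) + 1) ^ (-a)
        - (n : ℝ) ^ (1 - a)) := mul_nonneg (by positivity) (by linarith)
    rw [mul_sub, mul_sub, inv_mul_cancel_left₀ h1a.ne'] at this
    linarith

/-- Telescoping comparison with the decrements of `t ^ (-c)`; the induction step is `1 + c x ≤ (1 -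
x) ^ (-c)`. -/
theorem sum_Ioc_rpow_neg_tail_le {c : ℝ} (hc : 0 < c) {M : ℕ} (hM : 1 ≤ M) {n : ℕ} (hn : M ≤ n) :
    ∑ t ∈ Finset.Ioc M n, (t : ℝ) ^ (-(1 + c)) ≤ c⁻¹ * ((M : ℝ) ^ (-c) - (n : ℝ) ^ (-c)) := by
  induction n, hn using Nat.le_induction with
  | base => simp
  | succ n hn ih =>
    rw [Finset.sum_Ioc_succ_top hn]
    refine (add_le_add ih le_rfl).trans ?_
    have hx : (0 : ℝ) < n + 1 := by positivity
    have hn0 : (0 : ℝ) < n := by exact_mod_cast (by omega : 0 < n)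
    have h1 : (n : ℝ) = (n + 1) * (1 - 1 / ((n : ℝ) + 1)) := by field_simp; ring
    have hq : 0 < 1 - 1 / ((n : ℝ) + 1) := by
      rw [sub_pos, div_lt_one hx]; linarith
    have hb : 1 + c * (1 / ((n : ℝ) + 1)) ≤ (1 - 1 / ((n : ℝ) + 1)) ^ (-c) := by
      rw [Real.rpow_def_of_pos hq]
      have hl := Real.log_le_sub_one_of_pos hq
      have he := Real.add_one_le_exp (Real.log (1 - 1 / ((n : ℝ) + 1)) * -c)
      nlinarith
    have h2 : ((n : ℝ) + 1) ^ (-c) * (1 + c * (1 / ((n : ℝ) + 1))) ≤ (n : ℝ) ^ (-c) := by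
      rw [h1, Real.mul_rpow hx.le hq.le, ← h1]
      gcongr
    have h3 : ((n : ℝ) + 1) ^ (-c) = ((n : ℝ) + 1) * ((n : ℝ) + 1) ^ (-(1 + c)) := by
      rw [neg_add, Real.rpow_add hx, Real.rpow_neg_one]; field_simp
    have h4 : ((n : ℝ) + 1) ^ (-c) * (1 + c * (1 / ((n : ℝ) + 1))) =
        ((n : ℝ) + 1) ^ (-c) + c * ((n : ℝ) + 1) ^ (-(1 + c)) := by
      rw [h3]; field_simp
    push_cast
    have : 0 ≤ c⁻¹ * ((n : ℝ) ^ (-c) - (((n : ℝ) + 1) ^ (-c) + c * ((n : ℝ) + 1) ^ (-(1 + c)))) :=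
      mul_nonneg (by positivity) (by linarith)
    rw [mul_sub, mul_add, inv_mul_cancel_left₀ hc.ne'] at this
    linarith

/-- Cut the sum at `t ≈ u ^ 2`. Below, the second terms sum to order `(u ^ 2) ^ ((p - 2) / 2)`;
above, the first terms sum to order `u * (u ^ 2) ^ (-(3 - p) / 2)`. Both are `u ^ (p - 2)`. The
upper tail converges because `p < 3`; at `p = 3` this is the source of the logarithm. -/
theorem exists_sum_min_le {p : ℝ} (hp2 : 2 < p) (hp3 : p < 3) :
    ∃ C : ℝ, 0 ≤ C ∧ ∀ (u : ℝ), 0 ≤ u → ∀ n : ℕ,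
      ∑ t ∈ Finset.Ioc 0 n, min ((t : ℝ) ^ ((p - 5) / 2) * u) ((t : ℝ) ^ ((p - 4) / 2)) ≤
        C * (1 + u ^ (p - 2)) := by
  have ha : (0 : ℝ) < (p - 2) / 2 := by linarith
  have hc : (0 : ℝ) < (3 - p) / 2 := by linarith
  refine ⟨((p - 2) / 2)⁻¹ + ((3 - p) / 2)⁻¹, by positivity, fun u hu n => ?_⟩
  set M : ℕ := ⌊u ^ 2⌋₊ + 1 with hM
  have hMu : u ^ 2 ≤ M := by rw [hM]; push_cast; exact (Nat.lt_floor_add_one _).le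
  have hMle : (M : ℝ) ≤ u ^ 2 + 1 := by
    rw [hM]; push_cast; linarith [Nat.floor_le (sq_nonneg u)]
  have hM1 : 1 ≤ M := by omega
  have hterm0 : ∀ t : ℕ, 0 ≤ min ((t : ℝ) ^ ((p - 5) / 2) * u) ((t : ℝ) ^ ((p - 4) / 2)) :=
    fun t => le_min (by positivity) (by positivity)
  have h1 : ∑ t ∈ Finset.Ioc 0 n, min ((t : ℝ) ^ ((p - 5) / 2) * u) ((t : ℝ) ^ ((p - 4) / 2)) ≤
      ∑ t ∈ Finset.Ioc 0 M, (t : ℝ) ^ ((p - 4) / 2) +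
      ∑ t ∈ Finset.Ioc M (max n M), (t : ℝ) ^ ((p - 5) / 2) * u := by
    calc _ ≤ ∑ t ∈ Finset.Ioc 0 (max n M),
          min ((t : ℝ) ^ ((p - 5) / 2) * u) ((t : ℝ) ^ ((p - 4) / 2)) :=
          Finset.sum_le_sum_of_subset_of_nonneg (Finset.Ioc_subset_Ioc_right (le_max_left _ _))
            fun t _ _ => hterm0 t
      _ = _ + _ := (Finset.sum_Ioc_consecutive _ (Nat.zero_le M) (le_max_right n M)).symm
      _ ≤ _ := by
          gcongr
          · exact min_le_right _ _
          · exact min_le_left _ _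
  have h2 := sum_Ioc_rpow_neg_le (a := (4 - p) / 2) (by linarith) (by linarith) M
  have h3 := sum_Ioc_rpow_neg_tail_le hc hM1 (le_max_right n M)
  rw [show -((4 - p) / 2) = (p - 4) / 2 by ring, show 1 - (4 - p) / 2 = (p - 2) / 2 by ring] at h2
  rw [show -(1 + (3 - p) / 2) = (p - 5) / 2 by ring] at h3
  have h4 : (M : ℝ) ^ ((p - 2) / 2) ≤ 1 + u ^ (p - 2) := by
    calc (M : ℝ) ^ ((p - 2) / 2) ≤ (u ^ 2 + 1) ^ ((p - 2) / 2) := by gcongr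
      _ ≤ (u ^ 2) ^ ((p - 2) / 2) + 1 ^ ((p - 2) / 2) :=
          Real.rpow_add_le_add_rpow (by positivity) zero_le_one ha.le (by linarith)
      _ = 1 + u ^ (p - 2) := by
          rw [Real.one_rpow, ← Real.rpow_natCast, ← Real.rpow_mul hu, add_comm]
          congr 2; push_cast; ring
  have h5 : (M : ℝ) ^ (-((3 - p) / 2)) * u ≤ 1 + u ^ (p - 2) := by
    rcases le_or_gt u 1 with hu1 | hu1
    · have : (M : ℝ) ^ (-((3 - p) / 2)) ≤ 1 :=
        Real.rpow_le_one_of_one_le_of_nonpos (by exact_mod_cast hM1) (by linarith)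
      have h6 : (M : ℝ) ^ (-((3 - p) / 2)) * u ≤ 1 * 1 := by gcongr
      linarith [Real.rpow_nonneg hu (p - 2)]
    · have hu0 : 0 < u := by linarith
      have h6 : (M : ℝ) ^ (-((3 - p) / 2)) ≤ (u ^ 2) ^ (-((3 - p) / 2)) :=
        Real.rpow_le_rpow_of_nonpos (by positivity) hMu (by linarith)
      have h7 : (u ^ 2) ^ (-((3 - p) / 2)) * u = u ^ (p - 2) := by
        rw [← Real.rpow_natCast, ← Real.rpow_mul hu, ← Real.rpow_add_one hu0.ne']
        congr 1; push_cast; ring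
      calc _ ≤ (u ^ 2) ^ (-((3 - p) / 2)) * u := by gcongr
        _ ≤ _ := by rw [h7]; linarith
  have h6 : ∑ t ∈ Finset.Ioc M (max n M), (t : ℝ) ^ ((p - 5) / 2) ≤
      ((3 - p) / 2)⁻¹ * (M : ℝ) ^ (-((3 - p) / 2)) := by
    refine h3.trans ?_
    gcongr
    linarith [Real.rpow_nonneg (Nat.cast_nonneg (α := ℝ) (max n M)) (-((3 - p) / 2))]
  rw [← Finset.sum_mul] at h1
  calc _ ≤ _ := h1
    _ ≤ ((p - 2) / 2)⁻¹ * (M : ℝ) ^ ((p - 2) / 2) +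
        ((3 - p) / 2)⁻¹ * (M : ℝ) ^ (-((3 - p) / 2)) * u := by gcongr
    _ ≤ ((p - 2) / 2)⁻¹ * (1 + u ^ (p - 2)) + ((3 - p) / 2)⁻¹ * (1 + u ^ (p - 2)) := by
        rw [mul_assoc ((3 - p) / 2)⁻¹]; gcongr
    _ = _ := by ring

/-- The sum is comparable to its largest term, attained at `J = max A`. It serves to replace all the
levels containing a given point by a single one. -/
theorem exists_sum_geom_le {α : ℝ} (hα : 0 < α) :
    ∃ C : ℝ, 0 ≤ C ∧ ∀ A : Finset ℕ, A.Nonempty →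
      ∃ J ∈ A, ∑ j ∈ A, ((2 : ℝ) ^ j) ^ α ≤ C * ((2 : ℝ) ^ J) ^ α := by
  have h2 : 1 < (2 : ℝ) ^ α := Real.one_lt_rpow one_lt_two hα
  have hr : ∀ j : ℕ, ((2 : ℝ) ^ j) ^ α = ((2 : ℝ) ^ α) ^ j := fun j => by
    rw [← Real.rpow_natCast, ← Real.rpow_natCast, ← Real.rpow_mul zero_le_two,
      ← Real.rpow_mul zero_le_two, mul_comm]
  refine ⟨(2 : ℝ) ^ α / ((2 : ℝ) ^ α - 1), div_nonneg (by positivity) (by linarith),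
    fun A hA => ⟨A.max' hA, A.max'_mem hA, ?_⟩⟩
  simp only [hr]
  calc ∑ j ∈ A, ((2 : ℝ) ^ α) ^ j ≤ ∑ j ∈ Finset.range (A.max' hA + 1), ((2 : ℝ) ^ α) ^ j :=
        Finset.sum_le_sum_of_subset_of_nonneg
          (fun j hj => Finset.mem_range.2 (Nat.lt_succ_of_le (A.le_max' j hj)))
          fun j _ _ => by positivity
    _ = (((2 : ℝ) ^ α) ^ (A.max' hA + 1) - 1) / ((2 : ℝ) ^ α - 1) := geom_sum_eq h2.ne' _
    _ ≤ ((2 : ℝ) ^ α) ^ (A.max' hA + 1) / ((2 : ℝ) ^ α - 1) := by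
        gcongr
        linarith
    _ = _ := by rw [pow_succ]; ring

/-- Exchange of summation for weighted sums along dyadic ranges. -/
theorem exists_tsum_dyadic_le {s : ℝ} (hs : 0 < s) :
    ∃ C : ℝ≥0∞, C ≠ ∞ ∧ ∀ x : ℕ → ℝ≥0∞,
      ∑' j : ℕ, ENNReal.ofReal (((2 : ℝ) ^ j) ^ (-s)) * ∑ n ∈ Finset.range (2 ^ j), x n ≤
        C * ∑' n : ℕ, ENNReal.ofReal (((n + 1 : ℕ) : ℝ) ^ (-s)) * x n := by
  set q : ℝ := (2 : ℝ) ^ (-s) with hq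
  have hq0 : 0 < q := by positivity
  have hq1 : q < 1 := Real.rpow_lt_one_of_one_lt_of_neg one_lt_two (by linarith)
  have hr : ∀ j : ℕ, ((2 : ℝ) ^ j) ^ (-s) = q ^ j := fun j => by
    rw [hq, ← Real.rpow_natCast, ← Real.rpow_natCast, ← Real.rpow_mul zero_le_two,
      ← Real.rpow_mul zero_le_two, mul_comm]
  refine ⟨(1 - ENNReal.ofReal q)⁻¹, ?_, fun x => ?_⟩
  · rw [ENNReal.inv_ne_top, ne_eq, tsub_eq_zero_iff_le, not_le]
    exact ENNReal.ofReal_lt_one.2 hq1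
  have h1 : ∀ j : ℕ, ENNReal.ofReal (((2 : ℝ) ^ j) ^ (-s)) * ∑ n ∈ Finset.range (2 ^ j), x n =
      ∑' n : ℕ, (if n < 2 ^ j then ENNReal.ofReal (((2 : ℝ) ^ j) ^ (-s)) else 0) * x n := by
    intro j
    rw [tsum_eq_sum (s := Finset.range (2 ^ j)), Finset.mul_sum]
    · refine Finset.sum_congr rfl fun n hn => ?_
      rw [if_pos (Finset.mem_range.1 hn)]
    · intro n hn
      rw [if_neg (by simpa using hn), zero_mul]
  simp only [h1]
  rw [ENNReal.tsum_comm, ← ENNReal.tsum_mul_left]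
  refine ENNReal.tsum_le_tsum fun n => ?_
  rw [ENNReal.tsum_mul_right, ← mul_assoc]
  gcongr
  -- For fixed `n`, the indices with `n < 2 ^ j` start at `j₀`; their weights are a geometric series
  -- of ratio `q` with first term at most `(n + 1) ^ (-s)`.
  set j₀ := Nat.clog 2 (n + 1)
  have hj₀ : n + 1 ≤ 2 ^ j₀ := Nat.le_pow_clog one_lt_two _
  have hlt : ∀ j < j₀, ¬ n < 2 ^ j := fun j hj h =>
    absurd (Nat.clog_le_of_le_pow (b := 2) (show n + 1 ≤ 2 ^ j from h)) (not_le.2 hj)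
  rw [← Summable.sum_add_tsum_nat_add' (k := j₀) ENNReal.summable,
    Finset.sum_eq_zero fun j hj => if_neg (hlt j (Finset.mem_range.1 hj)), zero_add,
    mul_comm, ← ENNReal.tsum_geometric, ← ENNReal.tsum_mul_left]
  refine ENNReal.tsum_le_tsum fun i => ?_
  split_ifs with hi
  · rw [← ENNReal.ofReal_pow hq0.le, ← ENNReal.ofReal_mul (by positivity), hr, pow_add, mul_comm,
      ← hr j₀]
    refine ENNReal.ofReal_le_ofReal ?_
    gcongr ?_ * _
    exact Real.rpow_le_rpow_of_nonpos (by positivity) (by exact_mod_cast hj₀) (by linarith)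
  · exact zero_le

/-! ### Quantile functions -/

section Quantile

variable {Ω : Type*} [MeasurableSpace Ω] {μ : Measure Ω} {X : Ω → ℝ}

theorem absQuantile_nonneg (u : ℝ) : 0 ≤ absQuantile μ X u :=
  Real.sInf_nonneg fun _ ht => ht.1

theorem absQuantile_set_nonempty [IsFiniteMeasure μ] (hX : Measurable X) {u : ℝ} (hu : 0 < u) :
    {t : ℝ | 0 ≤ t ∧ μ {ω | t < |X ω|} ≤ ENNReal.ofReal u}.Nonempty := by
  have h := tendsto_measure_iInter_atTop (μ := μ) (s := fun n : ℕ => {ω | (n : ℝ) < |X ω|})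
    (fun n => (measurableSet_lt measurable_const (by fun_prop)).nullMeasurableSet)
    (fun m n hmn ω (hω : (n : ℝ) < |X ω|) =>
      show (m : ℝ) < |X ω| from lt_of_le_of_lt (Nat.cast_le.2 hmn) hω)
    ⟨0, measure_ne_top _ _⟩
  have h0 : ⋂ n : ℕ, {ω | (n : ℝ) < |X ω|} = ∅ := by
    ext ω
    simp only [Set.mem_iInter, Set.mem_ofPred_eq, Set.mem_empty_iff_false, iff_false, not_forall,
      not_lt]
    exact exists_nat_ge _
  rw [h0, measure_empty] at h
  obtain ⟨n, hn⟩ := (h.eventually_lt_const (ENNReal.ofReal_pos.2 hu)).exists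
  exact ⟨n, Nat.cast_nonneg n, hn.le⟩

theorem antitoneOn_absQuantile [IsFiniteMeasure μ] (hX : Measurable X) :
    AntitoneOn (absQuantile μ X) (Set.Ioi 0) := fun _ hu _ _ huv =>
  csInf_le_csInf ⟨0, fun _ ht => ht.1⟩ (absQuantile_set_nonempty hX hu)
    fun _ ht => ⟨ht.1, ht.2.trans (ENNReal.ofReal_le_ofReal huv)⟩

theorem aemeasurable_absQuantile [IsFiniteMeasure μ] (hX : Measurable X) {s : Set ℝ}
    (hs : MeasurableSet s) (hs0 : s ⊆ Set.Ioi 0) :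
    AEMeasurable (absQuantile μ X) (volume.restrict s) :=
  aemeasurable_restrict_of_antitoneOn hs ((antitoneOn_absQuantile hX).mono hs0)

theorem le_absQuantile [IsFiniteMeasure μ] (hX : Measurable X) {u t : ℝ} (hu : 0 < u)
    (h : ENNReal.ofReal u < μ {ω | t < |X ω|}) : t ≤ absQuantile μ X u := by
  refine le_csInf (absQuantile_set_nonempty hX hu) fun s hs => ?_
  by_contra! hst
  exact absurd (h.trans_le ((measure_mono fun ω (hω : t < |X ω|) => hst.trans hω).trans hs.2))
    (lt_irrefl _)

theorem lt_measure_of_lt_absQuantile {u t : ℝ} (ht : 0 ≤ t) (h : t < absQuantile μ X u) :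
    ENNReal.ofReal u < μ {ω | t < |X ω|} := by
  by_contra! hle
  exact notMem_of_lt_csInf h ⟨0, fun _ hs => hs.1⟩ ⟨ht, hle⟩

/-- The integral of `|X|` over a set is at most that of its quantile function near `0`. -/
theorem setLIntegral_abs_le_quantile [IsProbabilityMeasure μ] (hX : Measurable X) (A : Set Ω) :
    ∫⁻ ω in A, ENNReal.ofReal |X ω| ∂μ ≤
      ∫⁻ u in Set.Ioo 0 (μ A).toReal, ENNReal.ofReal (absQuantile μ X u) := by
  rw [lintegral_eq_lintegral_meas_lt _ (ae_of_all _ fun _ => abs_nonneg _) (by fun_prop),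
    lintegral_eq_lintegral_meas_le _ (ae_of_all _ fun u => absQuantile_nonneg u)
      (aemeasurable_absQuantile hX measurableSet_Ioo fun u hu => hu.1)]
  refine setLIntegral_mono' measurableSet_Ioi fun t ht => ?_
  have hm : MeasurableSet {ω | t < |X ω|} := measurableSet_lt measurable_const (by fun_prop)
  rw [Measure.restrict_apply hm]
  set w := μ ({ω | t < |X ω|} ∩ A)
  have hw : w ≠ ∞ := measure_ne_top _ _
  -- Layer-cake comparison: each `u` below the measure of `{t < |X|} ∩ A` satisfies both `t ≤
  -- absQuantile μ X u` and `u < μ A`.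
  calc w = volume (Set.Ioo 0 w.toReal) := by
        rw [Real.volume_Ioo, sub_zero, ENNReal.ofReal_toReal hw]
    _ ≤ volume ({u | t ≤ absQuantile μ X u} ∩ Set.Ioo 0 (μ A).toReal) := by
        refine measure_mono fun u hu => ⟨le_absQuantile hX hu.1 ?_, hu.1, hu.2.trans_le ?_⟩
        · exact ((ENNReal.ofReal_lt_iff_lt_toReal hu.1.le hw).2 hu.2).trans_le
            (measure_mono Set.inter_subset_left)
        · exact ENNReal.toReal_mono (measure_ne_top _ _) (measure_mono Set.inter_subset_right)
    _ ≤ _ := Measure.le_restrict_apply _ _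

/-- Layer cake: within `(0, 1)`, the points where the quantile function exceeds `t` lie below `μ {t
< |X|}`, so its tails are no larger than those of `|X|`. -/
theorem lintegral_absQuantile_rpow_le [IsProbabilityMeasure μ] (hX : Measurable X) {q : ℝ}
    (hq : 0 < q) :
    ∫⁻ u in Set.Ioo (0 : ℝ) 1, ENNReal.ofReal (absQuantile μ X u ^ q) ≤
      ∫⁻ ω, ENNReal.ofReal (|X ω| ^ q) ∂μ := by
  rw [lintegral_rpow_eq_lintegral_meas_lt_mul _ (ae_of_all _ fun u => absQuantile_nonneg u)
      (aemeasurable_absQuantile hX measurableSet_Ioo fun u hu => hu.1) hq,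
    lintegral_rpow_eq_lintegral_meas_lt_mul _ (ae_of_all _ fun _ => abs_nonneg _) (by fun_prop) hq]
  refine mul_le_mul' le_rfl ?_
  refine setLIntegral_mono' measurableSet_Ioi fun t (ht : 0 < t) => ?_
  gcongr ?_ * _
  have hw : μ {ω | t < |X ω|} ≠ ∞ := measure_ne_top _ _
  have hsub : {u | t < absQuantile μ X u} ∩ Set.Ioo 0 1 ⊆
      Set.Ioo 0 (μ {ω | t < |X ω|}).toReal := fun u hu =>
    ⟨hu.2.1, (ENNReal.ofReal_lt_iff_lt_toReal hu.2.1.le hw).1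
      (lt_measure_of_lt_absQuantile ht.le hu.1)⟩
  rw [Measure.restrict_apply' measurableSet_Ioo]
  refine (measure_mono hsub).trans (le_of_eq ?_)
  rw [Real.volume_Ioo, sub_zero, ENNReal.ofReal_toReal hw]

/-- The quantile function is nonincreasing, so its integral over `[b, a)` is at most that over `(0,
a - b)`. This separates a tail probability `a` into a normal part `b` and an excess. -/
theorem lintegral_absQuantile_le_add [IsFiniteMeasure μ] (hX : Measurable X) {a b : ℝ}
    (hb : 0 ≤ b) :
    ∫⁻ u in Set.Ioo 0 a, ENNReal.ofReal (absQuantile μ X u) ≤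
      (∫⁻ u in Set.Ioo 0 b, ENNReal.ofReal (absQuantile μ X u)) +
      ∫⁻ u in Set.Ioo 0 (max (a - b) 0), ENNReal.ofReal (absQuantile μ X u) := by
  have hsub : Set.Ioo 0 a ⊆ Set.Ioo 0 b ∪ Set.Ico b a := fun u hu => by
    rcases lt_or_ge u b with h | h
    · exact Or.inl ⟨hu.1, h⟩
    · exact Or.inr ⟨h, hu.2⟩
  refine (lintegral_mono_set hsub).trans ((lintegral_union_le _ _ _).trans ?_)
  refine add_le_add le_rfl ?_
  rw [← setLIntegral_congr (Ioo_ae_eq_Ico (a := b) (b := a)), ← lintegral_indicator measurableSet_Ioo,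
    ← lintegral_indicator measurableSet_Ioo, ← lintegral_add_right_eq_self _ b]
  refine lintegral_mono fun u => ?_
  simp only [Set.indicator, Set.mem_Ioo]
  by_cases h : b < u + b ∧ u + b < a
  · rw [if_pos h, if_pos ⟨by linarith [h.1], lt_max_of_lt_left (by linarith [h.2])⟩]
    exact ENNReal.ofReal_le_ofReal (antitoneOn_absQuantile hX
      (Set.mem_Ioi.2 (by linarith [h.1])) (Set.mem_Ioi.2 (by linarith [h.1])) (by linarith))
  · rw [if_neg h]; exact zero_le

end Quantile

/-! ### The normal quantile function -/

/-- By symmetry and absence of atoms, `P(|Y| ≥ x) ≤ 2 P(Y > x)`; hence `Φ(x) < 1 - u / 2`, and `x`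
lies below the quantile. -/
theorem le_stdNormalQuantile {u x : ℝ} (hu : 0 < u)
    (h : ENNReal.ofReal u < gaussianReal 0 1 {y | x ≤ |y|}) :
    x ≤ stdNormalQuantile (1 - u / 2) := by
  set γ := gaussianReal 0 1
  have hna : NullSingletonClass γ := nullSingletonClass_gaussianReal one_ne_zero
  have hneg : γ (Set.Iic (-x)) = γ (Set.Ici x) := by
    have h1 : γ.map (fun y => -y) = γ := by simpa using gaussianReal_map_neg (μ := 0) (v := 1)
    conv_lhs => rw [← h1, Measure.map_apply (by fun_prop) measurableSet_Iic]
    congr 1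
    ext y; simp
  have hle : γ {y | x ≤ |y|} ≤ γ (Set.Ioi x) + γ (Set.Ioi x) := by
    calc γ {y | x ≤ |y|} ≤ γ (Set.Ici x ∪ Set.Iic (-x)) := by
          refine measure_mono fun y (hy : x ≤ |y|) => ?_
          rcases le_abs.1 hy with h | h
          · exact Or.inl h
          · exact Or.inr (by simpa using (by linarith : y ≤ -x))
      _ ≤ γ (Set.Ici x) + γ (Set.Iic (-x)) := measure_union_le _ _
      _ = _ := by rw [hneg, measure_congr Ioi_ae_eq_Ici]
  have hcompl : (γ (Set.Ioi x)).toReal = 1 - cdf γ x := by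
    rw [cdf_eq_real, ← Set.compl_Iic, ← measureReal_def, probReal_compl_eq_one_sub measurableSet_Iic]
  have hlt : cdf γ x < 1 - u / 2 := by
    have h1 := h.trans_le hle
    rw [ENNReal.ofReal_lt_iff_lt_toReal hu.le (by finiteness),
      ENNReal.toReal_add (by finiteness) (by finiteness), hcompl] at h1
    linarith
  refine le_csInf ?_ fun y hy => ?_
  · exact ((tendsto_cdf_atTop γ).eventually (eventually_ge_nhds (by linarith : 1 - u / 2 < 1))).exists
  · by_contra! hyx
    have := monotone_cdf γ hyx.le
    have hy' : 1 - u / 2 ≤ cdf γ y := hy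
    linarith

theorem tsum_mul_setLIntegral {Q : ℝ → ℝ≥0∞} (hQ : AEMeasurable Q (volume.restrict (Set.Ioo 0 1)))
    {w : ℕ → ℝ} (hw : ∀ i, w i ≤ 1) (c : ℕ → ℝ) :
    ∑' i, ENNReal.ofReal (c i) * ∫⁻ u in Set.Ioo 0 (w i), Q u =
      ∫⁻ u in Set.Ioo 0 1,
        (∑' i, (Set.Ioo 0 (w i)).indicator (fun _ => ENNReal.ofReal (c i)) u) * Q u := by
  have h1 : ∀ i, ENNReal.ofReal (c i) * ∫⁻ u in Set.Ioo 0 (w i), Q u =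
      ∫⁻ u in Set.Ioo 0 1, (Set.Ioo 0 (w i)).indicator (fun _ => ENNReal.ofReal (c i)) u * Q u := by
    intro i
    have hrestr : (volume.restrict (Set.Ioo (0 : ℝ) 1)).restrict (Set.Ioo 0 (w i)) =
        volume.restrict (Set.Ioo 0 (w i)) := by
      rw [Measure.restrict_restrict measurableSet_Ioo, Set.inter_eq_left.2]
      exact Set.Ioo_subset_Ioo_right (hw i)
    rw [← hrestr, ← lintegral_const_mul' _ _ ENNReal.ofReal_ne_top,
      ← lintegral_indicator measurableSet_Ioo]
    refine lintegral_congr fun u => ?_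
    by_cases hu : u ∈ Set.Ioo 0 (w i) <;> simp [hu]
  simp only [h1, ← ENNReal.tsum_mul_right]
  exact (lintegral_tsum fun i =>
    ((measurable_const.indicator measurableSet_Ioo).aemeasurable).mul hQ).symm

/-- By Tonelli, `absQuantile μ X u` receives the weight `∑ 2 ^ (i (p - 2))` over the levels with `u
< P(σ|Y| ≥ 2 ^ i)`. The sum is comparable to its largest term, at a level `J` with `2 ^ J ≤ σ Φ⁻¹(1
- u / 2)`. This is how the weight in `envelopeNorm` arises. -/
theorem exists_tsum_gaussian_tail_le {p σ : ℝ} (hp : 2 < p) (hσ : 0 < σ) :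
    ∃ C : ℝ, 0 ≤ C ∧ ∀ {Ω : Type*} [MeasurableSpace Ω] (μ : Measure Ω) [IsProbabilityMeasure μ]
      (X : Ω → ℝ), Measurable X →
      ∑' i : ℕ, ENNReal.ofReal (((2 : ℝ) ^ i) ^ (p - 2)) *
        ∫⁻ u in Set.Ioo 0 (gaussianReal 0 1 {y | 2 ^ i ≤ σ * |y|}).toReal,
          ENNReal.ofReal (absQuantile μ X u) ≤ ENNReal.ofReal C * envelopeNorm p X μ := by
  obtain ⟨C, hC0, hC⟩ := exists_sum_geom_le (sub_pos.2 hp)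
  refine ⟨C * σ ^ (p - 2), by positivity, fun {Ω} _ μ _ X hX => ?_⟩
  set g : ℕ → ℝ := fun i => (gaussianReal 0 1 {y : ℝ | 2 ^ i ≤ σ * |y|}).toReal with hg
  have hg1 : ∀ i, g i ≤ 1 := fun i => by
    rw [hg]
    exact ENNReal.toReal_le_of_le_ofReal zero_le_one (by simpa using prob_le_one)
  have hQm := aemeasurable_absQuantile (μ := μ) hX measurableSet_Ioo
    (fun u (hu : u ∈ Set.Ioo (0 : ℝ) 1) => hu.1)
  refine (tsum_mul_setLIntegral hQm.ennreal_ofReal hg1 _).trans_le ?_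
  rw [envelopeNorm, ← lintegral_const_mul' _ _ ENNReal.ofReal_ne_top]
  refine setLIntegral_mono' measurableSet_Ioo fun u hu => ?_
  rw [ENNReal.ofReal_mul (p := max 1 (stdNormalQuantile (1 - u / 2)) ^ (p - 2)) (by positivity),
    ← mul_assoc]
  gcongr
  rw [ENNReal.tsum_eq_iSup_sum]
  refine iSup_le fun F => ?_
  rw [Finset.sum_indicator_eq_sum_filter, ← ENNReal.ofReal_sum_of_nonneg fun _ _ => by positivity,
    ← ENNReal.ofReal_mul (by positivity)]
  refine ENNReal.ofReal_le_ofReal ?_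
  rcases (F.filter fun i => u ∈ Set.Ioo 0 (g i)).eq_empty_or_nonempty with hF | hF
  · rw [hF, Finset.sum_empty]; positivity
  obtain ⟨J, hJ, hJs⟩ := hC _ hF
  refine hJs.trans ?_
  rw [mul_assoc]
  gcongr
  rw [← Real.mul_rpow hσ.le (by positivity)]
  refine Real.rpow_le_rpow (by positivity) ?_ (by linarith)
  have hJu := (Finset.mem_filter.1 hJ).2
  have h2 : (2 : ℝ) ^ J / σ ≤ stdNormalQuantile (1 - u / 2) := by
    refine le_stdNormalQuantile hu.1 ?_
    rw [ENNReal.ofReal_lt_iff_lt_toReal hu.1.le (measure_ne_top _ _)]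
    have hset : {y : ℝ | 2 ^ J / σ ≤ |y|} = {y : ℝ | 2 ^ J ≤ σ * |y|} := by
      ext y
      exact div_le_iff₀' hσ
    rw [hset]
    exact hJu.2
  rw [div_le_iff₀' hσ] at h2
  exact h2.trans (by gcongr; exact le_max_right _ _)

/-- The weight received by `absQuantile μ X u` is again comparable to its largest term, hence to at
most `W(u) ^ ((p - 2) / p)` with `W(u) = ∑ 2 ^ (i p) 1_{u < e i}`. Then Hölder's inequality with
exponents `p / (p - 2)` and `p / 2` applies, where `∫ W = ∑ 2 ^ (i p) e i`. -/
theorem exists_tsum_excess_le {p : ℝ} (hp : 2 < p) :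
    ∃ C : ℝ, 0 ≤ C ∧ ∀ {Ω : Type*} [MeasurableSpace Ω] (μ : Measure Ω) [IsProbabilityMeasure μ]
      (X : Ω → ℝ), Measurable X → ∀ e : ℕ → ℝ, (∀ i, 0 ≤ e i) → (∀ i, e i ≤ 1) →
      ∑' i : ℕ, ENNReal.ofReal (((2 : ℝ) ^ i) ^ (p - 2)) *
        ∫⁻ u in Set.Ioo 0 (e i), ENNReal.ofReal (absQuantile μ X u) ≤
      ENNReal.ofReal C * (∑' i : ℕ, ENNReal.ofReal (((2 : ℝ) ^ i) ^ p * e i)) ^ ((p - 2) / p) *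
        eLpNorm X (ENNReal.ofReal (p / 2)) μ := by
  obtain ⟨C, hC0, hC⟩ := exists_sum_geom_le (sub_pos.2 hp)
  refine ⟨C, hC0, fun {Ω} _ μ _ X hX e he0 he1 => ?_⟩
  have hp0 : 0 < p := by linarith
  have hQm := aemeasurable_absQuantile (μ := μ) hX measurableSet_Ioo
    (fun u (hu : u ∈ Set.Ioo (0 : ℝ) 1) => hu.1)
  have hrestr : ∀ i, (volume.restrict (Set.Ioo (0 : ℝ) 1)).restrict (Set.Ioo 0 (e i)) =
      volume.restrict (Set.Ioo 0 (e i)) := fun i => by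
    rw [Measure.restrict_restrict measurableSet_Ioo, Set.inter_eq_left.2]
    exact Set.Ioo_subset_Ioo_right (he1 i)
  refine (tsum_mul_setLIntegral hQm.ennreal_ofReal he1 _).trans_le ?_
  set W : ℝ → ℝ≥0∞ := fun u => ∑' i : ℕ, (Set.Ioo 0 (e i)).indicator
    (fun _ => ENNReal.ofReal (((2 : ℝ) ^ i) ^ p)) u with hW
  have hWm : Measurable W :=
    Measurable.tsum fun i => measurable_const.indicator measurableSet_Ioo
  have h2 : ∀ u, (∑' i : ℕ, (Set.Ioo 0 (e i)).indicator
        (fun _ => ENNReal.ofReal (((2 : ℝ) ^ i) ^ (p - 2))) u) *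
          ENNReal.ofReal (absQuantile μ X u) ≤
      ENNReal.ofReal C * (W u ^ ((p - 2) / p) * ENNReal.ofReal (absQuantile μ X u)) := by
    intro u
    rw [← mul_assoc]
    gcongr
    rw [ENNReal.tsum_eq_iSup_sum]
    refine iSup_le fun F => ?_
    rw [Finset.sum_indicator_eq_sum_filter, ← ENNReal.ofReal_sum_of_nonneg fun _ _ => by positivity]
    rcases (F.filter fun i => u ∈ Set.Ioo 0 (e i)).eq_empty_or_nonempty with hF | hF
    · rw [hF, Finset.sum_empty, ENNReal.ofReal_zero]; exact zero_le
    obtain ⟨J, hJ, hJs⟩ := hC _ hF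
    have hJu := (Finset.mem_filter.1 hJ).2
    refine (ENNReal.ofReal_le_ofReal hJs).trans ?_
    rw [ENNReal.ofReal_mul hC0]
    gcongr
    have h3 : ENNReal.ofReal (((2 : ℝ) ^ J) ^ p) ≤ W u := by
      refine le_trans (le_of_eq ?_) (ENNReal.le_tsum J)
      rw [Set.indicator_of_mem hJu]
    calc ENNReal.ofReal (((2 : ℝ) ^ J) ^ (p - 2)) =
          ENNReal.ofReal (((2 : ℝ) ^ J) ^ p) ^ ((p - 2) / p) := by
          rw [ENNReal.ofReal_rpow_of_nonneg (by positivity) (by positivity),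
            ← Real.rpow_mul (by positivity)]
          congr 2; field_simp
      _ ≤ _ := by gcongr
  refine (lintegral_mono h2).trans ?_
  rw [lintegral_const_mul' _ _ ENNReal.ofReal_ne_top, mul_assoc]
  gcongr
  have hconj : (p / (p - 2)).HolderConjugate (p / 2) := by
    rw [Real.holderConjugate_iff]
    constructor
    · rw [lt_div_iff₀ (by linarith)]; linarith
    · field_simp; ring
  refine (ENNReal.lintegral_mul_le_Lp_mul_Lq _ hconj (hWm.pow_const _).aemeasurable
    hQm.ennreal_ofReal).trans ?_
  have hp2 : p - 2 ≠ 0 := by linarith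
  gcongr ?_ * ?_
  · simp only [← ENNReal.rpow_mul]
    rw [show (p - 2) / p * (p / (p - 2)) = 1 by field_simp, one_div_div]
    simp only [ENNReal.rpow_one]
    gcongr
    rw [hW, lintegral_tsum fun i => (measurable_const.indicator measurableSet_Ioo).aemeasurable]
    refine ENNReal.tsum_le_tsum fun i => ?_
    rw [lintegral_indicator measurableSet_Ioo, hrestr, lintegral_const,
      Measure.restrict_apply_univ, Real.volume_Ioo, sub_zero, ENNReal.ofReal_mul (by positivity)]
  · rw [eLpNorm_eq_lintegral_rpow_enorm_toReal (by simpa using hp0) ENNReal.ofReal_ne_top,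
      ENNReal.toReal_ofReal (by positivity)]
    gcongr
    refine le_trans (le_of_eq ?_) ((lintegral_absQuantile_rpow_le (μ := μ) hX
      (q := p / 2) (by positivity)).trans
      (le_of_eq ?_))
    · refine lintegral_congr fun u => ?_
      rw [ENNReal.ofReal_rpow_of_nonneg (absQuantile_nonneg u) (by positivity)]
    · refine lintegral_congr fun ω => ?_
      rw [Real.enorm_eq_ofReal_abs, ENNReal.ofReal_rpow_of_nonneg (abs_nonneg _) (by positivity)]

/-! ### Test functions detecting tails -/

/-- A smooth even function, `0` on `[-1, 1]` and `1` outside `[-2, 2]`. -/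
noncomputable def tailBump (x : ℝ) : ℝ :=
  Real.smoothTransition (x - 1) + Real.smoothTransition (-x - 1)

theorem contDiff_tailBump (n : ℕ) : ContDiff ℝ n tailBump := by
  have h : ContDiff ℝ n Real.smoothTransition := Real.smoothTransition.contDiff (n := n)
  exact (h.comp (contDiff_id.sub contDiff_const)).add
    (h.comp (contDiff_id.neg.sub contDiff_const))

theorem tailBump_eq_zero {x : ℝ} (hx : |x| ≤ 1) : tailBump x = 0 := by
  have := abs_le.1 hx
  rw [tailBump, Real.smoothTransition.zero_of_nonpos (by linarith),
    Real.smoothTransition.zero_of_nonpos (by linarith), add_zero]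

theorem tailBump_eq_one {x : ℝ} (hx : 2 ≤ |x|) : tailBump x = 1 := by
  rcases le_abs.1 hx with h | h
  · rw [tailBump, Real.smoothTransition.one_of_one_le (by linarith),
      Real.smoothTransition.zero_of_nonpos (by linarith), add_zero]
  · rw [tailBump, Real.smoothTransition.zero_of_nonpos (by linarith),
      Real.smoothTransition.one_of_one_le (by linarith), zero_add]

theorem tailBump_nonneg (x : ℝ) : 0 ≤ tailBump x :=
  add_nonneg (Real.smoothTransition.nonneg _) (Real.smoothTransition.nonneg _)

theorem tailBump_le_one (x : ℝ) : tailBump x ≤ 1 := by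
  rcases le_total x 0 with h | h
  · rw [tailBump, Real.smoothTransition.zero_of_nonpos (by linarith), zero_add]
    exact Real.smoothTransition.le_one _
  · rw [tailBump, Real.smoothTransition.zero_of_nonpos (x := -x - 1) (by linarith), add_zero]
    exact Real.smoothTransition.le_one _

theorem hasDerivAt_tailBump (x : ℝ) : HasDerivAt tailBump (deriv tailBump x) x :=
  ((contDiff_tailBump 1).differentiable (by simp) x).hasDerivAt

theorem contDiff_deriv_tailBump (n : ℕ) : ContDiff ℝ n (deriv tailBump) := by
  have h : ContDiff ℝ (n + 1) tailBump := by exact_mod_cast contDiff_tailBump (n + 1)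
  exact (contDiff_succ_iff_deriv.1 h).2.2

theorem hasDerivAt_deriv_tailBump (x : ℝ) :
    HasDerivAt (deriv tailBump) (deriv (deriv tailBump) x) x :=
  ((contDiff_deriv_tailBump 1).differentiable (by simp) x).hasDerivAt

theorem contDiff_deriv_deriv_tailBump (n : ℕ) : ContDiff ℝ n (deriv (deriv tailBump)) := by
  have h : ContDiff ℝ (n + 1) (deriv tailBump) := by exact_mod_cast contDiff_deriv_tailBump (n + 1)
  exact (contDiff_succ_iff_deriv.1 h).2.2

theorem deriv_deriv_eq_zero_of_eventuallyEq {f : ℝ → ℝ} {c x : ℝ}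
    (h : f =ᶠ[nhds x] fun _ => c) : deriv (deriv f) x = 0 := by
  have h1 : deriv f =ᶠ[nhds x] fun _ => 0 := by
    have := h.deriv
    simpa using this
  rw [h1.deriv_eq]; simp

/-- What remains is the half-open annulus `1 < |x| ≤ 2`, whose dyadic dilates are disjoint. The
points `|x| = 1` are reached by continuity. -/
theorem deriv_deriv_tailBump_eq_zero {x : ℝ} (hx : |x| ≤ 1 ∨ 2 < |x|) :
    deriv (deriv tailBump) x = 0 := by
  rcases hx with hx | hx
  · have hcl : IsClosed {x | deriv (deriv tailBump) x = 0} :=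
      isClosed_eq (contDiff_deriv_deriv_tailBump 0).continuous continuous_const
    have hsub : Metric.ball (0 : ℝ) 1 ⊆ {x | deriv (deriv tailBump) x = 0} := fun y hy => by
      refine deriv_deriv_eq_zero_of_eventuallyEq (c := 0) ?_
      filter_upwards [Metric.isOpen_ball.mem_nhds hy] with z hz
      exact tailBump_eq_zero (by simpa using (Metric.mem_ball.1 hz).le)
    have h := closure_minimal hsub hcl
    rw [closure_ball _ one_ne_zero] at h
    exact h (by simpa using hx)
  · refine deriv_deriv_eq_zero_of_eventuallyEq (c := 1) ?_
    filter_upwards [(isOpen_lt continuous_const continuous_abs).mem_nhds hx] with z hz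
    exact tailBump_eq_one (le_of_lt hz)

/-- The second derivative is smooth with compact support: its Lipschitz bound serves at distances at
most `1`, its sup bound beyond. -/
theorem exists_holder_tailBump {α : ℝ} (hα0 : 0 < α) (hα1 : α ≤ 1) :
    ∃ H : ℝ, 0 ≤ H ∧ ∀ x y : ℝ,
      |deriv (deriv tailBump) x - deriv (deriv tailBump) y| ≤ H * |x - y| ^ α := by
  set g := deriv (deriv tailBump) with hg
  have hgc : Continuous g := (contDiff_deriv_deriv_tailBump 0).continuous
  have hsupp : HasCompactSupport g := by
    refine HasCompactSupport.of_support_subset_isCompact (isCompact_closedBall (0 : ℝ) 2) ?_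
    intro x hx
    rw [Function.mem_support] at hx
    by_contra h
    exact hx (deriv_deriv_tailBump_eq_zero (Or.inr (by simpa using h)))
  have hg1 : ContDiff ℝ 1 g := by exact_mod_cast contDiff_deriv_deriv_tailBump 1
  obtain ⟨B, hB⟩ := hgc.bounded_above_of_compact_support hsupp
  obtain ⟨L, hL⟩ := (hg1.continuous_deriv le_rfl).bounded_above_of_compact_support hsupp.deriv
  have hB0 : 0 ≤ B := (norm_nonneg _).trans (hB 0)
  have hL0 : 0 ≤ L := (norm_nonneg _).trans (hL 0)
  refine ⟨L + 2 * B, by positivity, fun x y => ?_⟩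
  rcases le_total |x - y| 1 with h | h
  · have h1 : |g x - g y| ≤ L * |x - y| := by
      have := (convex_univ (𝕜 := ℝ) (E := ℝ)).norm_image_sub_le_of_norm_deriv_le
        (f := g) (C := L) (x := y) (y := x)
        (fun z _ => (hg1.differentiable (by simp)) z) (fun z _ => hL z) trivial trivial
      simpa using this
    have h2 : |x - y| ≤ |x - y| ^ α := by
      rcases eq_or_lt_of_le (abs_nonneg (x - y)) with h0 | h0
      · rw [← h0, Real.zero_rpow hα0.ne']
      · simpa using Real.rpow_le_rpow_of_exponent_ge h0 h hα1
    calc _ ≤ L * |x - y| ^ α := h1.trans (by gcongr)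
      _ ≤ _ := by gcongr; linarith
  · have h1 : |g x - g y| ≤ 2 * B := by
      have h3 := abs_sub (g x) (g y)
      have h4 := hB x
      have h5 := hB y
      rw [Real.norm_eq_abs] at h4 h5
      linarith
    have h2 : 1 ≤ |x - y| ^ α := Real.one_le_rpow h hα0.le
    nlinarith

theorem sum_indicator_dyadic_le_one (J : Finset ℕ) {τ : ℝ} (hτ : 0 < τ) (x : ℝ) :
    ∑ i ∈ J, (if 2 ^ i * τ < |x| ∧ |x| ≤ 2 * (2 ^ i * τ) then (1 : ℝ) else 0) ≤ 1 := by
  rw [Finset.sum_ite, Finset.sum_const_zero, add_zero, Finset.sum_const, nsmul_eq_mul, mul_one]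
  refine Nat.cast_le_one.2 ?_
  refine Finset.card_le_one.2 fun i hi j hj => ?_
  have key : ∀ i j : ℕ, 2 ^ j * τ < |x| → |x| ≤ 2 * (2 ^ i * τ) → j ≤ i := by
    intro i j h1 h2
    have h3 : (2 : ℝ) ^ j * τ < 2 ^ (i + 1) * τ := by rw [pow_succ]; linarith
    have h4 := lt_of_mul_lt_mul_right h3 hτ.le
    have := (pow_lt_pow_iff_right₀ (one_lt_two (α := ℝ))).1 h4
    omega
  have hi' := (Finset.mem_filter.1 hi).2
  have hj' := (Finset.mem_filter.1 hj).2
  exact le_antisymm (key j i hi'.1 hj'.2) (key i j hj'.1 hi'.2)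

/-- If a law is close to a normal law when tested on functions with `(p-2)`-Hölder second
derivative, then the excess of its tail over the normal tail is small in weak `p`-th moment. -/
theorem exists_sum_tail_excess_le {p : ℝ} (hp2 : 2 < p) (hp3 : p ≤ 3) :
    ∃ H : ℝ, 0 ≤ H ∧ ∀ (ν : Measure ℝ) [IsProbabilityMeasure ν] (s τ K : ℝ), 0 < τ →
      (∀ f f₁ f₂ : ℝ → ℝ, (∀ x, HasDerivAt f (f₁ x) x) → (∀ x, HasDerivAt f₁ (f₂ x) x) →
        (∀ x y, |f₂ x - f₂ y| ≤ |x - y| ^ (p - 2)) → |∫ x, f x ∂ν - gaussSmooth s f 0| ≤ K) →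
      ∀ J : Finset ℕ, ∑ i ∈ J, (2 ^ i * τ) ^ p * (ν.real {x | 2 * (2 ^ i * τ) ≤ |x|} -
        (gaussianReal 0 1).real {y | 2 ^ i * τ ≤ |s * y|}) ≤ H * K := by
  obtain ⟨H, hH0, hH⟩ := exists_holder_tailBump (sub_pos.2 hp2) (by linarith : p - 2 ≤ 1)
  refine ⟨2 * H + 1, by positivity, fun ν _ s τ K hτ htest J => ?_⟩
  set t : ℕ → ℝ := fun i => 2 ^ i * τ with ht
  have ht0 : ∀ i, 0 < t i := fun i => by positivity
  -- `F` lies above the weighted tail indicators at levels `2 * t i` and below those at levels `t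
  -- i`. With the factor `t i ^ p`, each summand has a second derivative with `(p - 2)`-Hölder
  -- constant `H` whatever the scale; these live on disjoint annuli, so for given `x`, `y` at most
  -- two terms count, whence `2 * H`. The divisor `2 * H + 1` used below is positive even if `H =
  -- 0`.
  set F : ℝ → ℝ := fun x => ∑ i ∈ J, t i ^ p * tailBump (x / t i) with hF
  set F₁ : ℝ → ℝ := fun x => ∑ i ∈ J, t i ^ p * (deriv tailBump (x / t i) / t i) with hF₁
  set F₂ : ℝ → ℝ := fun x => ∑ i ∈ J, t i ^ p * (deriv (deriv tailBump) (x / t i) / t i / t i)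
    with hF₂
  have hd1 : ∀ x, HasDerivAt F (F₁ x) x := fun x => by
    refine HasDerivAt.fun_sum fun i _ => HasDerivAt.const_mul _ ?_
    have h := (hasDerivAt_tailBump (x / t i)).comp x ((hasDerivAt_id x).div_const (t i))
    refine h.congr_deriv ?_
    ring
  have hd2 : ∀ x, HasDerivAt F₁ (F₂ x) x := fun x => by
    refine HasDerivAt.fun_sum fun i _ => HasDerivAt.const_mul _ (HasDerivAt.div_const ?_ _)
    have h := (hasDerivAt_deriv_tailBump (x / t i)).comp x ((hasDerivAt_id x).div_const (t i))
    refine h.congr_deriv ?_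
    ring
  have hhol : ∀ x y, |F₂ x - F₂ y| ≤ 2 * H * |x - y| ^ (p - 2) := by
    intro x y
    have hterm : ∀ i ∈ J, |t i ^ p * (deriv (deriv tailBump) (x / t i) / t i / t i) -
        t i ^ p * (deriv (deriv tailBump) (y / t i) / t i / t i)| ≤
        ((if 2 ^ i * τ < |x| ∧ |x| ≤ 2 * (2 ^ i * τ) then (1 : ℝ) else 0) +
        (if 2 ^ i * τ < |y| ∧ |y| ≤ 2 * (2 ^ i * τ) then (1 : ℝ) else 0)) *
          (H * |x - y| ^ (p - 2)) := by
      intro i _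
      have hnn : 0 ≤ H * |x - y| ^ (p - 2) := by positivity
      have hmain : |t i ^ p * (deriv (deriv tailBump) (x / t i) / t i / t i) -
          t i ^ p * (deriv (deriv tailBump) (y / t i) / t i / t i)| ≤ H * |x - y| ^ (p - 2) := by
        have hti := ht0 i
        rw [← mul_sub, ← sub_div, ← sub_div, abs_mul, abs_div, abs_div, abs_of_pos hti,
          abs_of_nonneg (by positivity : 0 ≤ t i ^ p)]
        have h1 := hH (x / t i) (y / t i)
        rw [← sub_div, abs_div, abs_of_pos hti, Real.div_rpow (abs_nonneg _) hti.le] at h1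
        calc _ ≤ t i ^ p * (H * (|x - y| ^ (p - 2) / t i ^ (p - 2)) / t i / t i) := by gcongr
          _ = H * |x - y| ^ (p - 2) := by
              rw [Real.rpow_sub hti, Real.rpow_two]; field_simp
      have hzero : ∀ z : ℝ, ¬ (2 ^ i * τ < |z| ∧ |z| ≤ 2 * (2 ^ i * τ)) →
          deriv (deriv tailBump) (z / t i) = 0 := by
        intro z hz
        refine deriv_deriv_tailBump_eq_zero ?_
        rw [abs_div, abs_of_pos (ht0 i), div_le_one (ht0 i), lt_div_iff₀ (ht0 i)]
        rw [not_and_or, not_lt, not_le] at hz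
        exact hz
      by_cases hx : 2 ^ i * τ < |x| ∧ |x| ≤ 2 * (2 ^ i * τ)
      · rw [if_pos hx]
        refine hmain.trans (le_mul_of_one_le_left hnn ?_)
        split_ifs <;> norm_num
      · by_cases hy : 2 ^ i * τ < |y| ∧ |y| ≤ 2 * (2 ^ i * τ)
        · rw [if_neg hx, if_pos hy]
          simpa using hmain
        · rw [if_neg hx, if_neg hy, hzero x hx, hzero y hy]
          simp
    rw [hF₂]
    simp only
    rw [← Finset.sum_sub_distrib]
    refine (Finset.abs_sum_le_sum_abs _ _).trans ((Finset.sum_le_sum hterm).trans ?_)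
    rw [← Finset.sum_mul, Finset.sum_add_distrib, mul_assoc]
    have hx := sum_indicator_dyadic_le_one J hτ x
    have hy := sum_indicator_dyadic_le_one J hτ y
    gcongr
    linarith
  have hc : 0 < 2 * H + 1 := by positivity
  have happ := htest (fun x => F x / (2 * H + 1)) (fun x => F₁ x / (2 * H + 1))
    (fun x => F₂ x / (2 * H + 1)) (fun x => (hd1 x).div_const _) (fun x => (hd2 x).div_const _)
    (fun x y => by
      rw [← sub_div, abs_div, abs_of_pos hc, div_le_iff₀ hc]
      refine (hhol x y).trans ?_
      rw [mul_comm]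
      gcongr
      linarith)
  have hbm : Measurable tailBump := (contDiff_tailBump 0).continuous.measurable
  have hbd : ∀ x, ‖tailBump x‖ ≤ 1 := fun x => by
    rw [Real.norm_eq_abs, abs_of_nonneg (tailBump_nonneg x)]; exact tailBump_le_one x
  have hint : ∀ (m : Measure ℝ) [IsProbabilityMeasure m] (φ : ℝ → ℝ), Measurable φ →
      Integrable (fun x => tailBump (φ x)) m := fun m _ φ hφ =>
    Integrable.of_bound (hbm.comp hφ).aestronglyMeasurable 1 (ae_of_all _ fun x => hbd _)
  have hν : ∑ i ∈ J, t i ^ p * ν.real {x | 2 * t i ≤ |x|} ≤ ∫ x, F x ∂ν := by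
    rw [hF, integral_finsetSum _ fun i _ => (hint ν (fun x => x / t i) (by fun_prop)).const_mul _]
    refine Finset.sum_le_sum fun i _ => ?_
    rw [integral_const_mul]
    gcongr
    have hms : MeasurableSet {x : ℝ | 2 * t i ≤ |x|} := measurableSet_le (by fun_prop) (by fun_prop)
    rw [← integral_indicator_one hms]
    refine integral_mono ((integrable_const (1 : ℝ)).indicator hms)
      (hint ν (fun x => x / t i) (by fun_prop)) fun x => ?_
    by_cases hx : 2 * t i ≤ |x|
    · rw [Set.indicator_of_mem (by exact hx), tailBump_eq_one]
      · simp
      · rw [abs_div, abs_of_pos (ht0 i), le_div_iff₀ (ht0 i)]; exact hx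
    · rw [Set.indicator_of_notMem (by exact hx)]; exact tailBump_nonneg _
  have hγ : gaussSmooth s F 0 ≤
      ∑ i ∈ J, t i ^ p * (gaussianReal 0 1).real {y | t i ≤ |s * y|} := by
    rw [gaussSmooth, hF, integral_finsetSum _ fun i _ =>
      (hint (gaussianReal 0 1) (fun y => (0 + s * y) / t i) (by fun_prop)).const_mul _]
    refine Finset.sum_le_sum fun i _ => ?_
    rw [integral_const_mul]
    gcongr
    have hms : MeasurableSet {y : ℝ | t i ≤ |s * y|} := measurableSet_le (by fun_prop) (by fun_prop)
    rw [← integral_indicator_one hms]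
    refine integral_mono (hint (gaussianReal 0 1) (fun y => (0 + s * y) / t i) (by fun_prop))
      ((integrable_const (1 : ℝ)).indicator hms) fun y => ?_
    simp only [zero_add]
    by_cases hy : t i ≤ |s * y|
    · rw [Set.indicator_of_mem (by exact hy)]; exact tailBump_le_one _
    · rw [Set.indicator_of_notMem (by exact hy), tailBump_eq_zero]
      rw [abs_div, abs_of_pos (ht0 i), div_le_one (ht0 i)]
      exact (not_le.1 hy).le
  have hlin : ∫ x, F x / (2 * H + 1) ∂ν - gaussSmooth s (fun x => F x / (2 * H + 1)) 0 =
      (∫ x, F x ∂ν - gaussSmooth s F 0) / (2 * H + 1) := by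
    simp only [gaussSmooth, integral_div]
    ring
  rw [hlin, abs_div, abs_of_pos hc, div_le_iff₀ hc] at happ
  have := le_abs_self (∫ x, F x ∂ν - gaussSmooth s F 0)
  simp only [mul_sub, Finset.sum_sub_distrib]
  linarith

/-! ### Domination by powers of functions in `L^p` -/

/-- `|W| ≤ C Y ^ q` for some `Y ≥ 1` in `L^p`. -/
def LpDominated {Ω : Type*} [MeasurableSpace Ω] (μ : Measure Ω) (p q : ℝ) (W : Ω → ℝ) : Prop :=
  ∃ (C : ℝ) (Y : Ω → ℝ), 0 ≤ C ∧ MemLp Y (ENNReal.ofReal p) μ ∧ (∀ ω, 1 ≤ Y ω) ∧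
    ∀ ω, |W ω| ≤ C * Y ω ^ q

namespace LpDominated

variable {Ω : Type*} [MeasurableSpace Ω] {μ : Measure Ω} {p q q' : ℝ} {W W' : Ω → ℝ}

theorem mul (h : LpDominated μ p q W) (h' : LpDominated μ p q' W') (hq : 0 ≤ q) (hq' : 0 ≤ q') :
    LpDominated μ p (q + q') (fun ω => W ω * W' ω) := by
  obtain ⟨C, Y, hC, hY, hY1, hW⟩ := h
  obtain ⟨C', Y', hC', hY', hY1', hW'⟩ := h'
  refine ⟨C * C', fun ω => Y ω + Y' ω, by positivity, hY.add hY',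
    fun ω => by linarith [hY1 ω, hY1' ω], fun ω => ?_⟩
  have h1 := hY1 ω
  have h2 := hY1' ω
  rw [abs_mul, Real.rpow_add (by linarith)]
  calc |W ω| * |W' ω| ≤ (C * Y ω ^ q) * (C' * Y' ω ^ q') := by gcongr; exacts [hW ω, hW' ω]
    _ ≤ (C * (Y ω + Y' ω) ^ q) * (C' * (Y ω + Y' ω) ^ q') := by
        gcongr
        · linarith
        · linarith
    _ = _ := by ring

theorem add (h : LpDominated μ p q W) (h' : LpDominated μ p q W') (hq : 0 ≤ q) :
    LpDominated μ p q (fun ω => W ω + W' ω) := by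
  obtain ⟨C, Y, hC, hY, hY1, hW⟩ := h
  obtain ⟨C', Y', hC', hY', hY1', hW'⟩ := h'
  refine ⟨C + C', fun ω => Y ω + Y' ω, by positivity, hY.add hY',
    fun ω => by linarith [hY1 ω, hY1' ω], fun ω => ?_⟩
  have h1 := hY1 ω
  have h2 := hY1' ω
  calc |W ω + W' ω| ≤ C * Y ω ^ q + C' * Y' ω ^ q :=
        (abs_add_le _ _).trans (add_le_add (hW ω) (hW' ω))
    _ ≤ C * (Y ω + Y' ω) ^ q + C' * (Y ω + Y' ω) ^ q := by
        gcongr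
        · linarith
        · linarith
    _ = _ := by ring

theorem of_abs_le (h : LpDominated μ p q W) {c : ℝ} (hc : 0 ≤ c) (hW : ∀ ω, |W' ω| ≤ c * |W ω|) :
    LpDominated μ p q W' := by
  obtain ⟨C, Y, hC, hY, hY1, hb⟩ := h
  refine ⟨c * C, Y, by positivity, hY, hY1, fun ω => (hW ω).trans ?_⟩
  rw [mul_assoc]
  gcongr
  exact hb ω

theorem neg (h : LpDominated μ p q W) : LpDominated μ p q (fun ω => -W ω) :=
  h.of_abs_le zero_le_one fun ω => by simp

theorem sub (h : LpDominated μ p q W) (h' : LpDominated μ p q W') (hq : 0 ≤ q) :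
    LpDominated μ p q (fun ω => W ω - W' ω) := by
  simpa [sub_eq_add_neg] using h.add h'.neg hq

theorem of_bound [IsFiniteMeasure μ] (c : ℝ) (hW : ∀ ω, |W ω| ≤ c) :
    LpDominated μ p q W := by
  refine ⟨|c|, fun _ => 1, abs_nonneg c, memLp_const 1, fun _ => le_rfl, fun ω => ?_⟩
  rw [Real.one_rpow, mul_one]
  exact (hW ω).trans (le_abs_self c)

theorem of_growth [IsFiniteMeasure μ] {S : Ω → ℝ} (hS : MemLp S (ENNReal.ofReal p) μ) {f : ℝ → ℝ}
    {A : ℝ} (hA : 0 ≤ A) (hf : ∀ x, |f x| ≤ A * (1 + |x|) ^ q) :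
    LpDominated μ p q (fun ω => f (S ω)) := by
  refine ⟨A, fun ω => 1 + ‖S ω‖, hA, ?_, fun ω => by linarith [norm_nonneg (S ω)], fun ω => hf _⟩
  exact (memLp_const (1 : ℝ)).add hS.norm

theorem of_memLp [IsFiniteMeasure μ] {S : Ω → ℝ} (hS : MemLp S (ENNReal.ofReal p) μ) :
    LpDominated μ p 1 S :=
  of_growth hS (f := fun x => x) zero_le_one fun x => by simp

theorem integrable [IsFiniteMeasure μ] (h : LpDominated μ p q W) (hW : Measurable W)
    (hp : 0 < p) (hqp : q ≤ p) : Integrable W μ := by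
  obtain ⟨C, Y, hC, hY, hY1, hb⟩ := h
  have hYp : Integrable (fun ω => Y ω ^ p) μ := by
    have h1 := hY.integrable_norm_rpow (by simpa using hp) ENNReal.ofReal_ne_top
    rw [ENNReal.toReal_ofReal hp.le] at h1
    refine h1.congr (ae_of_all _ fun ω => ?_)
    simp only [Real.norm_eq_abs]
    rw [abs_of_nonneg (by linarith [hY1 ω])]
  refine (hYp.const_mul C).mono' hW.aestronglyMeasurable (ae_of_all _ fun ω => ?_)
  rw [Real.norm_eq_abs]
  refine (hb ω).trans ?_
  gcongr
  · exact hY1 ω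

theorem comp_measurePreserving {θ : Ω → Ω} (h : LpDominated μ p q W)
    (hθ : MeasurePreserving θ μ μ) : LpDominated μ p q (fun ω => W (θ ω)) := by
  obtain ⟨C, Y, hC, hY, hY1, hb⟩ := h
  exact ⟨C, fun ω => Y (θ ω), hC, hY.comp_measurePreserving hθ, fun ω => hY1 _, fun ω => hb _⟩

end LpDominated

/-! ### Stationary martingale differences -/

/-- A stationary sequence of martingale differences with finite moment of order `p ∈ (2, 3]` and
positive variance `σ ^ 2`. -/
structure StationaryMDS {Ω : Type*} (F₀ : MeasurableSpace Ω) [mΩ : MeasurableSpace Ω]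
    (μ : Measure Ω) (T : Ω ≃ᵐ Ω) (X₀ : Ω → ℝ) (σ p : ℝ) : Prop where
  measurePreserving : MeasurePreserving T μ μ
  le : F₀ ≤ mΩ
  le_comap : F₀ ≤ F₀.comap T
  mds : IsMartingaleDiffSeq μ (shiftFiltration T.toEquiv F₀) (shiftSeq T.toEquiv X₀)
  integral_sq : ∫ ω, X₀ ω ^ 2 ∂μ = σ ^ 2
  sigma_pos : 0 < σ
  two_lt : 2 < p
  le_three : p ≤ 3
  memLp : MemLp X₀ (ENNReal.ofReal p) μ

/-- The normalized conditional variance defect `𝔼(S_n²/n | ℱ₀) - σ²`. -/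
noncomputable def varDefect {Ω : Type*} (F₀ : MeasurableSpace Ω) [mΩ : MeasurableSpace Ω]
    (μ : Measure Ω) (T : Ω ≃ᵐ Ω) (X₀ : Ω → ℝ) (σ : ℝ) (n : ℕ) (ω : Ω) : ℝ :=
  (μ[fun ω' => partialSum (shiftSeq T.toEquiv X₀) n ω' ^ 2 / (n : ℝ) | F₀]) ω - σ ^ 2

theorem measurePreserving_zpow {Ω : Type*} [MeasurableSpace Ω] {μ : Measure Ω} {T : Ω ≃ᵐ Ω}
    (hT : MeasurePreserving T μ μ) (i : ℤ) :
    MeasurePreserving (T.toEquiv ^ i : Equiv.Perm Ω) μ μ := by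
  have hsymm : MeasurePreserving T.symm μ μ := hT.symm T
  induction i with
  | zero => exact MeasurePreserving.id μ
  | succ i ih =>
    rw [zpow_add_one]
    exact ih.comp hT
  | pred i ih =>
    rw [zpow_sub_one]
    exact ih.comp hsymm

theorem shiftSeq_add {Ω : Type*} (T : Equiv.Perm Ω) (X₀ : Ω → ℝ) (i j : ℤ) (ω : Ω) :
    shiftSeq T X₀ (i + j) ω = shiftSeq T X₀ i ((T ^ j : Equiv.Perm Ω) ω) := by
  rw [shiftSeq, shiftSeq, zpow_add, Equiv.Perm.mul_apply]

theorem zpow_apply_zpow_neg {Ω : Type*} (T : Equiv.Perm Ω) (i : ℤ) (ω : Ω) :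
    (T ^ i : Equiv.Perm Ω) ((T ^ (-i) : Equiv.Perm Ω) ω) = ω := by
  rw [← Equiv.Perm.mul_apply, ← zpow_add, add_neg_cancel, zpow_zero, Equiv.Perm.one_apply]

theorem measurable_comp_zpow_neg {Ω : Type*} {F₀ : MeasurableSpace Ω} {T : Equiv.Perm Ω} {i : ℤ}
    {W : Ω → ℝ} (hW : Measurable[shiftFiltration T F₀ i] W) :
    Measurable[F₀] fun ω => W ((T ^ (-i) : Equiv.Perm Ω) ω) := by
  refine @Measurable.comp _ _ _ F₀ (shiftFiltration T F₀ i) _ _ _ hW ?_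
  rw [measurable_iff_comap_le, shiftFiltration, MeasurableSpace.comap_comp]
  have : (T ^ i : Equiv.Perm Ω) ∘ (T ^ (-i) : Equiv.Perm Ω) = id :=
    funext fun ω => zpow_apply_zpow_neg T i ω
  rw [this, MeasurableSpace.comap_id]

theorem partialSum_succ {Ω : Type*} (X : ℤ → Ω → ℝ) (n : ℕ) (ω : Ω) :
    partialSum X (n + 1) ω = partialSum X n ω + X ((n : ℤ) + 1) ω := by
  rw [partialSum, partialSum, Finset.sum_Icc_succ_top (by omega)]
  push_cast
  rfl

theorem partialSum_zero {Ω : Type*} (X : ℤ → Ω → ℝ) (ω : Ω) : partialSum X 0 ω = 0 := by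
  simp [partialSum]

theorem partialSum_shiftSeq_add {Ω : Type*} (T : Equiv.Perm Ω) (X₀ : Ω → ℝ) (b m : ℕ) (ω : Ω) :
    partialSum (shiftSeq T X₀) (b + m) ω = partialSum (shiftSeq T X₀) b ω +
      partialSum (shiftSeq T X₀) m ((T ^ (b : ℤ) : Equiv.Perm Ω) ω) := by
  induction m with
  | zero => simp [partialSum_zero]
  | succ m ih =>
    rw [← add_assoc, partialSum_succ, partialSum_succ, ih, ← shiftSeq_add, add_assoc]
    congr 3
    push_cast; ring

namespace StationaryMDS

variable {Ω : Type*} {F₀ : MeasurableSpace Ω} [mΩ : MeasurableSpace Ω] {μ : Measure Ω}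
  {T : Ω ≃ᵐ Ω} {X₀ : Ω → ℝ} {σ p : ℝ}

theorem filtration_le (h : StationaryMDS F₀ μ T X₀ σ p) (i : ℤ) :
    shiftFiltration T.toEquiv F₀ i ≤ mΩ := by
  have h1 := (measurePreserving_zpow h.measurePreserving i).measurable
  exact (MeasurableSpace.comap_mono h.le).trans h1.comap_le

theorem filtration_mono (h : StationaryMDS F₀ μ T X₀ σ p) :
    Monotone (shiftFiltration T.toEquiv F₀) := by
  refine monotone_int_of_le_succ fun i => ?_
  have h1 : shiftFiltration T.toEquiv F₀ (i + 1) =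
      (F₀.comap T).comap (T.toEquiv ^ i : Equiv.Perm Ω) := by
    rw [shiftFiltration, MeasurableSpace.comap_comp, add_comm, zpow_one_add]
    rfl
  rw [h1]
  exact MeasurableSpace.comap_mono h.le_comap

theorem filtration_zero : shiftFiltration T.toEquiv F₀ 0 = F₀ := by
  rw [shiftFiltration, zpow_zero]
  exact MeasurableSpace.comap_id

theorem measurable_seq (h : StationaryMDS F₀ μ T X₀ σ p) (i : ℤ) :
    Measurable (shiftSeq T.toEquiv X₀ i) :=
  (h.mds.adapted i).mono (h.filtration_le i) le_rfl

theorem memLp_seq (h : StationaryMDS F₀ μ T X₀ σ p) (i : ℤ) :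
    MemLp (shiftSeq T.toEquiv X₀ i) (ENNReal.ofReal p) μ :=
  h.memLp.comp_measurePreserving (measurePreserving_zpow h.measurePreserving i)

theorem adapted_partialSum (h : StationaryMDS F₀ μ T X₀ σ p) (n : ℕ) :
    Measurable[shiftFiltration T.toEquiv F₀ n] (partialSum (shiftSeq T.toEquiv X₀) n) := by
  refine Finset.measurable_fun_sum _ fun k hk => ?_
  refine (h.mds.adapted k).mono (h.filtration_mono ?_) le_rfl
  exact_mod_cast (Finset.mem_Icc.1 hk).2

theorem measurable_partialSum (h : StationaryMDS F₀ μ T X₀ σ p) (n : ℕ) :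
    Measurable (partialSum (shiftSeq T.toEquiv X₀) n) :=
  (h.adapted_partialSum n).mono (h.filtration_le n) le_rfl

theorem memLp_partialSum (h : StationaryMDS F₀ μ T X₀ σ p) (n : ℕ) :
    MemLp (partialSum (shiftSeq T.toEquiv X₀) n) (ENNReal.ofReal p) μ :=
  memLp_finsetSum _ fun k _ => h.memLp_seq k

theorem integral_seq_sq (h : StationaryMDS F₀ μ T X₀ σ p) (i : ℤ) :
    ∫ ω, shiftSeq T.toEquiv X₀ i ω ^ 2 ∂μ = σ ^ 2 := by
  have hm := measurePreserving_zpow h.measurePreserving i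
  have h0 : Measurable X₀ := h.measurable_seq 0
  rw [← h.integral_sq]
  conv_rhs => rw [← hm.map_eq]
  rw [integral_map hm.measurable.aemeasurable (by fun_prop)]
  rfl

theorem measurable_varDefect (_h : StationaryMDS F₀ μ T X₀ σ p) (n : ℕ) :
    Measurable[F₀] (varDefect F₀ μ T X₀ σ n) :=
  stronglyMeasurable_condExp.measurable.sub_const _

theorem measurable_varDefect' (h : StationaryMDS F₀ μ T X₀ σ p) (n : ℕ) :
    Measurable (varDefect F₀ μ T X₀ σ n) :=
  (h.measurable_varDefect n).mono h.le le_rfl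

variable [IsProbabilityMeasure μ]

/-- Martingale differences are orthogonal to the past. -/
theorem integral_mul_seq_eq_zero (h : StationaryMDS F₀ μ T X₀ σ p) {i : ℤ} {W : Ω → ℝ}
    (hW : Measurable[shiftFiltration T.toEquiv F₀ (i - 1)] W)
    (hint : Integrable (fun ω => W ω * shiftSeq T.toEquiv X₀ i ω) μ) :
    ∫ ω, W ω * shiftSeq T.toEquiv X₀ i ω ∂μ = 0 := by
  have h1 := condExp_mul_of_stronglyMeasurable_left (μ := μ)
    (m := shiftFiltration T.toEquiv F₀ (i - 1)) hW.stronglyMeasurable hint (h.mds.integrable i)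
  rw [← integral_condExp (h.filtration_le (i - 1))]
  refine (integral_congr_ae h1).trans ?_
  have h2 := h.mds.condExp_eq_zero i
  rw [integral_congr_ae (g := fun _ => 0)]
  · simp
  · filter_upwards [h2] with ω hω
    simp [hω]

/-- Expanding the square, `W * S_k` is known at time `k` and therefore orthogonal to `X_{k+1}`.
Domination of order `p - 2` leaves room for two factors in `L^p`. -/
theorem integral_mul_partialSum_sq (h : StationaryMDS F₀ μ T X₀ σ p) {W : Ω → ℝ}
    (hW : Measurable[F₀] W) (hWd : LpDominated μ p (p - 2) W) (n : ℕ) :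
    ∫ ω, W ω * partialSum (shiftSeq T.toEquiv X₀) n ω ^ 2 ∂μ =
      ∑ k ∈ Finset.range n, ∫ ω, W ω * shiftSeq T.toEquiv X₀ ((k : ℤ) + 1) ω ^ 2 ∂μ := by
  have hp := h.two_lt
  have hWm : Measurable W := hW.mono h.le le_rfl
  induction n with
  | zero => simp [partialSum_zero]
  | succ n ih =>
    have hS := h.measurable_partialSum n
    have hX := h.measurable_seq ((n : ℤ) + 1)
    have dS := LpDominated.of_memLp (h.memLp_partialSum n)
    have dX := LpDominated.of_memLp (h.memLp_seq ((n : ℤ) + 1))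
    have i1 : Integrable (fun ω => W ω * partialSum (shiftSeq T.toEquiv X₀) n ω ^ 2) μ := by
      have := hWd.mul (dS.mul dS zero_le_one zero_le_one) (by linarith) (by norm_num)
      simpa only [sq] using this.integrable (by fun_prop) (by linarith) (by linarith)
    have i2 : Integrable (fun ω => W ω * partialSum (shiftSeq T.toEquiv X₀) n ω *
        shiftSeq T.toEquiv X₀ ((n : ℤ) + 1) ω) μ :=
      ((hWd.mul dS (by linarith) zero_le_one).mul dX (by linarith) zero_le_one).integrable
        (by fun_prop) (by linarith) (by linarith)
    have i3 : Integrable (fun ω => W ω * shiftSeq T.toEquiv X₀ ((n : ℤ) + 1) ω ^ 2) μ := by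
      have := hWd.mul (dX.mul dX zero_le_one zero_le_one) (by linarith) (by norm_num)
      simpa only [sq] using this.integrable (by fun_prop) (by linarith) (by linarith)
    have hz : ∫ ω, W ω * partialSum (shiftSeq T.toEquiv X₀) n ω *
        shiftSeq T.toEquiv X₀ ((n : ℤ) + 1) ω ∂μ = 0 := by
      refine h.integral_mul_seq_eq_zero ?_ i2
      rw [add_sub_cancel_right]
      refine Measurable.mul (hW.mono ?_ le_rfl) (h.adapted_partialSum n)
      have := h.filtration_mono (Int.natCast_nonneg n)
      rwa [filtration_zero] at this
    rw [Finset.sum_range_succ, ← ih]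
    have hexp : (fun ω => W ω * partialSum (shiftSeq T.toEquiv X₀) (n + 1) ω ^ 2) = fun ω =>
        W ω * partialSum (shiftSeq T.toEquiv X₀) n ω ^ 2 +
        2 * (W ω * partialSum (shiftSeq T.toEquiv X₀) n ω * shiftSeq T.toEquiv X₀ ((n : ℤ) + 1) ω) +
        W ω * shiftSeq T.toEquiv X₀ ((n : ℤ) + 1) ω ^ 2 := by
      ext ω
      rw [partialSum_succ]; ring
    rw [hexp, integral_add (f := fun ω => _ + _) (i1.add (i2.const_mul 2)) i3, integral_add i1 (i2.const_mul 2),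
      integral_const_mul, hz, mul_zero, add_zero]

theorem integrable_mul_sq_sub (h : StationaryMDS F₀ μ T X₀ σ p) {W : Ω → ℝ}
    (hW : Measurable W) (hWd : LpDominated μ p (p - 2) W) (i : ℤ) :
    Integrable (fun ω => W ω * (shiftSeq T.toEquiv X₀ i ω ^ 2 - σ ^ 2)) μ := by
  have hp := h.two_lt
  have hX := h.measurable_seq i
  have dX := LpDominated.of_memLp (h.memLp_seq i)
  have d2 := (dX.mul dX zero_le_one zero_le_one).sub
    (LpDominated.of_bound (W := fun _ => σ ^ 2) |σ ^ 2| (fun _ => le_rfl))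
    (by norm_num)
  have := hWd.mul d2 (by linarith) (by norm_num)
  simpa only [sq] using this.integrable (by fun_prop) (by linarith) (by linarith)

/-- A factor known at time `0` passes through the conditional expectation, and the cross terms
vanish. Tested against the past, the defect of a block is thus additive along the block. -/
theorem integral_mul_varDefect (h : StationaryMDS F₀ μ T X₀ σ p) {W : Ω → ℝ}
    (hW : Measurable[F₀] W) (hWd : LpDominated μ p (p - 2) W) (n : ℕ) :
    Integrable (fun ω => W ω * (n * varDefect F₀ μ T X₀ σ n ω)) μ ∧
    ∫ ω, W ω * (n * varDefect F₀ μ T X₀ σ n ω) ∂μ =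
      ∑ k ∈ Finset.range n, ∫ ω, W ω * (shiftSeq T.toEquiv X₀ ((k : ℤ) + 1) ω ^ 2 - σ ^ 2) ∂μ := by
  have hp := h.two_lt
  have hWm : Measurable W := hW.mono h.le le_rfl
  rcases Nat.eq_zero_or_pos n with rfl | hn
  · simp
  have hn0 : (n : ℝ) ≠ 0 := by positivity
  have hS := h.measurable_partialSum n
  have dS := LpDominated.of_memLp (h.memLp_partialSum n)
  have iS : Integrable (fun ω => partialSum (shiftSeq T.toEquiv X₀) n ω ^ 2) μ := by
    simpa only [sq] using (dS.mul dS zero_le_one zero_le_one).integrable (by fun_prop)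
      (by linarith) (by linarith)
  have iWS : Integrable (fun ω => W ω * partialSum (shiftSeq T.toEquiv X₀) n ω ^ 2) μ := by
    have := hWd.mul (dS.mul dS zero_le_one zero_le_one) (by linarith) (by norm_num)
    simpa only [sq] using this.integrable (by fun_prop) (by linarith) (by linarith)
  have iW : Integrable W μ := hWd.integrable hWm (by linarith) (by linarith)
  set E := μ[fun ω' => partialSum (shiftSeq T.toEquiv X₀) n ω' ^ 2 / (n : ℝ) | F₀] with hE
  have h1 : μ[fun ω => W ω * (partialSum (shiftSeq T.toEquiv X₀) n ω ^ 2 / (n : ℝ)) | F₀]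
      =ᵐ[μ] fun ω => W ω * E ω :=
    condExp_mul_of_stronglyMeasurable_left hW.stronglyMeasurable
      ((iWS.div_const n).congr (ae_of_all _ fun ω => by simp only [mul_div_assoc]; rfl)) (iS.div_const _)
  have iWE : Integrable (fun ω => W ω * E ω) μ := integrable_condExp.congr h1
  have h2 : ∫ ω, W ω * E ω ∂μ = (∫ ω, W ω * partialSum (shiftSeq T.toEquiv X₀) n ω ^ 2 ∂μ) / n := by
    rw [← integral_congr_ae h1, integral_condExp h.le, ← integral_div]
    simp only [mul_div_assoc]
  have hrw : (fun ω => W ω * (n * varDefect F₀ μ T X₀ σ n ω)) =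
      fun ω => n * (W ω * E ω) - n * σ ^ 2 * W ω := by
    ext ω
    rw [varDefect]; ring
  rw [hrw]
  refine ⟨(iWE.const_mul _).sub (iW.const_mul _), ?_⟩
  rw [integral_sub (iWE.const_mul _) (iW.const_mul _), integral_const_mul, integral_const_mul, h2,
    h.integral_mul_partialSum_sq hW hWd, mul_div_cancel₀ _ hn0]
  have h3 : ∀ k ∈ Finset.range n,
      ∫ ω, W ω * (shiftSeq T.toEquiv X₀ ((k : ℤ) + 1) ω ^ 2 - σ ^ 2) ∂μ =
      ∫ ω, W ω * shiftSeq T.toEquiv X₀ ((k : ℤ) + 1) ω ^ 2 ∂μ - σ ^ 2 * ∫ ω, W ω ∂μ := by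
    intro k _
    have i1 := h.integrable_mul_sq_sub hWm hWd ((k : ℤ) + 1)
    have i3 : Integrable (fun ω => W ω * shiftSeq T.toEquiv X₀ ((k : ℤ) + 1) ω ^ 2) μ :=
      (i1.add (iW.const_mul (σ ^ 2))).congr (ae_of_all _ fun ω => by
        simp only [Pi.add_apply]; ring)
    rw [← integral_const_mul, ← integral_sub i3 (iW.const_mul _)]
    refine integral_congr_ae (ae_of_all _ fun ω => ?_)
    simp only; ring
  rw [Finset.sum_congr rfl h3, Finset.sum_sub_distrib, Finset.sum_const, Finset.card_range,
    nsmul_eq_mul, mul_assoc]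

/-- Pairing of a variable known at time `b` with the squares after time `b`. -/
theorem sum_integral_mul_sq_sub (h : StationaryMDS F₀ μ T X₀ σ p) {W : Ω → ℝ} {b : ℕ}
    (hW : Measurable[shiftFiltration T.toEquiv F₀ b] W) (hWd : LpDominated μ p (p - 2) W) (n : ℕ) :
    ∑ k ∈ Finset.range n,
      ∫ ω, W ω * (shiftSeq T.toEquiv X₀ (((b + k : ℕ) : ℤ) + 1) ω ^ 2 - σ ^ 2) ∂μ =
    ∫ ω, W ((T.toEquiv ^ (-(b : ℤ)) : Equiv.Perm Ω) ω) * (n * varDefect F₀ μ T X₀ σ n ω) ∂μ := by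
  have hm := measurePreserving_zpow h.measurePreserving (-(b : ℤ))
  have hW' := measurable_comp_zpow_neg hW
  have hWm : Measurable W := hW.mono (h.filtration_le b) le_rfl
  rw [(h.integral_mul_varDefect hW' (hWd.comp_measurePreserving hm) n).2]
  refine Finset.sum_congr rfl fun k _ => ?_
  have hX := h.measurable_seq (((b + k : ℕ) : ℤ) + 1)
  -- Translation by `T ^ (-b)` preserves `μ` and turns time `b` into time `0`.
  conv_lhs => rw [← hm.map_eq]
  rw [integral_map hm.measurable.aemeasurable (by fun_prop)]
  refine integral_congr_ae (ae_of_all _ fun ω => ?_)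
  simp only
  rw [← shiftSeq_add]
  congr 4
  push_cast; ring

end StationaryMDS

/-! ### Weighted moments of the conditional variance defects -/

theorem ofReal_rpow_le_tsum_dyadic {x τ α : ℝ} (hτ : 0 < τ) (hx : 0 ≤ x) (hα : 0 < α) :
    ENNReal.ofReal (x ^ α) ≤ ENNReal.ofReal ((2 * τ) ^ α) +
      ∑' i : ℕ, ENNReal.ofReal ((4 * (2 ^ i * τ)) ^ α) *
        (if 2 * (2 ^ i * τ) ≤ x then 1 else 0) := by
  rcases lt_or_ge x (2 * τ) with h | h
  · refine le_add_right (ENNReal.ofReal_le_ofReal ?_)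
    gcongr
  -- `i` indexes the dyadic shell `2 * (2 ^ i * τ) ≤ x < 4 * (2 ^ i * τ)`.
  · obtain ⟨i, hi1, hi2⟩ := exists_nat_pow_near (x := x / (2 * τ)) (y := 2)
      (by rwa [one_le_div (by positivity)]) one_lt_two
    rw [le_div_iff₀ (by positivity)] at hi1
    rw [div_lt_iff₀ (by positivity), pow_succ] at hi2
    refine le_add_left (le_trans ?_ (ENNReal.le_tsum i))
    rw [if_pos (by linarith), mul_one]
    refine ENNReal.ofReal_le_ofReal ?_
    gcongr
    linarith

theorem lintegral_absQuantile_le_envelopeNorm {Ω : Type*} [MeasurableSpace Ω] {μ : Measure Ω}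
    {X : Ω → ℝ} {p : ℝ} (hp : 2 ≤ p) :
    ∫⁻ u in Set.Ioo (0 : ℝ) 1, ENNReal.ofReal (absQuantile μ X u) ≤ envelopeNorm p X μ := by
  refine lintegral_mono fun u => ENNReal.ofReal_le_ofReal ?_
  exact le_mul_of_one_le_left (absQuantile_nonneg u)
    (Real.one_le_rpow (le_max_left _ _) (by linarith))

namespace StationaryMDS

variable {Ω : Type*} {F₀ : MeasurableSpace Ω} [mΩ : MeasurableSpace Ω] {μ : Measure Ω}
  {T : Ω ≃ᵐ Ω} {X₀ : Ω → ℝ} {σ p : ℝ} [IsProbabilityMeasure μ]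

/-- Let `W` be the sign of the defect of the whole block, cut off to `A`. The left side is the
pairing of `W` with that defect, which splits into the pairings for the first `m` and the next `n`
steps. In the second, `W` is translated and lives on a set with the same measure as `A`, so each
pairing is bounded by rearrangement. -/
theorem setLIntegral_varDefect_le_add (h : StationaryMDS F₀ μ T X₀ σ p) {A : Set Ω}
    (hA : MeasurableSet[F₀] A) (m n : ℕ) :
    ∫⁻ ω in A, ENNReal.ofReal |((m + n : ℕ) : ℝ) * varDefect F₀ μ T X₀ σ (m + n) ω| ∂μ ≤
      ENNReal.ofReal m * (∫⁻ u in Set.Ioo 0 (μ A).toReal,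
        ENNReal.ofReal (absQuantile μ (varDefect F₀ μ T X₀ σ m) u)) +
      ENNReal.ofReal n * (∫⁻ u in Set.Ioo 0 (μ A).toReal,
        ENNReal.ofReal (absQuantile μ (varDefect F₀ μ T X₀ σ n) u)) := by
  have hp := h.two_lt
  have hAm : MeasurableSet A := h.le _ hA
  set θ := (T.toEquiv ^ (-(m : ℤ)) : Equiv.Perm Ω) with hθ
  have hmp : MeasurePreserving θ μ μ := measurePreserving_zpow h.measurePreserving _
  set D := varDefect F₀ μ T X₀ σ with hD
  have hDm : ∀ k, Measurable (D k) := fun k => h.measurable_varDefect' k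
  set W : Ω → ℝ := A.indicator fun ω => if 0 ≤ D (m + n) ω then (1 : ℝ) else -1 with hW
  have hWF : Measurable[F₀] W := by
    refine Measurable.indicator (Measurable.ite ?_ measurable_const measurable_const) hA
    exact h.measurable_varDefect (m + n) measurableSet_Ici
  have hW1 : ∀ ω, |W ω| = A.indicator (fun _ => (1 : ℝ)) ω := fun ω => by
    rw [hW]
    by_cases hω : ω ∈ A
    · rw [Set.indicator_of_mem hω, Set.indicator_of_mem hω]
      split_ifs <;> simp
    · rw [Set.indicator_of_notMem hω, Set.indicator_of_notMem hω]; simp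
  have hW1' : ∀ ω, |W ω| ≤ 1 := fun ω => by
    rw [hW1]; exact Set.indicator_le_self' (fun _ _ => zero_le_one) ω
  have hWd : LpDominated μ p (p - 2) W := LpDominated.of_bound 1 hW1'
  have hWn : Measurable[shiftFiltration T.toEquiv F₀ m] W := by
    refine hWF.mono ?_ le_rfl
    have := h.filtration_mono (Int.natCast_nonneg m)
    rwa [filtration_zero] at this
  have e1 := (h.integral_mul_varDefect hWF hWd (m + n))
  have e2 := (h.integral_mul_varDefect hWF hWd m)
  have e3 := h.sum_integral_mul_sq_sub hWn hWd n
  have e4 := (h.integral_mul_varDefect (measurable_comp_zpow_neg hWn)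
    (hWd.comp_measurePreserving hmp) n).1
  have hsplit : ∫ ω, W ω * (((m + n : ℕ) : ℝ) * D (m + n) ω) ∂μ =
      ∫ ω, W ω * (m * D m ω) ∂μ + ∫ ω, W (θ ω) * (n * D n ω) ∂μ := by
    rw [e1.2, e2.2, ← e3, Finset.sum_range_add]
  have hbound : ∀ (B : Set Ω) (V : Ω → ℝ) (k : ℕ),
      (∀ ω, |V ω| = B.indicator (fun _ => (1 : ℝ)) ω) →
      MeasurableSet B → μ B = μ A → Integrable (fun ω => V ω * (k * D k ω)) μ →
      ENNReal.ofReal (∫ ω, V ω * (k * D k ω) ∂μ) ≤ ENNReal.ofReal k *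
        ∫⁻ u in Set.Ioo 0 (μ A).toReal, ENNReal.ofReal (absQuantile μ (D k) u) := by
    intro B V k hV hB hBA hi
    calc ENNReal.ofReal (∫ ω, V ω * (k * D k ω) ∂μ) ≤
          ENNReal.ofReal (∫ ω, |V ω * (k * D k ω)| ∂μ) :=
          ENNReal.ofReal_le_ofReal (integral_mono hi hi.abs fun ω => le_abs_self _)
      _ = ∫⁻ ω, ENNReal.ofReal |V ω * (k * D k ω)| ∂μ :=
          ofReal_integral_eq_lintegral_ofReal hi.abs (ae_of_all _ fun ω => abs_nonneg _)
      _ = ∫⁻ ω, B.indicator (fun ω => ENNReal.ofReal k * ENNReal.ofReal |D k ω|) ω ∂μ := by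
          refine lintegral_congr fun ω => ?_
          rw [abs_mul, hV]
          by_cases hω : ω ∈ B
          · rw [Set.indicator_of_mem hω, Set.indicator_of_mem hω, one_mul, abs_mul, Nat.abs_cast,
              ENNReal.ofReal_mul (Nat.cast_nonneg k)]
          · rw [Set.indicator_of_notMem hω, Set.indicator_of_notMem hω]; simp
      _ = ENNReal.ofReal k * ∫⁻ ω in B, ENNReal.ofReal |D k ω| ∂μ := by
          rw [lintegral_indicator hB, lintegral_const_mul' _ _ ENNReal.ofReal_ne_top]
      _ ≤ _ := by
          rw [← hBA]
          gcongr
          exact setLIntegral_abs_le_quantile (hDm k) B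
  have hlhs : ∫⁻ ω in A, ENNReal.ofReal |((m + n : ℕ) : ℝ) * D (m + n) ω| ∂μ =
      ENNReal.ofReal (∫ ω, W ω * (((m + n : ℕ) : ℝ) * D (m + n) ω) ∂μ) := by
    rw [ofReal_integral_eq_lintegral_ofReal e1.1 (ae_of_all _ fun ω => ?_),
      ← lintegral_indicator hAm]
    · refine lintegral_congr fun ω => ?_
      rw [hW]
      by_cases hω : ω ∈ A
      · rw [Set.indicator_of_mem hω, Set.indicator_of_mem hω, abs_mul, Nat.abs_cast]
        split_ifs with h0
        · rw [one_mul, abs_of_nonneg h0]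
        · rw [abs_of_neg (not_le.1 h0)]
          congr 1; ring
      · rw [Set.indicator_of_notMem hω, Set.indicator_of_notMem hω]; simp
    · simp only [hW, Pi.zero_apply]
      by_cases hω : ω ∈ A
      · rw [Set.indicator_of_mem hω]
        split_ifs with h0
        · rw [one_mul]; exact mul_nonneg (Nat.cast_nonneg _) h0
        · have := mul_nonneg (Nat.cast_nonneg (α := ℝ) (m + n)) (neg_nonneg.2 (not_le.1 h0).le)
          linarith
      · rw [Set.indicator_of_notMem hω]; simp
  rw [hlhs, hsplit]
  refine (ENNReal.ofReal_add_le).trans (add_le_add ?_ ?_)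
  · exact hbound A W m hW1 hAm rfl e2.1
  · refine hbound (θ ⁻¹' A) (fun ω => W (θ ω)) n (fun ω => ?_) (hmp.measurable hAm)
      (hmp.measure_preimage hAm.nullMeasurableSet) e4
    rw [hW1]
    rfl

/-- Averaging the subadditivity of the variance defects over all splittings of `N`. -/
theorem setLIntegral_varDefect_le_sum (h : StationaryMDS F₀ μ T X₀ σ p) {A : Set Ω}
    (hA : MeasurableSet[F₀] A) {N : ℕ} (hN : 0 < N) :
    ∫⁻ ω in A, ENNReal.ofReal |(N : ℝ) * varDefect F₀ μ T X₀ σ N ω| ∂μ ≤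
      ENNReal.ofReal (2 / N) * ∑ n ∈ Finset.range N, ENNReal.ofReal ((n + 1 : ℕ) : ℝ) *
        ∫⁻ u in Set.Ioo 0 (μ A).toReal,
          ENNReal.ofReal (absQuantile μ (varDefect F₀ μ T X₀ σ (n + 1)) u) := by
  set x := ∫⁻ ω in A, ENNReal.ofReal |(N : ℝ) * varDefect F₀ μ T X₀ σ N ω| ∂μ with hx
  set f : ℕ → ℝ≥0∞ := fun n => ENNReal.ofReal (n : ℝ) * ∫⁻ u in Set.Ioo 0 (μ A).toReal,
          ENNReal.ofReal (absQuantile μ (varDefect F₀ μ T X₀ σ n) u) with hf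
  have h1 : ∀ n ∈ Finset.range (N + 1), x ≤ f n + f (N - n) := by
    intro n hn
    have hnN : n + (N - n) = N := by
      have := Finset.mem_range.1 hn
      omega
    have := h.setLIntegral_varDefect_le_add hA n (N - n)
    rw [hnN] at this
    exact this
  have h2 : ((N + 1 : ℕ) : ℝ≥0∞) * x ≤ 2 * ∑ n ∈ Finset.range (N + 1), f n := by
    calc ((N + 1 : ℕ) : ℝ≥0∞) * x = ∑ n ∈ Finset.range (N + 1), x := by
          rw [Finset.sum_const, Finset.card_range, nsmul_eq_mul]
      _ ≤ ∑ n ∈ Finset.range (N + 1), (f n + f (N - n)) := Finset.sum_le_sum h1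
      _ = _ := by
          rw [Finset.sum_add_distrib, two_mul]
          congr 1
          have := Finset.sum_range_reflect f (N + 1)
          simpa using this
  have hf0 : f 0 = 0 := by simp [hf]
  rw [Finset.sum_range_succ', hf0, add_zero] at h2
  have hN' : (N : ℝ≥0∞) * x ≤ 2 * ∑ n ∈ Finset.range N, f (n + 1) := by
    refine le_trans ?_ h2
    gcongr
    omega
  have hNe : (N : ℝ≥0∞) ≠ 0 := by simpa using hN.ne'
  have hcast : ENNReal.ofReal (2 / N) = 2 / N := by
    rw [ENNReal.ofReal_div_of_pos (by exact_mod_cast hN)]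
    simp
  rw [hcast, ENNReal.div_eq_inv_mul, mul_assoc]
  rwa [← ENNReal.div_eq_inv_mul, ENNReal.le_div_iff_mul_le (Or.inl hNe) (Or.inl (by simp)),
    mul_comm]

end StationaryMDS

namespace StationaryMDS

variable {Ω : Type*} {F₀ : MeasurableSpace Ω} [mΩ : MeasurableSpace Ω] {μ : Measure Ω}
  {T : Ω ≃ᵐ Ω} {X₀ : Ω → ℝ} {σ p : ℝ}

/-- The sum of the `m` variables up to time `0`. -/
noncomputable def pastSum (T : Ω ≃ᵐ Ω) (X₀ : Ω → ℝ) (m : ℕ) (ω : Ω) : ℝ :=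
  partialSum (shiftSeq T.toEquiv X₀) m ((T.toEquiv ^ (-(m : ℤ)) : Equiv.Perm Ω) ω)

theorem measurable_pastSum (h : StationaryMDS F₀ μ T X₀ σ p) (m : ℕ) :
    Measurable[F₀] (pastSum T X₀ m) :=
  measurable_comp_zpow_neg (h.adapted_partialSum m)

/-- The law of `S_m` is within `K` of the normal law of the same variance, when tested on functions
whose second derivative is `(p-2)`-Hölder. -/
def NormalApprox (μ : Measure Ω) (T : Ω ≃ᵐ Ω) (X₀ : Ω → ℝ) (σ p : ℝ) (m : ℕ) (K : ℝ) : Prop :=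
  ∀ f f₁ f₂ : ℝ → ℝ, (∀ x, HasDerivAt f (f₁ x) x) → (∀ x, HasDerivAt f₁ (f₂ x) x) →
    (∀ x y, |f₂ x - f₂ y| ≤ |x - y| ^ (p - 2)) →
    |∫ ω, f (partialSum (shiftSeq T.toEquiv X₀) m ω) ∂μ - gaussSmooth (σ * √m) f 0| ≤ K

variable [IsProbabilityMeasure μ]

/-- `pastSum T X₀ m` has the law of `S_m`, and `√m ≤ τ` bounds the normal tail at `2 ^ i * τ` by
`P(σ|Y| ≥ 2 ^ i)`. The estimate of `exists_sum_tail_excess_le` holds for every finite set of levels;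
restricting it to those with positive excess produces the positive parts. -/
theorem exists_tsum_excess_pastSum_le (h : StationaryMDS F₀ μ T X₀ σ p) :
    ∃ H : ℝ, 0 ≤ H ∧ ∀ (m : ℕ) (τ K : ℝ), 0 < τ → √m ≤ τ → NormalApprox μ T X₀ σ p m K →
      ∑' i : ℕ, ENNReal.ofReal (((2 : ℝ) ^ i) ^ p *
        max ((μ {ω | 2 * (2 ^ i * τ) ≤ |pastSum T X₀ m ω|}).toReal -
          (gaussianReal 0 1 {y | 2 ^ i ≤ σ * |y|}).toReal) 0) ≤
        ENNReal.ofReal (H * K / τ ^ p) := by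
  obtain ⟨H, hH0, hH⟩ := exists_sum_tail_excess_le h.two_lt h.le_three
  refine ⟨H, hH0, fun m τ K hτ hm hK => ?_⟩
  have hσ := h.sigma_pos
  have hSm := h.measurable_partialSum m
  set S := partialSum (shiftSeq T.toEquiv X₀) m with hS
  have hmp := measurePreserving_zpow h.measurePreserving (-(m : ℤ))
  have hpr : IsProbabilityMeasure (μ.map S) := Measure.isProbabilityMeasure_map hSm.aemeasurable
  have key := hH (μ.map S) (σ * √m) τ K hτ fun f f₁ f₂ hf hf₁ hf₂ => by
    have hfc : Continuous f := continuous_iff_continuousAt.2 fun x => (hf x).continuousAt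
    rw [integral_map hSm.aemeasurable hfc.aestronglyMeasurable]
    exact hK f f₁ f₂ hf hf₁ hf₂
  set P : ℕ → ℝ := fun i => (μ {ω | 2 * (2 ^ i * τ) ≤ |pastSum T X₀ m ω|}).toReal with hP
  set g : ℕ → ℝ := fun i => (gaussianReal 0 1 {y : ℝ | 2 ^ i ≤ σ * |y|}).toReal with hg
  have hPi : ∀ i, (μ.map S).real {x | 2 * (2 ^ i * τ) ≤ |x|} = P i := fun i => by
    have hms : MeasurableSet {x : ℝ | 2 * (2 ^ i * τ) ≤ |x|} :=
      measurableSet_le (by fun_prop) (by fun_prop)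
    rw [measureReal_def, Measure.map_apply hSm hms, hP]
    simp only
    rw [← hmp.measure_preimage (hSm hms).nullMeasurableSet]
    rfl
  have hgi : ∀ i, (gaussianReal 0 1).real {y | 2 ^ i * τ ≤ |σ * √m * y|} ≤ g i := fun i => by
    refine ENNReal.toReal_mono (measure_ne_top _ _) (measure_mono fun y hy => ?_)
    have hy' : 2 ^ i * τ ≤ |σ * √m * y| := hy
    rw [abs_mul, abs_of_nonneg (by positivity : 0 ≤ σ * √m)] at hy'
    have h1 : σ * √m * |y| ≤ σ * τ * |y| := by gcongr
    have h2 : 2 ^ i * τ ≤ (σ * |y|) * τ := by linarith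
    exact le_of_mul_le_mul_right h2 hτ
  have hτp : 0 < τ ^ p := Real.rpow_pos_of_pos hτ p
  rw [ENNReal.tsum_eq_iSup_sum]
  refine iSup_le fun F => ?_
  rw [← ENNReal.ofReal_sum_of_nonneg fun i _ => by positivity]
  refine ENNReal.ofReal_le_ofReal ?_
  rw [le_div_iff₀ hτp]
  calc (∑ i ∈ F, ((2 : ℝ) ^ i) ^ p * max (P i - g i) 0) * τ ^ p
      = ∑ i ∈ F.filter fun i => g i < P i, (2 ^ i * τ) ^ p * (P i - g i) := by
        rw [Finset.sum_filter, Finset.sum_mul]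
        refine Finset.sum_congr rfl fun i _ => ?_
        rw [Real.mul_rpow (by positivity) hτ.le]
        split_ifs with hi
        · rw [max_eq_left (by linarith)]
          ring
        · rw [max_eq_right (by linarith)]
          ring
    _ ≤ _ := (Finset.sum_le_sum fun i _ => ?_).trans (key (F.filter fun i => g i < P i))
  rw [hPi]
  have := hgi i
  gcongr

end StationaryMDS

namespace StationaryMDS

variable {Ω : Type*} {F₀ : MeasurableSpace Ω} [mΩ : MeasurableSpace Ω] {μ : Measure Ω}
  {T : Ω ≃ᵐ Ω} {X₀ : Ω → ℝ} {σ p : ℝ} [IsProbabilityMeasure μ]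

theorem lintegral_varDefect_le (h : StationaryMDS F₀ μ T X₀ σ p) {N : ℕ} (hN : 0 < N) :
    ∫⁻ ω, ENNReal.ofReal |(N : ℝ) * varDefect F₀ μ T X₀ σ N ω| ∂μ ≤
      ENNReal.ofReal (2 / N) * ∑ n ∈ Finset.range N, ENNReal.ofReal ((n + 1 : ℕ) : ℝ) *
        envelopeNorm p (varDefect F₀ μ T X₀ σ (n + 1)) μ := by
  have h1 := h.setLIntegral_varDefect_le_sum (A := Set.univ) MeasurableSet.univ hN
  rw [setLIntegral_univ] at h1
  refine h1.trans ?_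
  simp only [measure_univ, ENNReal.toReal_one]
  gcongr
  exact lintegral_absQuantile_le_envelopeNorm h.two_lt.le

/-- Expand `|pastSum| ^ (p - 2)` over dyadic tail events at scale `τ = √N`, and bound the defect on
each event by quantile integrals over `(0, P i)`. Splitting `P i` into a normal tail and an excess,
the former yields `envelopeNorm` and the latter the `L^(p/2)` norm. -/
theorem exists_lintegral_pastSum_mul_varDefect_le (h : StationaryMDS F₀ μ T X₀ σ p) :
    ∃ C : ℝ, 0 ≤ C ∧ ∀ (N m : ℕ) (D : ℝ), 0 < N → m ≤ N → 0 ≤ D →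
      NormalApprox μ T X₀ σ p m (D * N) →
      ∫⁻ ω, ENNReal.ofReal (|pastSum T X₀ m ω| ^ (p - 2)) *
        ENNReal.ofReal |(N : ℝ) * varDefect F₀ μ T X₀ σ N ω| ∂μ ≤
      ENNReal.ofReal (C / N) * ∑ n ∈ Finset.range N, ENNReal.ofReal ((n + 1 : ℕ) : ℝ) *
        (ENNReal.ofReal ((N : ℝ) ^ ((p - 2) / 2)) *
          envelopeNorm p (varDefect F₀ μ T X₀ σ (n + 1)) μ +
        ENNReal.ofReal (D ^ ((p - 2) / p) * (N : ℝ) ^ ((p - 2) / p)) *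
          eLpNorm (varDefect F₀ μ T X₀ σ (n + 1)) (ENNReal.ofReal (p / 2)) μ) := by
  obtain ⟨H, hH0, hH⟩ := h.exists_tsum_excess_pastSum_le
  obtain ⟨C₁, hC₁0, hC₁⟩ := exists_tsum_gaussian_tail_le h.two_lt h.sigma_pos
  obtain ⟨C₂, hC₂0, hC₂⟩ := exists_tsum_excess_le h.two_lt
  have hp := h.two_lt
  set α := p - 2 with hα
  have hα0 : 0 < α := by linarith
  set θ := α / p with hθ
  have hθ0 : 0 < θ := div_pos hα0 (by linarith)
  set c : ℝ := (2 : ℝ) ^ α + 4 ^ α * C₁ + 4 ^ α * (C₂ * H ^ θ) with hc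
  have hc0 : 0 ≤ c := by positivity
  refine ⟨2 * c, by positivity, fun N m D hN hmN hD hK => ?_⟩
  have hN0 : (0 : ℝ) < N := by exact_mod_cast hN
  set τ := √(N : ℝ) with hτ
  have hτ0 : 0 < τ := Real.sqrt_pos.2 hN0
  have hmτ : √(m : ℝ) ≤ τ := Real.sqrt_le_sqrt (by exact_mod_cast hmN)
  have hτα : τ ^ α = (N : ℝ) ^ (α / 2) := by
    rw [hτ, Real.sqrt_eq_rpow, ← Real.rpow_mul hN0.le]
    ring_nf
  have hτp : (τ ^ p) ^ θ = τ ^ α := by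
    rw [← Real.rpow_mul hτ0.le, hθ]
    congr 1
    field_simp
  set a : Ω → ℝ≥0∞ := fun ω => ENNReal.ofReal |(N : ℝ) * varDefect F₀ μ T X₀ σ N ω| with ha
  have ham : Measurable a := by
    have := h.measurable_varDefect' N
    fun_prop
  set A : ℕ → Set Ω := fun i => {ω | 2 * (2 ^ i * τ) ≤ |pastSum T X₀ m ω|} with hA
  have hAF : ∀ i, MeasurableSet[F₀] (A i) := fun i => by
    have := h.measurable_pastSum m
    have h2 : MeasurableSet {x : ℝ | 2 * (2 ^ i * τ) ≤ |x|} :=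
      measurableSet_le (by fun_prop) (by fun_prop)
    exact this h2
  set M : ℕ → ℝ → ℝ≥0∞ := fun n v => ∫⁻ u in Set.Ioo 0 v,
    ENNReal.ofReal (absQuantile μ (varDefect F₀ μ T X₀ σ (n + 1)) u) with hM
  set P : ℕ → ℝ := fun i => (μ (A i)).toReal with hP
  set g : ℕ → ℝ := fun i => (gaussianReal 0 1 {y : ℝ | 2 ^ i ≤ σ * |y|}).toReal with hg
  have hP1 : ∀ i, P i ≤ 1 := fun i =>
    ENNReal.toReal_le_of_le_ofReal zero_le_one (by simpa using prob_le_one)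
  set E : ℕ → ℝ≥0∞ := fun n => envelopeNorm p (varDefect F₀ μ T X₀ σ (n + 1)) μ with hE
  set Lp : ℕ → ℝ≥0∞ := fun n =>
    eLpNorm (varDefect F₀ μ T X₀ σ (n + 1)) (ENNReal.ofReal (p / 2)) μ with hLp
  have hpow : ∀ i : ℕ, ENNReal.ofReal ((4 * (2 ^ i * τ)) ^ α) =
      ENNReal.ofReal ((4 * τ) ^ α) * ENNReal.ofReal (((2 : ℝ) ^ i) ^ α) := fun i => by
    rw [← ENNReal.ofReal_mul (by positivity), ← Real.mul_rpow (by positivity) (by positivity)]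
    ring_nf
  have hexc : (∑' i : ℕ, ENNReal.ofReal (((2 : ℝ) ^ i) ^ p * max (P i - g i) 0)) ^ θ ≤
      ENNReal.ofReal ((H * (D * N) / τ ^ p) ^ θ) := by
    rw [← ENNReal.ofReal_rpow_of_nonneg (by positivity) hθ0.le]
    exact ENNReal.rpow_le_rpow (hH m τ (D * N) hτ0 hmτ hK) hθ0.le
  have hbr : ∀ n, ENNReal.ofReal ((2 * τ) ^ α) * M n 1 +
      ∑' i : ℕ, ENNReal.ofReal ((4 * (2 ^ i * τ)) ^ α) * M n (P i) ≤
      ENNReal.ofReal c * (ENNReal.ofReal ((N : ℝ) ^ (α / 2)) * E n +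
        ENNReal.ofReal (D ^ θ * (N : ℝ) ^ θ) * Lp n) := fun n => by
    have hDm := h.measurable_varDefect' (n + 1)
    have h1 : M n 1 ≤ E n := lintegral_absQuantile_le_envelopeNorm hp.le
    have h2 : ∑' i : ℕ, ENNReal.ofReal (((2 : ℝ) ^ i) ^ α) * M n (P i) ≤
        ENNReal.ofReal C₁ * E n +
          ENNReal.ofReal C₂ * ENNReal.ofReal ((H * (D * N) / τ ^ p) ^ θ) * Lp n := by
      calc ∑' i : ℕ, ENNReal.ofReal (((2 : ℝ) ^ i) ^ α) * M n (P i)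
          ≤ ∑' i : ℕ, (ENNReal.ofReal (((2 : ℝ) ^ i) ^ α) * M n (g i) +
              ENNReal.ofReal (((2 : ℝ) ^ i) ^ α) * M n (max (P i - g i) 0)) := by
            refine ENNReal.tsum_le_tsum fun i => ?_
            rw [← mul_add]
            gcongr
            exact lintegral_absQuantile_le_add hDm ENNReal.toReal_nonneg
        _ ≤ _ := by
            rw [ENNReal.tsum_add]
            refine add_le_add (hC₁ μ _ hDm) ((hC₂ μ _ hDm _ (fun i => le_max_right _ _)
              fun i => max_le ?_ zero_le_one).trans ?_)
            · have : 0 ≤ g i := ENNReal.toReal_nonneg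
              linarith [hP1 i]
            · gcongr
    -- The normalization `τ ^ p` of the excess, raised to the power `θ`, cancels the level factor `τ
    -- ^ α`, leaving `(D * N) ^ θ`.
    have h3 : (4 * τ) ^ α * (C₂ * (H * (D * N) / τ ^ p) ^ θ) =
        4 ^ α * (C₂ * H ^ θ) * (D ^ θ * (N : ℝ) ^ θ) := by
      rw [Real.div_rpow (by positivity) (by positivity), hτp, Real.mul_rpow (by positivity) hτ0.le,
        Real.mul_rpow hH0 (by positivity), Real.mul_rpow hD hN0.le]
      have : τ ^ α ≠ 0 := by positivity
      field_simp
    have h4 : (2 * τ) ^ α = 2 ^ α * (N : ℝ) ^ (α / 2) := by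
      rw [Real.mul_rpow zero_le_two hτ0.le, hτα]
    have h5 : (4 * τ) ^ α = 4 ^ α * (N : ℝ) ^ (α / 2) := by
      rw [Real.mul_rpow (by norm_num) hτ0.le, hτα]
    simp_rw [hpow, mul_assoc]
    rw [ENNReal.tsum_mul_left]
    calc _ ≤ ENNReal.ofReal ((2 * τ) ^ α) * E n + ENNReal.ofReal ((4 * τ) ^ α) *
          (ENNReal.ofReal C₁ * E n +
          ENNReal.ofReal C₂ * ENNReal.ofReal ((H * (D * N) / τ ^ p) ^ θ) * Lp n) := by gcongr
      _ = ENNReal.ofReal ((2 ^ α + 4 ^ α * C₁) * (N : ℝ) ^ (α / 2)) * E n +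
          ENNReal.ofReal (4 ^ α * (C₂ * H ^ θ) * (D ^ θ * (N : ℝ) ^ θ)) * Lp n := by
          rw [← h3, mul_add, ← mul_assoc, ← mul_assoc, ← add_assoc, ← add_mul,
            ← ENNReal.ofReal_mul (by positivity), ← ENNReal.ofReal_mul (by positivity),
            ← ENNReal.ofReal_mul (by positivity), ← ENNReal.ofReal_add (by positivity)
              (by positivity), h4, h5]
          ring_nf
      _ ≤ ENNReal.ofReal (c * (N : ℝ) ^ (α / 2)) * E n +
          ENNReal.ofReal (c * (D ^ θ * (N : ℝ) ^ θ)) * Lp n := by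
          gcongr
          · exact le_add_of_nonneg_right (by positivity)
          · exact le_add_of_nonneg_left (by positivity)
      _ = _ := by
          rw [ENNReal.ofReal_mul hc0, ENNReal.ofReal_mul hc0]
          ring
  calc ∫⁻ ω, ENNReal.ofReal (|pastSum T X₀ m ω| ^ α) * a ω ∂μ
      ≤ ∫⁻ ω, (ENNReal.ofReal ((2 * τ) ^ α) * a ω + ∑' i : ℕ,
          ENNReal.ofReal ((4 * (2 ^ i * τ)) ^ α) * (A i).indicator a ω) ∂μ := by
        refine lintegral_mono fun ω => ?_
        have h1 := ofReal_rpow_le_tsum_dyadic hτ0 (abs_nonneg (pastSum T X₀ m ω)) hα0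
        refine (mul_le_mul_left h1 (a ω)).trans (le_of_eq ?_)
        rw [add_mul, ← ENNReal.tsum_mul_right]
        congr 2
        ext i
        by_cases hi : 2 * (2 ^ i * τ) ≤ |pastSum T X₀ m ω|
        · rw [Set.indicator_of_mem (show ω ∈ A i from hi), if_pos hi, mul_one]
        · rw [Set.indicator_of_notMem (show ω ∉ A i from hi), if_neg hi]
          simp
    _ = ENNReal.ofReal ((2 * τ) ^ α) * (∫⁻ ω, a ω ∂μ) + ∑' i : ℕ,
          ENNReal.ofReal ((4 * (2 ^ i * τ)) ^ α) * ∫⁻ ω in A i, a ω ∂μ := by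
        rw [lintegral_add_left (by fun_prop), lintegral_const_mul _ ham, lintegral_tsum]
        · congr 2
          ext i
          rw [lintegral_const_mul _ (ham.indicator (h.le _ (hAF i))),
            lintegral_indicator (h.le _ (hAF i))]
        · exact fun i => ((ham.indicator (h.le _ (hAF i))).const_mul _).aemeasurable
    _ ≤ ENNReal.ofReal ((2 * τ) ^ α) * (ENNReal.ofReal (2 / N) * ∑ n ∈ Finset.range N,
          ENNReal.ofReal ((n + 1 : ℕ) : ℝ) * M n 1) + ∑' i : ℕ,
          ENNReal.ofReal ((4 * (2 ^ i * τ)) ^ α) * (ENNReal.ofReal (2 / N) *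
            ∑ n ∈ Finset.range N, ENNReal.ofReal ((n + 1 : ℕ) : ℝ) * M n (P i)) := by
        gcongr with i
        · have := h.setLIntegral_varDefect_le_sum (A := Set.univ) MeasurableSet.univ hN
          simpa only [setLIntegral_univ, measure_univ, ENNReal.toReal_one] using this
        · exact h.setLIntegral_varDefect_le_sum (hAF i) hN
    _ = ENNReal.ofReal (2 / N) * ∑ n ∈ Finset.range N, ENNReal.ofReal ((n + 1 : ℕ) : ℝ) *
          (ENNReal.ofReal ((2 * τ) ^ α) * M n 1 +
            ∑' i : ℕ, ENNReal.ofReal ((4 * (2 ^ i * τ)) ^ α) * M n (P i)) := by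
        simp_rw [mul_add, Finset.sum_add_distrib, mul_add]
        congr 1
        · rw [mul_left_comm, Finset.mul_sum]
          simp_rw [mul_left_comm (ENNReal.ofReal ((2 * τ) ^ α))]
        · simp_rw [mul_left_comm _ (ENNReal.ofReal (2 / N : ℝ))]
          rw [ENNReal.tsum_mul_left]
          congr 1
          simp_rw [Finset.mul_sum, ← ENNReal.tsum_mul_left]
          rw [Summable.tsum_finsetSum fun _ _ => ENNReal.summable]
          simp_rw [mul_left_comm (ENNReal.ofReal ((4 * (2 ^ _ * τ)) ^ α))]
    _ ≤ ENNReal.ofReal (2 / N) * ∑ n ∈ Finset.range N, ENNReal.ofReal ((n + 1 : ℕ) : ℝ) *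
          (ENNReal.ofReal c * (ENNReal.ofReal ((N : ℝ) ^ (α / 2)) * E n +
            ENNReal.ofReal (D ^ θ * (N : ℝ) ^ θ) * Lp n)) := by
        gcongr with n
        exact hbr n
    _ = _ := by
        simp_rw [mul_left_comm _ (ENNReal.ofReal c)]
        rw [← Finset.mul_sum, ← mul_assoc, ← ENNReal.ofReal_mul (by positivity),
          show (2 : ℝ) / N * c = 2 * c / N by ring]

/-- The weighted moments of the conditional variance defects that are needed in the Lindeberg
argument are summable over dyadic blocks. -/
theorem exists_block_bound (h : StationaryMDS F₀ μ T X₀ σ p)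
    (hC1 : ∑' n : ℕ, ENNReal.ofReal (1 / ((n + 1 : ℕ) : ℝ) ^ (2 - p / 2)) *
      envelopeNorm p (varDefect F₀ μ T X₀ σ (n + 1)) μ < ∞)
    (hC2 : ∑' n : ℕ, ENNReal.ofReal (1 / ((n + 1 : ℕ) : ℝ) ^ (2 / p)) *
      eLpNorm (varDefect F₀ μ T X₀ σ (n + 1)) (ENNReal.ofReal (p / 2)) μ < ∞) :
    ∃ K₀ K₁ : ℝ, 0 ≤ K₀ ∧ 0 ≤ K₁ ∧ ∀ D : ℝ, 0 ≤ D → ∃ B : ℕ → ℝ, (∀ j, 0 ≤ B j) ∧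
      (∀ J : ℕ, ∑ j ∈ Finset.range J, ((2 : ℝ) ^ j)⁻¹ * B j ≤ K₀ + K₁ * D ^ ((p - 2) / p)) ∧
      ∀ j m : ℕ, m ≤ 2 ^ j → NormalApprox μ T X₀ σ p m (D * 2 ^ j) →
        ∫ ω, (2 + |pastSum T X₀ m ω| ^ (p - 2) +
          ∫ y, |σ * √m * y| ^ (p - 2) ∂gaussianReal 0 1) *
          |((2 ^ j : ℕ) : ℝ) * varDefect F₀ μ T X₀ σ (2 ^ j) ω| ∂μ ≤ B j := by
  obtain ⟨C, hC0, hC⟩ := h.exists_lintegral_pastSum_mul_varDefect_le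
  have hp := h.two_lt
  have hp3 := h.le_three
  have hσ := h.sigma_pos
  set α := p - 2 with hα
  have hα0 : 0 < α := by linarith
  set θ := α / p with hθ
  -- At scale `2 ^ j` there are two factors `2 ^ (-j)`, one from the weight of the block and one
  -- from averaging over splittings, times `2 ^ (j (p - 2) / 2)` or `2 ^ (j (p - 2) / p)`. This
  -- gives the exponents `3 - p / 2` and `1 + 2 / p`; the factor `n + 1` lowers each by one, to
  -- those of the two hypotheses.
  obtain ⟨C₁, hC₁t, hC₁⟩ := exists_tsum_dyadic_le (s := 3 - p / 2) (by linarith)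
  obtain ⟨C₂, hC₂t, hC₂⟩ := exists_tsum_dyadic_le (s := 1 + 2 / p) (by positivity)
  set E : ℕ → ℝ≥0∞ := fun n => envelopeNorm p (varDefect F₀ μ T X₀ σ (n + 1)) μ with hE
  set Lp : ℕ → ℝ≥0∞ := fun n =>
    eLpNorm (varDefect F₀ μ T X₀ σ (n + 1)) (ENNReal.ofReal (p / 2)) μ with hLp
  set G : ℝ := ∫ y, |y| ^ α ∂gaussianReal 0 1 with hG
  have hG0 : 0 ≤ G := integral_nonneg fun y => by positivity
  set c : ℝ := 2 * (2 + σ ^ α * G) + C with hc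
  have hc0 : 0 ≤ c := by positivity
  set s₁ := ∑' n : ℕ, ENNReal.ofReal (1 / ((n + 1 : ℕ) : ℝ) ^ (2 - p / 2)) * E n with hs₁
  set s₂ := ∑' n : ℕ, ENNReal.ofReal (1 / ((n + 1 : ℕ) : ℝ) ^ (2 / p)) * Lp n with hs₂
  have hfin1 : ENNReal.ofReal c * (C₁ * s₁) ≠ ∞ :=
    ENNReal.mul_ne_top ENNReal.ofReal_ne_top (ENNReal.mul_ne_top hC₁t hC1.ne)
  have hfin2 : ENNReal.ofReal c * (C₂ * s₂) ≠ ∞ :=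
    ENNReal.mul_ne_top ENNReal.ofReal_ne_top (ENNReal.mul_ne_top hC₂t hC2.ne)
  -- Neither constant depends on `D`, which enters only through a power less than `1`. The bootstrap
  -- rests on this.
  refine ⟨(ENNReal.ofReal c * (C₁ * s₁)).toReal, (ENNReal.ofReal c * (C₂ * s₂)).toReal,
    ENNReal.toReal_nonneg, ENNReal.toReal_nonneg, fun D hD => ?_⟩
  set b : ℕ → ℝ≥0∞ := fun j => ENNReal.ofReal (c / (2 : ℝ) ^ j) *
    ∑ n ∈ Finset.range (2 ^ j), ENNReal.ofReal ((n + 1 : ℕ) : ℝ) *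
      (ENNReal.ofReal (((2 : ℝ) ^ j) ^ (α / 2)) * E n +
        ENNReal.ofReal (D ^ θ * ((2 : ℝ) ^ j) ^ θ) * Lp n) with hb
  have hsum : ∑' j : ℕ, ENNReal.ofReal (((2 : ℝ) ^ j)⁻¹) * b j ≤
      ENNReal.ofReal c * (C₁ * s₁) + ENNReal.ofReal (D ^ θ) * (ENNReal.ofReal c * (C₂ * s₂)) := by
    have hsplit : ∀ j : ℕ, ENNReal.ofReal (((2 : ℝ) ^ j)⁻¹) * b j =
        ENNReal.ofReal c * (ENNReal.ofReal (((2 : ℝ) ^ j) ^ (-(3 - p / 2))) *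
          ∑ n ∈ Finset.range (2 ^ j), ENNReal.ofReal ((n + 1 : ℕ) : ℝ) * E n) +
        ENNReal.ofReal (D ^ θ) * (ENNReal.ofReal c *
          (ENNReal.ofReal (((2 : ℝ) ^ j) ^ (-(1 + 2 / p))) *
          ∑ n ∈ Finset.range (2 ^ j), ENNReal.ofReal ((n + 1 : ℕ) : ℝ) * Lp n)) := fun j => by
      have hj : (0 : ℝ) < 2 ^ j := by positivity
      have e1 : ((2 : ℝ) ^ j) ^ (-(3 - p / 2)) =
          ((2 : ℝ) ^ j)⁻¹ * (((2 : ℝ) ^ j)⁻¹ * ((2 : ℝ) ^ j) ^ (α / 2)) := by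
        rw [← Real.rpow_neg_one, ← Real.rpow_add hj, ← Real.rpow_add hj, hα]
        ring_nf
      have e2 : ((2 : ℝ) ^ j) ^ (-(1 + 2 / p)) =
          ((2 : ℝ) ^ j)⁻¹ * (((2 : ℝ) ^ j)⁻¹ * ((2 : ℝ) ^ j) ^ θ) := by
        rw [← Real.rpow_neg_one, ← Real.rpow_add hj, ← Real.rpow_add hj, hθ, hα]
        congr 1
        field_simp
        ring
      have hj' : (0 : ℝ) ≤ ((2 : ℝ) ^ j)⁻¹ := by positivity
      simp only [e1, e2, hb]
      rw [div_eq_mul_inv c, ENNReal.ofReal_mul hc0, ENNReal.ofReal_mul hj', ENNReal.ofReal_mul hj',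
        ENNReal.ofReal_mul hj', ENNReal.ofReal_mul hj', ENNReal.ofReal_mul (by positivity)]
      simp_rw [mul_add, Finset.sum_add_distrib, mul_add, mul_assoc]
      simp_rw [mul_left_comm (ENNReal.ofReal ((_ + 1 : ℕ) : ℝ)), ← Finset.mul_sum]
      ring
    have w1 : ∀ n : ℕ, ENNReal.ofReal (((n + 1 : ℕ) : ℝ) ^ (-(3 - p / 2))) *
        (ENNReal.ofReal ((n + 1 : ℕ) : ℝ) * E n) =
        ENNReal.ofReal (1 / ((n + 1 : ℕ) : ℝ) ^ (2 - p / 2)) * E n := fun n => by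
      have hn : (0 : ℝ) < ((n + 1 : ℕ) : ℝ) := by positivity
      rw [← mul_assoc, ← ENNReal.ofReal_mul (by positivity), ← Real.rpow_add_one hn.ne', one_div,
        ← Real.rpow_neg hn.le]
      ring_nf
    have w2 : ∀ n : ℕ, ENNReal.ofReal (((n + 1 : ℕ) : ℝ) ^ (-(1 + 2 / p))) *
        (ENNReal.ofReal ((n + 1 : ℕ) : ℝ) * Lp n) =
        ENNReal.ofReal (1 / ((n + 1 : ℕ) : ℝ) ^ (2 / p)) * Lp n := fun n => by
      have hn : (0 : ℝ) < ((n + 1 : ℕ) : ℝ) := by positivity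
      rw [← mul_assoc, ← ENNReal.ofReal_mul (by positivity), ← Real.rpow_add_one hn.ne', one_div,
        ← Real.rpow_neg hn.le]
      ring_nf
    simp_rw [hsplit]
    rw [ENNReal.tsum_add, ENNReal.tsum_mul_left, ENNReal.tsum_mul_left, ENNReal.tsum_mul_left]
    gcongr
    · refine (hC₁ _).trans (le_of_eq ?_)
      simp_rw [w1]
      rfl
    · refine (hC₂ _).trans (le_of_eq ?_)
      simp_rw [w2]
      rfl
  have hsumt : ENNReal.ofReal c * (C₁ * s₁) +
      ENNReal.ofReal (D ^ θ) * (ENNReal.ofReal c * (C₂ * s₂)) ≠ ∞ :=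
    ENNReal.add_ne_top.2 ⟨hfin1, ENNReal.mul_ne_top ENNReal.ofReal_ne_top hfin2⟩
  have hbt : ∀ j, b j ≠ ∞ := fun j hj => by
    have h1 := (ENNReal.le_tsum (f := fun j : ℕ => ENNReal.ofReal (((2 : ℝ) ^ j)⁻¹) * b j)
      j).trans hsum
    simp only [hj] at h1
    rw [ENNReal.mul_top (by simp)] at h1
    exact hsumt (top_le_iff.1 h1)
  refine ⟨fun j => (b j).toReal, fun j => ENNReal.toReal_nonneg, fun J => ?_,
    fun j m hm hK => ?_⟩
  · have h1 := (ENNReal.sum_le_tsum (f := fun j : ℕ => ENNReal.ofReal (((2 : ℝ) ^ j)⁻¹) * b j)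
      (Finset.range J)).trans hsum
    have h2 := ENNReal.toReal_mono hsumt h1
    rw [ENNReal.toReal_sum fun j _ => ENNReal.mul_ne_top ENNReal.ofReal_ne_top (hbt j),
      ENNReal.toReal_add hfin1 (ENNReal.mul_ne_top ENNReal.ofReal_ne_top hfin2),
      ENNReal.toReal_mul (a := ENNReal.ofReal (D ^ θ)),
      ENNReal.toReal_ofReal (by positivity)] at h2
    refine le_trans (le_of_eq ?_) (h2.trans (le_of_eq (by ring)))
    refine Finset.sum_congr rfl fun j _ => ?_
    rw [ENNReal.toReal_mul, ENNReal.toReal_ofReal (by positivity)]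
  · have hN : 0 < 2 ^ j := by positivity
    set N := 2 ^ j with hNdef
    have hNR : ((2 : ℝ) ^ j) = (N : ℝ) := by rw [hNdef]; push_cast; rfl
    have hN1 : (1 : ℝ) ≤ N := by exact_mod_cast hN
    set g : ℝ := ∫ y, |σ * √m * y| ^ α ∂gaussianReal 0 1 with hg
    have hg0 : 0 ≤ g := integral_nonneg fun y => by positivity
    have hNα : 1 ≤ (N : ℝ) ^ (α / 2) := Real.one_le_rpow hN1 (by positivity)
    have hgle : g ≤ σ ^ α * G * (N : ℝ) ^ (α / 2) := by
      have e1 : g = σ ^ α * √(m : ℝ) ^ α * G := by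
        rw [hg, hG, ← integral_const_mul]
        congr 1
        ext y
        rw [abs_mul, abs_of_nonneg (by positivity : 0 ≤ σ * √(m : ℝ)),
          Real.mul_rpow (by positivity) (abs_nonneg _), Real.mul_rpow hσ.le (by positivity)]
      have e2 : √(m : ℝ) ^ α ≤ (N : ℝ) ^ (α / 2) := by
        rw [Real.sqrt_eq_rpow, ← Real.rpow_mul (by positivity), show 1 / 2 * α = α / 2 by ring]
        gcongr
      rw [e1]
      calc σ ^ α * √(m : ℝ) ^ α * G ≤ σ ^ α * (N : ℝ) ^ (α / 2) * G := by gcongr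
        _ = _ := by ring
    have hDm := h.measurable_varDefect' N
    have hVm : Measurable (pastSum T X₀ m) := (h.measurable_pastSum m).mono h.le le_rfl
    rw [integral_eq_lintegral_of_nonneg_ae (ae_of_all _ fun ω => by positivity)
      (by fun_prop)]
    refine ENNReal.toReal_mono (hbt j) ?_
    set a : Ω → ℝ≥0∞ := fun ω => ENNReal.ofReal |(N : ℝ) * varDefect F₀ μ T X₀ σ N ω| with ha
    have ham : Measurable a := by fun_prop
    calc ∫⁻ ω, ENNReal.ofReal ((2 + |pastSum T X₀ m ω| ^ α + g) *
          |(N : ℝ) * varDefect F₀ μ T X₀ σ N ω|) ∂μ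
        = ∫⁻ ω, (ENNReal.ofReal (2 + g) * a ω +
            ENNReal.ofReal (|pastSum T X₀ m ω| ^ α) * a ω) ∂μ := by
          refine lintegral_congr fun ω => ?_
          rw [ENNReal.ofReal_mul (by positivity), ← add_mul,
            ← ENNReal.ofReal_add (by positivity) (by positivity),
            show 2 + |pastSum T X₀ m ω| ^ α + g = 2 + g + |pastSum T X₀ m ω| ^ α by ring]
      _ = ENNReal.ofReal (2 + g) * ∫⁻ ω, a ω ∂μ +
            ∫⁻ ω, ENNReal.ofReal (|pastSum T X₀ m ω| ^ α) * a ω ∂μ := by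
          rw [lintegral_add_left (by fun_prop), lintegral_const_mul _ ham]
      _ ≤ ENNReal.ofReal ((2 + σ ^ α * G) * (N : ℝ) ^ (α / 2)) * (ENNReal.ofReal (2 / N) *
            ∑ n ∈ Finset.range N, ENNReal.ofReal ((n + 1 : ℕ) : ℝ) * E n) +
          ENNReal.ofReal (C / N) * ∑ n ∈ Finset.range N, ENNReal.ofReal ((n + 1 : ℕ) : ℝ) *
            (ENNReal.ofReal ((N : ℝ) ^ (α / 2)) * E n +
              ENNReal.ofReal (D ^ θ * (N : ℝ) ^ θ) * Lp n) := by
          refine add_le_add (mul_le_mul' (ENNReal.ofReal_le_ofReal ?_)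
            (h.lintegral_varDefect_le hN)) (hC N m D hN hm hD ?_)
          · nlinarith
          · rwa [← hNR]
      _ ≤ ENNReal.ofReal (2 * (2 + σ ^ α * G) / N) * (∑ n ∈ Finset.range N,
            ENNReal.ofReal ((n + 1 : ℕ) : ℝ) * (ENNReal.ofReal ((N : ℝ) ^ (α / 2)) * E n +
              ENNReal.ofReal (D ^ θ * (N : ℝ) ^ θ) * Lp n)) +
          ENNReal.ofReal (C / N) * ∑ n ∈ Finset.range N, ENNReal.ofReal ((n + 1 : ℕ) : ℝ) *
            (ENNReal.ofReal ((N : ℝ) ^ (α / 2)) * E n +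
              ENNReal.ofReal (D ^ θ * (N : ℝ) ^ θ) * Lp n) := by
          refine add_le_add_left ?_ _
          rw [← mul_assoc, ← ENNReal.ofReal_mul (by positivity),
            show (2 + σ ^ α * G) * (N : ℝ) ^ (α / 2) * (2 / N) =
              2 * (2 + σ ^ α * G) / N * (N : ℝ) ^ (α / 2) by ring,
            ENNReal.ofReal_mul (by positivity), mul_assoc, Finset.mul_sum]
          refine mul_le_mul' le_rfl (Finset.sum_le_sum fun n _ => ?_)
          rw [mul_left_comm]
          exact mul_le_mul' le_rfl le_self_add
      _ = b j := by
          rw [← add_mul, ← ENNReal.ofReal_add (by positivity) (by positivity), ← add_div, hb]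
          simp only [hNR, ← hc, ← hNdef]

end StationaryMDS

/-! ### Second order expansions -/

theorem integrable_id_gaussianReal : Integrable (fun y : ℝ => y) (gaussianReal 0 1) :=
  (integrable_comp_gaussianReal (f := fun y => y) measurable_id
    (expGrowth_of_abs_le_pow (A := 1) (k := 1) zero_le_one fun x => by simp) 0 1).congr
    (ae_of_all _ fun y => by simp)

theorem integrable_sq_gaussianReal : Integrable (fun y : ℝ => y ^ 2) (gaussianReal 0 1) := by
  simpa using integrable_abs_rpow_gaussianReal (q := 2) zero_le_two

theorem integral_sq_gaussianReal : ∫ y, y ^ 2 ∂gaussianReal 0 1 = 1 := by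
  have h := variance_id_gaussianReal (μ := 0) (v := 1)
  rw [variance_eq_sub (memLp_id_gaussianReal 2)] at h
  simpa using h

/-- A function of growth `1 + |u| ^ (p - 2)`, multiplied by `u ^ 2`. -/
theorem mul_sq_le_of_growth {φ : ℝ → ℝ} {κ p : ℝ} (hκ : ∀ u, 0 ≤ u → φ u ≤ κ * (1 + u ^ (p - 2)))
    (hp : 2 < p) (u : ℝ) : φ |u| * u ^ 2 ≤ κ * (u ^ 2 + |u| ^ p) := by
  have h1 : |u| ^ p = |u| ^ (p - 2) * u ^ 2 := by
    rcases eq_or_ne u 0 with rfl | hu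
    · simp [Real.zero_rpow (by linarith : p ≠ 0)]
    · have h0 : 0 < |u| := abs_pos.2 hu
      rw [← sq_abs, ← Real.rpow_natCast, ← Real.rpow_add h0]
      congr 1
      push_cast
      ring
  rw [h1]
  calc φ |u| * u ^ 2 ≤ κ * (1 + |u| ^ (p - 2)) * u ^ 2 := by
        gcongr
        exact hκ _ (abs_nonneg u)
    _ = _ := by ring

theorem integrable_mul_sq_gaussianReal {φ : ℝ → ℝ} {κ p : ℝ} (hφm : Measurable φ)
    (hφ0 : ∀ u, 0 ≤ φ u) (hκ : ∀ u, 0 ≤ u → φ u ≤ κ * (1 + u ^ (p - 2))) (hp : 2 < p) (s : ℝ) :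
    Integrable (fun y => φ |s * y| * (s * y) ^ 2) (gaussianReal 0 1) := by
  have h1 : Integrable (fun y : ℝ => κ * ((s * y) ^ 2 + |s * y| ^ p)) (gaussianReal 0 1) := by
    have h2 := (integrable_abs_rpow_gaussianReal (q := p) (by linarith)).const_mul (|s| ^ p)
    have h3 := integrable_sq_gaussianReal.const_mul (s ^ 2)
    refine ((h3.add h2).const_mul κ).congr (ae_of_all _ fun y => ?_)
    simp only [Pi.add_apply, abs_mul]
    rw [Real.mul_rpow (abs_nonneg _) (abs_nonneg _)]
    ring
  refine h1.mono' (by fun_prop) (ae_of_all _ fun y => ?_)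
  have := hφ0 |s * y|
  rw [Real.norm_eq_abs, abs_of_nonneg (by positivity)]
  exact mul_sq_le_of_growth hκ hp _

/-- The standard normal has mean `0` and variance `1`, so integrating the Taylor expansion removes
the first order term and leaves `g₂ x * s ^ 2 / 2`. -/
theorem abs_gaussSmooth_taylor_two_le {g g₁ g₂ φ : ℝ → ℝ} (hg : ∀ x, HasDerivAt g (g₁ x) x)
    (hg₁ : ∀ x, HasDerivAt g₁ (g₂ x) x) (hgg : ExpGrowth g) {κ p : ℝ} (hφm : Measurable φ)
    (hφ0 : ∀ u, 0 ≤ φ u) (hmono : ∀ u v, 0 ≤ u → u ≤ v → φ u ≤ φ v)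
    (hmod : ∀ x u, |g₂ (x + u) - g₂ x| ≤ φ |u|)
    (hκ : ∀ u, 0 ≤ u → φ u ≤ κ * (1 + u ^ (p - 2))) (hp : 2 < p) (s x : ℝ) :
    |gaussSmooth s g x - g x - g₂ x * s ^ 2 / 2| ≤
      ∫ y, φ |s * y| * (s * y) ^ 2 ∂gaussianReal 0 1 := by
  have hgm : Measurable g :=
    (continuous_iff_continuousAt.2 fun x => (hg x).continuousAt).measurable
  have i0 := integrable_comp_gaussianReal hgm hgg x s
  have i1 := integrable_id_gaussianReal.const_mul (g₁ x * s)
  have i2 := integrable_sq_gaussianReal.const_mul (g₂ x * s ^ 2 / 2)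
  have e : gaussSmooth s g x - g x - g₂ x * s ^ 2 / 2 =
      ∫ y, (g (x + s * y) - g x - g₁ x * s * y - g₂ x * s ^ 2 / 2 * y ^ 2) ∂gaussianReal 0 1 := by
    have j1 : Integrable (fun y => g (x + s * y) - g x) (gaussianReal 0 1) :=
      i0.sub (integrable_const _)
    have j2 : Integrable (fun y => g (x + s * y) - g x - g₁ x * s * y) (gaussianReal 0 1) :=
      j1.sub i1
    rw [integral_sub j2 i2, integral_sub j1 i1, integral_sub i0 (integrable_const _),
      integral_const_mul, integral_const_mul, integral_sq_gaussianReal, integral_id_gaussianReal]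
    simp [gaussSmooth]
  rw [e]
  refine (abs_integral_le_integral_abs).trans (integral_mono_of_nonneg
    (ae_of_all _ fun y => abs_nonneg _) (integrable_mul_sq_gaussianReal hφm hφ0 hκ hp s)
    (ae_of_all _ fun y => ?_))
  have := abs_taylor_two_le hg hg₁ (x := x) (u := s * y) (ω := φ |s * y|)
    fun v hv => (hmod x v).trans (hmono _ _ (abs_nonneg v) hv)
  refine le_trans (le_of_eq ?_) this
  simp only
  ring_nf

namespace StationaryMDS

variable {Ω : Type*} {F₀ : MeasurableSpace Ω} [mΩ : MeasurableSpace Ω] {μ : Measure Ω}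
  {T : Ω ≃ᵐ Ω} {X₀ : Ω → ℝ} {σ p : ℝ}

theorem integral_mul_sq_seq (h : StationaryMDS F₀ μ T X₀ σ p) {φ : ℝ → ℝ}
    (hφm : Measurable φ) (i : ℤ) :
    ∫ ω, φ |shiftSeq T.toEquiv X₀ i ω| * shiftSeq T.toEquiv X₀ i ω ^ 2 ∂μ =
      ∫ ω, φ |X₀ ω| * X₀ ω ^ 2 ∂μ := by
  have hm := measurePreserving_zpow h.measurePreserving i
  have h0 : Measurable X₀ := h.measurable_seq 0
  conv_rhs => rw [← hm.map_eq]
  rw [integral_map hm.measurable.aemeasurable (by fun_prop)]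
  rfl

variable [IsProbabilityMeasure μ]

theorem integrable_mul_sq_seq (h : StationaryMDS F₀ μ T X₀ σ p) {φ : ℝ → ℝ} {κ : ℝ}
    (hφm : Measurable φ) (hφ0 : ∀ u, 0 ≤ φ u) (hκ : ∀ u, 0 ≤ u → φ u ≤ κ * (1 + u ^ (p - 2)))
    (i : ℤ) :
    Integrable (fun ω => φ |shiftSeq T.toEquiv X₀ i ω| * shiftSeq T.toEquiv X₀ i ω ^ 2) μ := by
  have hp := h.two_lt
  have hX := h.measurable_seq i
  have hκ0 : 0 ≤ κ := by
    have h1 := (hφ0 0).trans (hκ 0 le_rfl)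
    rwa [Real.zero_rpow (by linarith), add_zero, mul_one] at h1
  have d : LpDominated μ p p
      (fun ω => φ |shiftSeq T.toEquiv X₀ i ω| * shiftSeq T.toEquiv X₀ i ω ^ 2) := by
    refine LpDominated.of_growth (f := fun x => φ |x| * x ^ 2) (h.memLp_seq i)
      (by positivity : 0 ≤ κ * 2) fun x => ?_
    have h0 := hφ0 |x|
    have h1 : (1 : ℝ) ≤ 1 + |x| := by linarith [abs_nonneg x]
    rw [abs_of_nonneg (by positivity), mul_assoc]
    refine (mul_sq_le_of_growth hκ hp x).trans ?_
    have h2 : x ^ 2 ≤ (1 + |x|) ^ p := by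
      calc x ^ 2 = |x| ^ 2 := (sq_abs x).symm
        _ ≤ (1 + |x|) ^ 2 := by gcongr; linarith
        _ = (1 + |x|) ^ (2 : ℝ) := by norm_cast
        _ ≤ _ := Real.rpow_le_rpow_of_exponent_le h1 hp.le
    have h3 : |x| ^ p ≤ (1 + |x|) ^ p := by gcongr; linarith
    gcongr
    linarith
  exact d.integrable (by fun_prop) (by linarith) le_rfl

/-- One step of Lindeberg's replacement of martingale differences by Gaussian variables. -/
theorem abs_replacement_le (h : StationaryMDS F₀ μ T X₀ σ p) {g g₁ g₂ φ : ℝ → ℝ} {κ : ℝ}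
    (hg : ∀ x, HasDerivAt g (g₁ x) x) (hg₁ : ∀ x, HasDerivAt g₁ (g₂ x) x) (hg₂ : Measurable g₂)
    (hφm : Measurable φ) (hφ0 : ∀ u, 0 ≤ φ u) (hmono : ∀ u v, 0 ≤ u → u ≤ v → φ u ≤ φ v)
    (hmod : ∀ x u, |g₂ (x + u) - g₂ x| ≤ φ |u|)
    (hκ : ∀ u, 0 ≤ u → φ u ≤ κ * (1 + u ^ (p - 2))) (k : ℕ) :
    |∫ ω, g (partialSum (shiftSeq T.toEquiv X₀) (k + 1) ω) ∂μ -
      ∫ ω, gaussSmooth σ g (partialSum (shiftSeq T.toEquiv X₀) k ω) ∂μ -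
      (∫ ω, g₂ (partialSum (shiftSeq T.toEquiv X₀) k ω) *
        (shiftSeq T.toEquiv X₀ ((k : ℤ) + 1) ω ^ 2 - σ ^ 2) ∂μ) / 2| ≤
      ∫ ω, φ |X₀ ω| * X₀ ω ^ 2 ∂μ + ∫ y, φ |σ * y| * (σ * y) ^ 2 ∂gaussianReal 0 1 := by
  have hp := h.two_lt
  have hp3 := h.le_three
  have hκ0 : 0 ≤ κ := by
    have h1 := (hφ0 0).trans (hκ 0 le_rfl)
    rwa [Real.zero_rpow (by linarith), add_zero, mul_one] at h1
  obtain ⟨A, hA0, hA, hA₁, hA₂⟩ := exists_growth_of_increment_le hg hg₁ hκ0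
    (by linarith : 0 ≤ p - 2) fun x => by
      have h1 := hmod 0 x
      rw [zero_add] at h1
      exact h1.trans (hκ _ (abs_nonneg x))
  rw [sub_add_cancel] at hA
  have hgg : ExpGrowth g := expGrowth_of_abs_le_rpow (k := 3) hA0 (by simpa using hp3) hA
  have hgm : Measurable g :=
    (continuous_iff_continuousAt.2 fun x => (hg x).continuousAt).measurable
  have hg₁m : Measurable g₁ :=
    (continuous_iff_continuousAt.2 fun x => (hg₁ x).continuousAt).measurable
  set S := partialSum (shiftSeq T.toEquiv X₀) k with hS
  set X := shiftSeq T.toEquiv X₀ ((k : ℤ) + 1) with hX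
  have hSm : Measurable S := h.measurable_partialSum k
  have hXm : Measurable X := h.measurable_seq _
  have hSL := h.memLp_partialSum k
  have hS1 : ∀ ω, partialSum (shiftSeq T.toEquiv X₀) (k + 1) ω = S ω + X ω :=
    fun ω => partialSum_succ _ _ _
  have dX : LpDominated μ p 1 X := LpDominated.of_memLp (h.memLp_seq _)
  have d0 : LpDominated μ p p (fun ω => g (S ω)) := LpDominated.of_growth hSL hA0 hA
  have d1 : LpDominated μ p (p - 2 + 1) (fun ω => g₁ (S ω)) := LpDominated.of_growth hSL hA0 hA₁
  have d2 : LpDominated μ p (p - 2) (fun ω => g₂ (S ω)) := LpDominated.of_growth hSL hA0 hA₂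
  have i0 : Integrable (fun ω => g (S ω)) μ := d0.integrable (by fun_prop) (by linarith) le_rfl
  have i0' : Integrable (fun ω => g (S ω + X ω)) μ := by
    have h1 := h.memLp_partialSum (k + 1)
    have := (LpDominated.of_growth h1 hA0 hA).integrable
      (hgm.comp (h.measurable_partialSum (k + 1))) (by linarith) le_rfl
    simpa only [hS1] using this
  have i1 : Integrable (fun ω => g₁ (S ω) * X ω) μ :=
    (d1.mul dX (by linarith) zero_le_one).integrable (by fun_prop) (by linarith) (by linarith)
  have i2 : Integrable (fun ω => g₂ (S ω) * (X ω ^ 2 - σ ^ 2)) μ :=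
    h.integrable_mul_sq_sub (by fun_prop) d2 _
  have i3 : Integrable (fun ω => g₂ (S ω)) μ :=
    d2.integrable (by fun_prop) (by linarith) (by linarith)
  set R := ∫ y, φ |σ * y| * (σ * y) ^ 2 ∂gaussianReal 0 1 with hR
  have hgs : ∀ ω, |gaussSmooth σ g (S ω) - g (S ω) - g₂ (S ω) * σ ^ 2 / 2| ≤ R := fun ω =>
    abs_gaussSmooth_taylor_two_le hg hg₁ hgg hφm hφ0 hmono hmod hκ hp σ (S ω)
  have hgsm : Measurable fun ω => gaussSmooth σ g (S ω) :=
    (measurable_gaussSmooth hgm σ).comp hSm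
  have i4 : Integrable (fun ω => gaussSmooth σ g (S ω) - g (S ω) - g₂ (S ω) * σ ^ 2 / 2) μ := by
    refine (integrable_const R).mono' (by fun_prop) (ae_of_all _ fun ω => ?_)
    exact hgs ω
  have i5 : Integrable (fun ω => gaussSmooth σ g (S ω)) μ := by
    refine ((i4.add i0).add (i3.mul_const (σ ^ 2 / 2))).congr (ae_of_all _ fun ω => ?_)
    simp only [Pi.add_apply]
    ring
  have i6 : Integrable (fun ω => g (S ω + X ω) - g (S ω) - g₁ (S ω) * X ω -
      g₂ (S ω) * X ω ^ 2 / 2) μ := by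
    refine (((i0'.sub i0).sub i1).sub
      ((i2.add (i3.mul_const (σ ^ 2))).div_const 2)).congr (ae_of_all _ fun ω => ?_)
    simp only [Pi.add_apply, Pi.sub_apply]
    ring
  have z : ∫ ω, g₁ (S ω) * X ω ∂μ = 0 := by
    refine h.integral_mul_seq_eq_zero ?_ i1
    rw [add_sub_cancel_right]
    exact hg₁m.comp (h.adapted_partialSum k)
  -- The martingale step and the Gaussian step are both expanded around `S_k`. The first order term
  -- has mean zero by `z`, the second order terms combine into the subtracted pairing, and two
  -- Taylor remainders are left.
  have e : ∫ ω, g (partialSum (shiftSeq T.toEquiv X₀) (k + 1) ω) ∂μ -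
      ∫ ω, gaussSmooth σ g (S ω) ∂μ - (∫ ω, g₂ (S ω) * (X ω ^ 2 - σ ^ 2) ∂μ) / 2 =
      ∫ ω, (g (S ω + X ω) - g (S ω) - g₁ (S ω) * X ω - g₂ (S ω) * X ω ^ 2 / 2) ∂μ -
      ∫ ω, (gaussSmooth σ g (S ω) - g (S ω) - g₂ (S ω) * σ ^ 2 / 2) ∂μ := by
    simp_rw [hS1]
    have j1 : Integrable (fun ω => g (S ω + X ω) - gaussSmooth σ g (S ω)) μ := i0'.sub i5
    have j2 : Integrable (fun ω => g (S ω + X ω) - gaussSmooth σ g (S ω) -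
        g₂ (S ω) * (X ω ^ 2 - σ ^ 2) / 2) μ := j1.sub (i2.div_const 2)
    rw [← integral_sub i6 i4, ← integral_sub i0' i5, ← integral_div,
      ← integral_sub j1 (i2.div_const 2), ← sub_zero (∫ ω, _ - _ ∂μ), ← z, ← integral_sub j2 i1]
    congr 1
    ext ω
    ring
  rw [e]
  refine (abs_sub _ _).trans (add_le_add ?_ ?_)
  · rw [← h.integral_mul_sq_seq hφm ((k : ℤ) + 1)]
    refine (abs_integral_le_integral_abs).trans (integral_mono_of_nonneg
      (ae_of_all _ fun ω => abs_nonneg _) (h.integrable_mul_sq_seq hφm hφ0 hκ _)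
      (ae_of_all _ fun ω => ?_))
    exact abs_taylor_two_le hg hg₁ (x := S ω) (u := X ω) (ω := φ |X ω|)
      fun v hv => (hmod _ v).trans (hmono _ _ (abs_nonneg v) hv)
  · refine (abs_integral_le_integral_abs).trans ?_
    calc ∫ ω, |gaussSmooth σ g (S ω) - g (S ω) - g₂ (S ω) * σ ^ 2 / 2| ∂μ ≤ ∫ _, R ∂μ :=
          integral_mono i4.abs (integrable_const _) hgs
      _ = R := by simp

end StationaryMDS

/-! ### Pairing block increments with variance defects -/

theorem gaussSmooth_zero (f : ℝ → ℝ) : gaussSmooth 0 f = f := by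
  ext x
  simp [gaussSmooth]

theorem gaussSmooth_sqrt_add {f : ℝ → ℝ} (hf : Measurable f) (hfg : ExpGrowth f) {σ : ℝ}
    (hσ : 0 ≤ σ) (m s : ℕ) :
    gaussSmooth (σ * √m) (gaussSmooth (σ * √s) f) = gaussSmooth (σ * √((m + s : ℕ) : ℝ)) f := by
  rw [gaussSmooth_gaussSmooth hf hfg, mul_pow, mul_pow, Real.sq_sqrt (by positivity),
    Real.sq_sqrt (by positivity), ← mul_add, Real.sqrt_mul (by positivity), Real.sqrt_sq hσ]
  push_cast
  rfl

theorem integrable_growth_gaussianReal {φ : ℝ → ℝ} {κ q : ℝ} (hφm : Measurable φ)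
    (hφ0 : ∀ u, 0 ≤ φ u) (hκ : ∀ u, 0 ≤ u → φ u ≤ κ * (1 + u ^ q)) (hq : 0 ≤ q) (s : ℝ) :
    Integrable (fun y => φ |s * y|) (gaussianReal 0 1) := by
  have h1 : Integrable (fun y : ℝ => κ * (1 + |s| ^ q * |y| ^ q)) (gaussianReal 0 1) :=
    ((integrable_const 1).add ((integrable_abs_rpow_gaussianReal hq).const_mul _)).const_mul κ
  refine h1.mono' (Measurable.aestronglyMeasurable (by fun_prop)) (ae_of_all _ fun y => ?_)
  rw [Real.norm_eq_abs, abs_of_nonneg (hφ0 _), ← Real.mul_rpow (abs_nonneg _) (abs_nonneg _),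
    ← abs_mul]
  exact hκ _ (abs_nonneg _)

theorem abs_gaussSmooth_sub_self_le_integral {f φ : ℝ → ℝ} (hf : Measurable f) (hfg : ExpGrowth f)
    (hmod : ∀ x u, |f (x + u) - f x| ≤ φ |u|) {s : ℝ}
    (hφ : Integrable (fun y => φ |s * y|) (gaussianReal 0 1)) (x : ℝ) :
    |gaussSmooth s f x - f x| ≤ ∫ y, φ |s * y| ∂gaussianReal 0 1 := by
  have e : gaussSmooth s f x - f x = ∫ y, (f (x + s * y) - f x) ∂gaussianReal 0 1 := by
    rw [integral_sub (integrable_comp_gaussianReal hf hfg x s) (integrable_const _)]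
    simp [gaussSmooth]
  rw [e]
  exact (abs_integral_le_integral_abs).trans (integral_mono_of_nonneg
    (ae_of_all _ fun y => abs_nonneg _) hφ (ae_of_all _ fun y => hmod x _))

namespace StationaryMDS

/-- The moment of the conditional variance defect of a block of length `N`, weighted by the
increments of a function with modulus of continuity `φ` over the preceding block of length `m`. -/
noncomputable def blockMoment {Ω : Type*} (F₀ : MeasurableSpace Ω) [MeasurableSpace Ω]
    (μ : Measure Ω) (T : Ω ≃ᵐ Ω) (X₀ : Ω → ℝ) (σ : ℝ) (φ : ℝ → ℝ) (m N : ℕ) : ℝ :=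
  ∫ ω, (φ |pastSum T X₀ m ω| + ∫ y, φ |σ * √m * y| ∂gaussianReal 0 1) *
    |(N : ℝ) * varDefect F₀ μ T X₀ σ N ω| ∂μ

variable {Ω : Type*} {F₀ : MeasurableSpace Ω} [mΩ : MeasurableSpace Ω] {μ : Measure Ω}
  {T : Ω ≃ᵐ Ω} {X₀ : Ω → ℝ} {σ p : ℝ}

theorem memLp_pastSum (h : StationaryMDS F₀ μ T X₀ σ p) (m : ℕ) :
    MemLp (pastSum T X₀ m) (ENNReal.ofReal p) μ :=
  (h.memLp_partialSum m).comp_measurePreserving (measurePreserving_zpow h.measurePreserving _)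

theorem blockMoment_nonneg {φ : ℝ → ℝ} (hφ0 : ∀ u, 0 ≤ φ u) (m N : ℕ) :
    0 ≤ blockMoment F₀ μ T X₀ σ φ m N :=
  integral_nonneg fun _ => mul_nonneg (add_nonneg (hφ0 _) (integral_nonneg fun _ => hφ0 _))
    (abs_nonneg _)

variable [IsProbabilityMeasure μ]

theorem integrable_blockMoment (h : StationaryMDS F₀ μ T X₀ σ p) {φ : ℝ → ℝ} {κ : ℝ}
    (hφm : Measurable φ) (hφ0 : ∀ u, 0 ≤ φ u) (hκ : ∀ u, 0 ≤ u → φ u ≤ κ * (1 + u ^ (p - 2)))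
    (m N : ℕ) :
    Integrable (fun ω => (φ |pastSum T X₀ m ω| + ∫ y, φ |σ * √m * y| ∂gaussianReal 0 1) *
      |(N : ℝ) * varDefect F₀ μ T X₀ σ N ω|) μ := by
  have hp := h.two_lt
  have hκ0 : 0 ≤ κ := by
    have h1 := (hφ0 0).trans (hκ 0 le_rfl)
    rwa [Real.zero_rpow (by linarith), add_zero, mul_one] at h1
  set c := ∫ y, φ |σ * √m * y| ∂gaussianReal 0 1 with hc
  have hc0 : 0 ≤ c := integral_nonneg fun y => hφ0 _
  have d1 : LpDominated μ p (p - 2) (fun ω => φ |pastSum T X₀ m ω|) := by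
    refine LpDominated.of_growth (f := fun x => φ |x|) (h.memLp_pastSum m)
      (by positivity : 0 ≤ κ * 2) fun x => ?_
    rw [abs_of_nonneg (hφ0 _), mul_assoc]
    refine (hκ _ (abs_nonneg x)).trans ?_
    have h2 : 1 ≤ (1 + |x|) ^ (p - 2) :=
      Real.one_le_rpow (by linarith [abs_nonneg x]) (by linarith)
    have h3 : |x| ^ (p - 2) ≤ (1 + |x|) ^ (p - 2) := by gcongr; linarith
    gcongr
    linarith
  have d2 := d1.add (LpDominated.of_bound (W := fun _ => c) c fun _ => (abs_of_nonneg hc0).le)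
    (by linarith)
  have hm : Measurable[F₀] fun ω => φ |pastSum T X₀ m ω| + c := by
    have := h.measurable_pastSum m
    exact (hφm.comp (measurable_abs.comp this)).add_const c
  refine (h.integral_mul_varDefect hm d2 N).1.abs.congr (ae_of_all _ fun ω => ?_)
  have := hφ0 |pastSum T X₀ m ω|
  simp only [abs_mul]
  rw [abs_of_nonneg (by positivity : 0 ≤ φ |pastSum T X₀ m ω| + c)]

theorem blockMoment_mono (h : StationaryMDS F₀ μ T X₀ σ p) {φ φ' : ℝ → ℝ} {κ : ℝ}
    (hφm : Measurable φ) (hφm' : Measurable φ') (hφ0 : ∀ u, 0 ≤ φ u) (hφ0' : ∀ u, 0 ≤ φ' u)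
    (hφ : ∀ u, 0 ≤ u → φ u ≤ φ' u) (hκ : ∀ u, 0 ≤ u → φ' u ≤ κ * (1 + u ^ (p - 2))) (m N : ℕ) :
    blockMoment F₀ μ T X₀ σ φ m N ≤ blockMoment F₀ μ T X₀ σ φ' m N := by
  have hp := h.two_lt
  have hκ' : ∀ u, 0 ≤ u → φ u ≤ κ * (1 + u ^ (p - 2)) := fun u hu => (hφ u hu).trans (hκ u hu)
  refine integral_mono (h.integrable_blockMoment hφm hφ0 hκ' m N)
    (h.integrable_blockMoment hφm' hφ0' hκ m N) fun ω => ?_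
  refine mul_le_mul_of_nonneg_right (add_le_add (hφ _ (abs_nonneg _)) ?_) (abs_nonneg _)
  exact integral_mono (integrable_growth_gaussianReal hφm hφ0 hκ' (by linarith) _)
    (integrable_growth_gaussianReal hφm' hφ0' hκ (by linarith) _) fun y => hφ _ (abs_nonneg _)

/-- `blockMoment` is additive in the modulus, so moduli are summed before being bounded. The `2`
collects the constant `1` of `1 + u ^ (p - 2)` from the increment and from its Gaussian counterpart.
-/
theorem sum_blockMoment_le (h : StationaryMDS F₀ μ T X₀ σ p) {ψ : ℕ → ℝ → ℝ} {κ : ℝ}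
    {s : Finset ℕ} (hψm : ∀ t, Measurable (ψ t)) (hψ0 : ∀ t u, 0 ≤ ψ t u)
    (hκ : ∀ u, 0 ≤ u → ∑ t ∈ s, ψ t u ≤ κ * (1 + u ^ (p - 2))) (m N : ℕ) :
    ∑ t ∈ s, blockMoment F₀ μ T X₀ σ (ψ t) m N ≤
      κ * ∫ ω, (2 + |pastSum T X₀ m ω| ^ (p - 2) +
        ∫ y, |σ * √m * y| ^ (p - 2) ∂gaussianReal 0 1) *
        |(N : ℝ) * varDefect F₀ μ T X₀ σ N ω| ∂μ := by
  have hp := h.two_lt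
  have hκt : ∀ t ∈ s, ∀ u, 0 ≤ u → ψ t u ≤ κ * (1 + u ^ (p - 2)) := fun t ht u hu =>
    (Finset.single_le_sum (f := fun t => ψ t u) (fun t _ => hψ0 t u) ht).trans (hκ u hu)
  have hi : ∀ t ∈ s, Integrable (fun y => ψ t |σ * √m * y|) (gaussianReal 0 1) := fun t ht =>
    integrable_growth_gaussianReal (hψm t) (hψ0 t) (hκt t ht) (by linarith) _
  have e1 : ∑ t ∈ s, blockMoment F₀ μ T X₀ σ (ψ t) m N =
      blockMoment F₀ μ T X₀ σ (fun u => ∑ t ∈ s, ψ t u) m N := by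
    simp only [blockMoment]
    rw [← integral_finsetSum _ fun t ht =>
      h.integrable_blockMoment (hψm t) (hψ0 t) (hκt t ht) m N]
    congr 1
    ext ω
    rw [integral_finsetSum _ hi, ← Finset.sum_mul, Finset.sum_add_distrib]
  have hκ0 : 0 ≤ κ := by
    have h1 := (Finset.sum_nonneg fun t _ => hψ0 t 0).trans (hκ 0 le_rfl)
    rwa [Real.zero_rpow (by linarith), add_zero, mul_one] at h1
  have e2 : blockMoment F₀ μ T X₀ σ (fun u => κ * (1 + |u| ^ (p - 2))) m N =
      κ * ∫ ω, (2 + |pastSum T X₀ m ω| ^ (p - 2) +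
        ∫ y, |σ * √m * y| ^ (p - 2) ∂gaussianReal 0 1) *
        |(N : ℝ) * varDefect F₀ μ T X₀ σ N ω| ∂μ := by
    have hi2 : Integrable (fun y => |σ * √m * y| ^ (p - 2)) (gaussianReal 0 1) := by
      have := integrable_growth_gaussianReal (φ := fun u => |u| ^ (p - 2)) (κ := 1) (q := p - 2)
        (by fun_prop) (fun u => by positivity) (fun u hu => by
          rw [abs_of_nonneg hu]
          linarith) (by linarith) (σ * √m)
      simpa only [abs_abs] using this
    simp only [blockMoment, abs_abs]
    rw [← integral_const_mul, integral_const_mul, integral_add (integrable_const _) hi2]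
    congr 1
    ext ω
    simp only [integral_const, probReal_univ, smul_eq_mul, mul_one]
    ring
  rw [e1, ← e2]
  refine h.blockMoment_mono (κ := κ) (Finset.measurable_fun_sum _ fun t _ => hψm t)
    (by fun_prop) (fun u => Finset.sum_nonneg fun t _ => hψ0 t u) (fun u => by positivity)
    (fun u hu => ?_) (fun u hu => ?_) m N
  · rw [abs_of_nonneg hu]
    exact hκ u hu
  · rw [abs_of_nonneg hu]

/-- Moving the freezing time from `b` to `b + m`. The difference of the two factors is known at time
`b + m`, so pairing it with the next `N` squares gives a variance defect. It is split as `f(S_{b+m})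
- f(S_b)`, at most `φ` of the increment, plus the distance of `f` to its smoothing at `S_b`, at most
the Gaussian mean of `φ`. Translated to time `0`, the increment is `pastSum T X₀ m`. -/
theorem abs_sum_block_diff_le (h : StationaryMDS F₀ μ T X₀ σ p) {f φ : ℝ → ℝ} {κ : ℝ}
    (hf : Measurable f) (hφm : Measurable φ) (hφ0 : ∀ u, 0 ≤ φ u)
    (hmod : ∀ x u, |f (x + u) - f x| ≤ φ |u|)
    (hκ : ∀ u, 0 ≤ u → φ u ≤ κ * (1 + u ^ (p - 2))) (b m N : ℕ) :
    |∑ k ∈ Finset.range N, (∫ ω, f (partialSum (shiftSeq T.toEquiv X₀) (b + m) ω) *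
        (shiftSeq T.toEquiv X₀ (((b + m + k : ℕ) : ℤ) + 1) ω ^ 2 - σ ^ 2) ∂μ -
      ∫ ω, gaussSmooth (σ * √m) f (partialSum (shiftSeq T.toEquiv X₀) b ω) *
        (shiftSeq T.toEquiv X₀ (((b + m + k : ℕ) : ℤ) + 1) ω ^ 2 - σ ^ 2) ∂μ)| ≤
      blockMoment F₀ μ T X₀ σ φ m N := by
  have hp := h.two_lt
  have hp3 := h.le_three
  have hκ0 : 0 ≤ κ := by
    have h1 := (hφ0 0).trans (hκ 0 le_rfl)
    rwa [Real.zero_rpow (by linarith), add_zero, mul_one] at h1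
  have hA : ∀ x, |f x| ≤ (|f 0| + κ * 2) * (1 + |x|) ^ (p - 2) := fun x => by
    have h1 := hmod 0 x
    rw [zero_add] at h1
    have h1' := h1.trans (hκ _ (abs_nonneg x))
    have h2 : 1 ≤ (1 + |x|) ^ (p - 2) :=
      Real.one_le_rpow (by linarith [abs_nonneg x]) (by linarith)
    have h3 : |x| ^ (p - 2) ≤ (1 + |x|) ^ (p - 2) := by gcongr; linarith
    have h4 : |f x| ≤ |f 0| + |f x - f 0| := by
      have := abs_add_le (f 0) (f x - f 0)
      rwa [add_sub_cancel] at this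
    calc |f x| ≤ |f 0| * 1 + κ * (1 + |x| ^ (p - 2)) := by linarith
      _ ≤ |f 0| * (1 + |x|) ^ (p - 2) + κ * ((1 + |x|) ^ (p - 2) + (1 + |x|) ^ (p - 2)) := by
          gcongr
      _ = _ := by ring
  have hA0 : 0 ≤ |f 0| + κ * 2 := by positivity
  have hfg : ExpGrowth f :=
    expGrowth_of_abs_le_rpow (k := 1) hA0 (by push_cast; linarith) hA
  set c := ∫ y, φ |σ * √m * y| ∂gaussianReal 0 1 with hc
  have hself : ∀ x, |gaussSmooth (σ * √m) f x - f x| ≤ c := fun x =>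
    abs_gaussSmooth_sub_self_le_integral hf hfg hmod
      (integrable_growth_gaussianReal hφm hφ0 hκ (by linarith) _) x
  have hGm := measurable_gaussSmooth hf (σ * √m)
  set S := partialSum (shiftSeq T.toEquiv X₀) with hS
  set G := gaussSmooth (σ * √m) f with hG
  have d1 : ∀ k, LpDominated μ p (p - 2) (fun ω => f (S k ω)) := fun k =>
    LpDominated.of_growth (h.memLp_partialSum k) hA0 hA
  have d2 : LpDominated μ p (p - 2) (fun ω => G (S b ω)) := by
    have := (LpDominated.of_bound (μ := μ) (p := p) (q := p - 2)
      (W := fun ω => G (S b ω) - f (S b ω)) c fun ω => hself _).add (d1 b) (by linarith)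
    simpa using this
  have d3 := (d1 (b + m)).sub d2 (by linarith)
  have m1 : Measurable[shiftFiltration T.toEquiv F₀ ((b + m : ℕ) : ℤ)]
      fun ω => f (S (b + m) ω) := hf.comp (h.adapted_partialSum (b + m))
  have m2 : Measurable[shiftFiltration T.toEquiv F₀ ((b + m : ℕ) : ℤ)] fun ω => G (S b ω) :=
    (hGm.comp (h.adapted_partialSum b)).mono (h.filtration_mono (by push_cast; omega)) le_rfl
  have m3 : Measurable[shiftFiltration T.toEquiv F₀ ((b + m : ℕ) : ℤ)]
      fun ω => f (S (b + m) ω) - G (S b ω) := m1.sub m2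
  have e1 : ∑ k ∈ Finset.range N, (∫ ω, f (S (b + m) ω) *
        (shiftSeq T.toEquiv X₀ (((b + m + k : ℕ) : ℤ) + 1) ω ^ 2 - σ ^ 2) ∂μ -
      ∫ ω, G (S b ω) *
        (shiftSeq T.toEquiv X₀ (((b + m + k : ℕ) : ℤ) + 1) ω ^ 2 - σ ^ 2) ∂μ) =
      ∑ k ∈ Finset.range N, ∫ ω, (f (S (b + m) ω) - G (S b ω)) *
        (shiftSeq T.toEquiv X₀ (((b + m + k : ℕ) : ℤ) + 1) ω ^ 2 - σ ^ 2) ∂μ := by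
    refine Finset.sum_congr rfl fun k _ => ?_
    rw [← integral_sub (h.integrable_mul_sq_sub (m1.mono (h.filtration_le _) le_rfl) (d1 _) _)
      (h.integrable_mul_sq_sub (m2.mono (h.filtration_le _) le_rfl) d2 _)]
    congr 1
    ext ω
    ring
  rw [e1, h.sum_integral_mul_sq_sub m3 d3 N]
  refine (abs_integral_le_integral_abs).trans (integral_mono_of_nonneg
    (ae_of_all _ fun ω => abs_nonneg _) (h.integrable_blockMoment hφm hφ0 hκ m N)
    (ae_of_all _ fun ω => ?_))
  refine (abs_mul _ _).le.trans (mul_le_mul_of_nonneg_right ?_ (abs_nonneg _))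
  set ω' := (T.toEquiv ^ (-((b + m : ℕ) : ℤ)) : Equiv.Perm Ω) ω with hω'
  have e2 : S (b + m) ω' = S b ω' + pastSum T X₀ m ω := by
    rw [hS, partialSum_shiftSeq_add, pastSum, hω', ← Equiv.Perm.mul_apply, ← zpow_add]
    congr 4
    push_cast
    ring
  have h1 : |f (S (b + m) ω') - f (S b ω')| ≤ φ |pastSum T X₀ m ω| := by
    rw [e2]
    exact hmod _ _
  have h2 := hself (S b ω')
  rw [abs_sub_comm] at h2
  calc |f (S (b + m) ω') - G (S b ω')|
      = |(f (S (b + m) ω') - f (S b ω')) + (f (S b ω') - G (S b ω'))| := by ring_nf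
    _ ≤ _ := (abs_add_le _ _).trans (add_le_add h1 h2)

end StationaryMDS

theorem sum_Ioc_zero_eq_sum_range (f : ℕ → ℝ) (n : ℕ) :
    ∑ t ∈ Finset.Ioc 0 n, f t = ∑ k ∈ Finset.range n, f (k + 1) := by
  induction n with
  | zero => simp
  | succ n ih => rw [Finset.sum_Ioc_succ_top (Nat.zero_le n), ih, Finset.sum_range_succ]

/-! ### Summation of the Lindeberg steps -/

namespace StationaryMDS

variable {Ω : Type*} {F₀ : MeasurableSpace Ω} [mΩ : MeasurableSpace Ω] {μ : Measure Ω}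
  {T : Ω ≃ᵐ Ω} {X₀ : Ω → ℝ} {σ p : ℝ} [IsProbabilityMeasure μ]

theorem sum_moment_le (h : StationaryMDS F₀ μ T X₀ σ p) {ψ : ℕ → ℝ → ℝ} {κ : ℝ} {s : Finset ℕ}
    (hψm : ∀ t, Measurable (ψ t)) (hψ0 : ∀ t u, 0 ≤ ψ t u)
    (hκ : ∀ u, 0 ≤ u → ∑ t ∈ s, ψ t u ≤ κ * (1 + u ^ (p - 2))) :
    ∑ t ∈ s, (∫ ω, ψ t |X₀ ω| * X₀ ω ^ 2 ∂μ +
      ∫ y, ψ t |σ * y| * (σ * y) ^ 2 ∂gaussianReal 0 1) ≤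
      κ * (∫ ω, (1 + |X₀ ω| ^ (p - 2)) * X₀ ω ^ 2 ∂μ +
        ∫ y, (1 + |σ * y| ^ (p - 2)) * (σ * y) ^ 2 ∂gaussianReal 0 1) := by
  have hp := h.two_lt
  have hκt : ∀ t ∈ s, ∀ u, 0 ≤ u → ψ t u ≤ κ * (1 + u ^ (p - 2)) := fun t ht u hu =>
    (Finset.single_le_sum (f := fun t => ψ t u) (fun t _ => hψ0 t u) ht).trans (hκ u hu)
  have hone : ∀ u : ℝ, 0 ≤ u → 1 + |u| ^ (p - 2) ≤ 1 * (1 + u ^ (p - 2)) := fun u hu => by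
    rw [abs_of_nonneg hu, one_mul]
  have i1 : Integrable (fun ω => (1 + |X₀ ω| ^ (p - 2)) * X₀ ω ^ 2) μ := by
    have := h.integrable_mul_sq_seq (φ := fun u => 1 + |u| ^ (p - 2)) (by fun_prop)
      (fun u => by positivity) hone 0
    simp only [abs_abs] at this
    exact this
  have i2 : Integrable (fun y => (1 + |σ * y| ^ (p - 2)) * (σ * y) ^ 2) (gaussianReal 0 1) := by
    have := integrable_mul_sq_gaussianReal (φ := fun u => 1 + |u| ^ (p - 2)) (by fun_prop)
      (fun u => by positivity) hone hp σ
    simpa only [abs_abs] using this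
  have i3 : ∀ t ∈ s, Integrable (fun ω => ψ t |X₀ ω| * X₀ ω ^ 2) μ := fun t ht =>
    h.integrable_mul_sq_seq (hψm t) (hψ0 t) (hκt t ht) 0
  have i4 : ∀ t ∈ s, Integrable (fun y => ψ t |σ * y| * (σ * y) ^ 2) (gaussianReal 0 1) :=
    fun t ht => integrable_mul_sq_gaussianReal (hψm t) (hψ0 t) (hκt t ht) hp σ
  rw [Finset.sum_add_distrib, ← integral_finsetSum _ i3, ← integral_finsetSum _ i4, mul_add,
    ← integral_const_mul, ← integral_const_mul]
  refine add_le_add (integral_mono (integrable_finsetSum _ i3) (i1.const_mul κ) fun ω => ?_)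
    (integral_mono (integrable_finsetSum _ i4) (i2.const_mul κ) fun y => ?_)
  · simp only
    rw [← Finset.sum_mul, ← mul_assoc]
    gcongr
    exact hκ _ (abs_nonneg _)
  · simp only
    rw [← Finset.sum_mul, ← mul_assoc]
    gcongr
    exact hκ _ (abs_nonneg _)

/-- Normal approximation of `S_n` for smooth test functions: the second derivatives of the Gaussian
smoothings of `g` have moduli of continuity `ψ t`, which sum up to at most `κ (1 + u ^ (p - 2))`. -/
theorem abs_integral_sub_gaussSmooth_le (h : StationaryMDS F₀ μ T X₀ σ p) {g g₁ g₂ : ℝ → ℝ} {n : ℕ}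
    (hn : 1 ≤ n) (hg : ∀ x, HasDerivAt g (g₁ x) x) (hg₁ : ∀ x, HasDerivAt g₁ (g₂ x) x)
    (hg₂ : Measurable g₂) {ψ : ℕ → ℝ → ℝ} {κ K : ℝ} {B : ℕ → ℝ} (hψm : ∀ t, Measurable (ψ t))
    (hψ0 : ∀ t u, 0 ≤ ψ t u) (hψmono : ∀ t u v, 0 ≤ u → u ≤ v → ψ t u ≤ ψ t v)
    (hψanti : ∀ s t u, 1 ≤ s → s ≤ t → 0 ≤ u → ψ t u ≤ ψ s u)
    (hmod : ∀ s, s < n → ∀ x u,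
      |gaussSmooth (σ * √s) g₂ (x + u) - gaussSmooth (σ * √s) g₂ x| ≤ ψ (s + 1) |u|)
    (hκ : ∀ u, 0 ≤ u → ∑ t ∈ Finset.Ioc 0 n, ψ t u ≤ κ * (1 + u ^ (p - 2)))
    (hB0 : ∀ j, 0 ≤ B j) (hBK : ∀ J, ∑ j ∈ Finset.range J, ((2 : ℝ) ^ j)⁻¹ * B j ≤ K)
    (hB : ∀ j m, m ≤ 2 ^ j → m < n → ∫ ω, (2 + |pastSum T X₀ m ω| ^ (p - 2) +
      ∫ y, |σ * √m * y| ^ (p - 2) ∂gaussianReal 0 1) *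
      |((2 ^ j : ℕ) : ℝ) * varDefect F₀ μ T X₀ σ (2 ^ j) ω| ∂μ ≤ B j) :
    |∫ ω, g (partialSum (shiftSeq T.toEquiv X₀) n ω) ∂μ - gaussSmooth (σ * √n) g 0| ≤
      κ * ((∫ ω, (1 + |X₀ ω| ^ (p - 2)) * X₀ ω ^ 2 ∂μ +
        ∫ y, (1 + |σ * y| ^ (p - 2)) * (σ * y) ^ 2 ∂gaussianReal 0 1) + K) := by
  have hp := h.two_lt
  have hp3 := h.le_three
  have hσ := h.sigma_pos
  have hψκ : ∀ t, 1 ≤ t → ∀ u, 0 ≤ u → ψ t u ≤ κ * (1 + u ^ (p - 2)) := fun t ht u hu =>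
    (hψanti 1 t u le_rfl ht hu).trans ((Finset.single_le_sum (f := fun t => ψ t u)
      (fun t _ => hψ0 t u) (Finset.mem_Ioc.2 ⟨one_pos, hn⟩)).trans (hκ u hu))
  have hκ0 : 0 ≤ κ := by
    have h1 := (hψ0 1 0).trans (hψκ 1 le_rfl 0 le_rfl)
    rwa [Real.zero_rpow (by linarith), add_zero, mul_one] at h1
  obtain ⟨A, hA0, hA, hA₁, hA₂⟩ := exists_growth_of_increment_le hg hg₁ hκ0
    (by linarith : 0 ≤ p - 2) fun x => by
      have h1 := hmod 0 hn 0 x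
      simp only [Nat.cast_zero, Real.sqrt_zero, mul_zero, gaussSmooth_zero, zero_add] at h1
      exact h1.trans (hψκ 1 le_rfl _ (abs_nonneg x))
  have hgg : ExpGrowth g := expGrowth_of_abs_le_rpow (k := 3) hA0 (by push_cast; linarith) hA
  have hgg₁ : ExpGrowth g₁ := expGrowth_of_abs_le_rpow (k := 2) hA0 (by push_cast; linarith) hA₁
  have hgg₂ : ExpGrowth g₂ := expGrowth_of_abs_le_rpow (k := 1) hA0 (by push_cast; linarith) hA₂
  have hgm : Measurable g :=
    (continuous_iff_continuousAt.2 fun x => (hg x).continuousAt).measurable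
  have hg₁m : Measurable g₁ :=
    (continuous_iff_continuousAt.2 fun x => (hg₁ x).continuousAt).measurable
  set S := partialSum (shiftSeq T.toEquiv X₀) with hS
  set R : ℕ → ℝ := fun t => ∫ ω, ψ t |X₀ ω| * X₀ ω ^ 2 ∂μ +
      ∫ y, ψ t |σ * y| * (σ * y) ^ 2 ∂gaussianReal 0 1 with hR
  -- The factor frozen at time `a` is smoothed over the `n - a - 1` remaining steps, so that
  -- freezing at `b` instead of `b + m` amounts to `m` further smoothing steps.
  set e : ℕ → ℕ → ℝ := fun a k => ∫ ω, gaussSmooth (σ * √((n - a - 1 : ℕ) : ℝ)) g₂ (S a ω) *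
    (shiftSeq T.toEquiv X₀ ((k : ℤ) + 1) ω ^ 2 - σ ^ 2) ∂μ with he
  -- Lindeberg interpolation: the first `k` variables are those of the martingale, the `n - k`
  -- others are Gaussian.
  set a : ℕ → ℝ := fun k => ∫ ω, gaussSmooth (σ * √((n - k : ℕ) : ℝ)) g (S k ω) ∂μ with ha
  have hstep : ∀ k ∈ Finset.range n, |a (k + 1) - a k - e k k / 2| ≤ R (n - 1 - k + 1) := by
    intro k hk
    have hk' := Finset.mem_range.1 hk
    obtain ⟨s, hs⟩ : ∃ s, n = k + 1 + s := ⟨n - (k + 1), by omega⟩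
    have e1 : n - (k + 1) = s := by omega
    have e2 : n - k = 1 + s := by omega
    have e3 : 1 + s - 1 = s := by omega
    have e4 : n - 1 - k + 1 = s + 1 := by omega
    have hsg : gaussSmooth σ (gaussSmooth (σ * √s) g) = gaussSmooth (σ * √((1 + s : ℕ) : ℝ)) g := by
      have := gaussSmooth_sqrt_add hgm hgg hσ.le 1 s
      simpa using this
    simp only [ha, he, e1, e2, e3, e4]
    rw [← hsg]
    exact h.abs_replacement_le (hasDerivAt_gaussSmooth hg hg₁m hgg hgg₁ (σ * √s))
      (hasDerivAt_gaussSmooth hg₁ hg₂ hgg₁ hgg₂ (σ * √s)) (measurable_gaussSmooth hg₂ _)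
      (hψm (s + 1)) (hψ0 (s + 1)) (hψmono (s + 1)) (hmod s (by omega))
      (hψκ (s + 1) (by omega)) k
  have ha0 : a 0 = gaussSmooth (σ * √n) g 0 := by
    simp [ha, hS, partialSum_zero]
  have han : a n = ∫ ω, g (S n ω) ∂μ := by
    simp only [ha, Nat.sub_self, Nat.cast_zero, Real.sqrt_zero, mul_zero, gaussSmooth_zero]
  -- Since `S_0 = 0`, the factor frozen at time `0` is a constant, and every square has mean `σ ^
  -- 2`.
  have he0 : ∀ k, e 0 k = 0 := fun k => by
    simp only [he, hS, partialSum_zero]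
    have hXi : Integrable (fun ω => shiftSeq T.toEquiv X₀ ((k : ℤ) + 1) ω ^ 2) μ := by
      have := h.integrable_mul_sq_seq (φ := fun _ => 1) (κ := 1) measurable_const
        (fun _ => zero_le_one) (fun u hu => by
          have : 0 ≤ u ^ (p - 2) := by positivity
          linarith) ((k : ℤ) + 1)
      simpa using this
    rw [integral_const_mul, integral_sub hXi (integrable_const _), h.integral_seq_sq]
    simp
  have hRsum : ∑ k ∈ Finset.range n, R (n - 1 - k + 1) ≤
      κ * (∫ ω, (1 + |X₀ ω| ^ (p - 2)) * X₀ ω ^ 2 ∂μ +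
        ∫ y, (1 + |σ * y| ^ (p - 2)) * (σ * y) ^ 2 ∂gaussianReal 0 1) := by
    rw [Finset.sum_range_reflect (fun k => R (k + 1)), ← sum_Ioc_zero_eq_sum_range]
    exact h.sum_moment_le hψm hψ0 hκ
  have hdiff : ∀ b m N, b + m < n → |∑ k ∈ Finset.range N, (e (b + m) (b + m + k) -
      e b (b + m + k))| ≤ blockMoment F₀ μ T X₀ σ (ψ (n - (b + m))) m N := by
    intro b m N hbm
    obtain ⟨s, hs⟩ : ∃ s, n = b + m + 1 + s := ⟨n - (b + m + 1), by omega⟩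
    have e2 : n - b - 1 = m + s := by omega
    have e3 : n - (b + m) = s + 1 := by omega
    have := h.abs_sum_block_diff_le (measurable_gaussSmooth hg₂ (σ * √s)) (hψm (s + 1))
      (hψ0 (s + 1)) (hmod s (by omega)) (hψκ (s + 1) (by omega)) b m N
    rw [gaussSmooth_sqrt_add hg₂ hgg₂ hσ.le] at this
    simp only [he, e2, e3]
    exact this
  have hpre : |∑ k ∈ Finset.range n, e k k| ≤ 2 * (κ * K) := by
    -- The cutoff retains the block lengths that occur in the decomposition. They satisfy `2 ^ j <
    -- n`, so `hB` applies; in the bootstrap only sums shorter than `n` are available.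
    set δ : ℕ → ℕ → ℝ := fun j t => if 2 * 2 ^ j ≤ n then
      blockMoment F₀ μ T X₀ σ (ψ t) (2 ^ j) (2 ^ j) else 0 with hδ
    set η : ℕ → ℝ := fun j => ((2 : ℝ) ^ j)⁻¹ * (κ * B j) with hη
    have key := abs_sum_prefix_le (n := n) (e := e) (δ := δ) (η := η) (fun j t => ?_) (fun j => ?_)
      (fun j s t hs hst => ?_) (fun j b hb => ?_) (fun j m hm hmn => ?_) n n
      (Nat.lt_two_pow_self) le_rfl
    · simp only [he0, sub_zero, Nat.sub_self] at key
      refine key.trans ?_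
      calc ∑ j ∈ Finset.range n, (((2 : ℝ) ^ j)⁻¹ * ∑ t ∈ Finset.Ioc 0 n, δ j t + η j)
          ≤ ∑ j ∈ Finset.range n, (((2 : ℝ) ^ j)⁻¹ * (κ * B j) + ((2 : ℝ) ^ j)⁻¹ * (κ * B j)) := by
            refine Finset.sum_le_sum fun j _ => add_le_add ?_ le_rfl
            gcongr
            simp only [hδ]
            split_ifs with hj
            · refine (h.sum_blockMoment_le hψm hψ0 hκ (2 ^ j) (2 ^ j)).trans ?_
              gcongr
              have : 0 < 2 ^ j := by positivity
              exact hB j (2 ^ j) le_rfl (by omega)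
            · rw [Finset.sum_const_zero]
              exact mul_nonneg hκ0 (hB0 j)
        _ = 2 * (κ * ∑ j ∈ Finset.range n, ((2 : ℝ) ^ j)⁻¹ * B j) := by
            rw [Finset.mul_sum, Finset.mul_sum]
            exact Finset.sum_congr rfl fun j _ => by ring
        _ ≤ _ := by
            gcongr
            exact hBK n
    · simp only [hδ]
      split_ifs
      · exact blockMoment_nonneg (hψ0 t) _ _
      · exact le_rfl
    · exact mul_nonneg (by positivity) (mul_nonneg hκ0 (hB0 j))
    · simp only [hδ]
      split_ifs
      · exact h.blockMoment_mono (hψm t) (hψm s) (hψ0 t) (hψ0 s)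
          (fun u hu => hψanti s t u hs hst hu) (hψκ s hs) _ _
      · exact le_rfl
    · have h2 : 0 < 2 ^ j := by positivity
      simp only [hδ]
      rw [if_pos (by omega)]
      exact hdiff b (2 ^ j) (2 ^ j) (by omega)
    · have h2 : 0 < 2 ^ j := by positivity
      have h3 := hdiff 0 m (2 ^ j) (by omega)
      rw [zero_add] at h3
      refine h3.trans ?_
      -- From `m + 2 ^ j ≤ n` follows `2 ^ j ≤ n - m`, so by monotonicity in `t` the single modulus
      -- `ψ (n - m)` is at most the average of `ψ t` over `t ≤ 2 ^ j`. This is where the factor `2 ^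
      -- (-j)` in `η` comes from.
      have h4 : ∀ u, 0 ≤ u → ∑ t ∈ ({n - m} : Finset ℕ), ψ t u ≤
          ((2 : ℝ) ^ j)⁻¹ * κ * (1 + u ^ (p - 2)) := fun u hu => by
        rw [Finset.sum_singleton, mul_assoc, inv_mul_eq_div, le_div_iff₀ (by positivity)]
        calc ψ (n - m) u * 2 ^ j = ∑ t ∈ Finset.Ioc 0 (2 ^ j), ψ (n - m) u := by
              simp [mul_comm]
          _ ≤ ∑ t ∈ Finset.Ioc 0 (2 ^ j), ψ t u := by
              refine Finset.sum_le_sum fun t ht => ?_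
              have := Finset.mem_Ioc.1 ht
              exact hψanti t (n - m) u (by omega) (by omega) hu
          _ ≤ ∑ t ∈ Finset.Ioc 0 n, ψ t u := by
              refine Finset.sum_le_sum_of_subset_of_nonneg
                (Finset.Ioc_subset_Ioc_right (by omega)) fun t _ _ => hψ0 t u
          _ ≤ _ := hκ u hu
      have h5 := h.sum_blockMoment_le hψm hψ0 h4 m (2 ^ j)
      rw [Finset.sum_singleton] at h5
      refine h5.trans ?_
      simp only [hη]
      rw [mul_assoc]
      gcongr
      exact hB j m hm.le (by omega)
  have htel : a n - a 0 = ∑ k ∈ Finset.range n, (a (k + 1) - a k - e k k / 2) +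
      (∑ k ∈ Finset.range n, e k k) / 2 := by
    rw [← Finset.sum_range_sub, Finset.sum_div, ← Finset.sum_add_distrib]
    exact Finset.sum_congr rfl fun k _ => by ring
  rw [← han, ← ha0, htel]
  calc _ ≤ |∑ k ∈ Finset.range n, (a (k + 1) - a k - e k k / 2)| +
        |(∑ k ∈ Finset.range n, e k k) / 2| := abs_add_le _ _
    _ ≤ ∑ k ∈ Finset.range n, R (n - 1 - k + 1) + 2 * (κ * K) / 2 := by
        refine add_le_add ((Finset.abs_sum_le_sum_abs _ _).trans (Finset.sum_le_sum hstep)) ?_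
        rw [abs_div, abs_two]
        gcongr
    _ ≤ _ := by
        rw [mul_add]
        linarith

end StationaryMDS

/-! ### The bootstrap at order p -/

theorem exists_add_mul_rpow_le (a b : ℝ) {θ : ℝ} (hb : 0 ≤ b) (hθ : θ < 1) :
    ∃ D : ℝ, 0 ≤ D ∧ a + b * D ^ θ ≤ D := by
  -- `D ≥ 2 a` takes care of `a`, and `D ≥ (2 b) ^ (1 / (1 - θ))` gives `b D ^ θ ≤ D / 2`.
  set D : ℝ := max 1 (max (2 * a) ((2 * b) ^ (1 - θ)⁻¹)) with hD
  have hD1 : 1 ≤ D := le_max_left _ _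
  have hD2 : 2 * a ≤ D := (le_max_left _ _).trans (le_max_right _ _)
  have hD3 : (2 * b) ^ (1 - θ)⁻¹ ≤ D := (le_max_right _ _).trans (le_max_right _ _)
  refine ⟨D, by linarith, ?_⟩
  have h1 : 2 * b ≤ D ^ (1 - θ) := by
    have h2 := Real.rpow_le_rpow (by positivity) hD3 (by linarith : 0 ≤ 1 - θ)
    rwa [Real.rpow_inv_rpow (by positivity) (by linarith)] at h2
  have h3 : D ^ (1 - θ) * D ^ θ = D := by
    rw [← Real.rpow_add (by linarith), sub_add_cancel, Real.rpow_one]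
  have h4 : 2 * b * D ^ θ ≤ D := by
    calc 2 * b * D ^ θ ≤ D ^ (1 - θ) * D ^ θ := by gcongr
      _ = D := h3
  linarith

namespace StationaryMDS

variable {Ω : Type*} {F₀ : MeasurableSpace Ω} [mΩ : MeasurableSpace Ω] {μ : Measure Ω}
  {T : Ω ≃ᵐ Ω} {X₀ : Ω → ℝ} {σ p : ℝ}

theorem NormalApprox.mono {m : ℕ} {K K' : ℝ} (h : NormalApprox μ T X₀ σ p m K) (hK : K ≤ K') :
    NormalApprox μ T X₀ σ p m K' :=
  fun f f₁ f₂ hf hf₁ hf₂ => (h f f₁ f₂ hf hf₁ hf₂).trans hK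

variable [IsProbabilityMeasure μ]

/-- The normal approximation of order `p`. -/
theorem exists_normalApprox (h : StationaryMDS F₀ μ T X₀ σ p)
    (hC1 : ∑' n : ℕ, ENNReal.ofReal (1 / ((n + 1 : ℕ) : ℝ) ^ (2 - p / 2)) *
      envelopeNorm p (varDefect F₀ μ T X₀ σ (n + 1)) μ < ∞)
    (hC2 : ∑' n : ℕ, ENNReal.ofReal (1 / ((n + 1 : ℕ) : ℝ) ^ (2 / p)) *
      eLpNorm (varDefect F₀ μ T X₀ σ (n + 1)) (ENNReal.ofReal (p / 2)) μ < ∞) :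
    ∃ D : ℝ, 0 ≤ D ∧ ∀ n : ℕ, NormalApprox μ T X₀ σ p n (D * n) := by
  have hp := h.two_lt
  obtain ⟨K₀, K₁, hK₀, hK₁, hblock⟩ := h.exists_block_bound hC1 hC2
  set M := ∫ ω, (1 + |X₀ ω| ^ (p - 2)) * X₀ ω ^ 2 ∂μ +
    ∫ y, (1 + |σ * y| ^ (p - 2)) * (σ * y) ^ 2 ∂gaussianReal 0 1 with hM
  obtain ⟨D, hD0, hD⟩ := exists_add_mul_rpow_le (M + K₀) K₁ (θ := (p - 2) / p) hK₁
    (by rw [div_lt_one (by linarith)]; linarith)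
  obtain ⟨B, hB0, hBK, hB⟩ := hblock D hD0
  refine ⟨D, hD0, fun n => ?_⟩
  -- At order `p` every smoothing has modulus `|u| ^ (p - 2)`, so `κ = n`. The moment bounds involve
  -- only sums of length `m < n` with `m ≤ 2 ^ j`, whose error `D * m` is at most `D * 2 ^ j` by
  -- induction; the choice of `D` then gives the bound `D * n`.
  induction n using Nat.strong_induction_on with
  | _ n ih =>
    intro f f₁ f₂ hf hf₁ hf₂
    rcases Nat.eq_zero_or_pos n with rfl | hn
    · simp [partialSum_zero, gaussSmooth_zero]
    have hα : 0 < p - 2 := by linarith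
    have hf₂m : Measurable f₂ := (continuous_of_holder hα hf₂).measurable
    have := h.abs_integral_sub_gaussSmooth_le (n := n) hn hf hf₁ hf₂m
      (ψ := fun _ u => |u| ^ (p - 2)) (κ := n) (fun t => by fun_prop) (fun t u => by positivity)
      (fun t u v hu huv => by
        rw [abs_of_nonneg hu, abs_of_nonneg (hu.trans huv)]
        gcongr)
      (fun s t u _ _ _ => le_rfl)
      (fun s hs x u => by
        rw [abs_abs]
        refine abs_gaussSmooth_sub_le hf₂m (expGrowth_of_holder hα hf₂) _ fun z => ?_
        refine (hf₂ _ _).trans (le_of_eq ?_)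
        ring_nf)
      (fun u hu => by
        rw [abs_of_nonneg hu]
        simp
        gcongr
        linarith)
      hB0 hBK (fun j m hm hmn => hB j m hm ((ih m hmn).mono ?_))
    · refine this.trans ?_
      rw [mul_comm D]
      gcongr
      linarith
    · gcongr
      exact_mod_cast hm

/-- Normal approximation for test functions with given moduli of continuity of the second
derivatives of their Gaussian smoothings. -/
theorem exists_abs_integral_sub_gaussSmooth_le (h : StationaryMDS F₀ μ T X₀ σ p)
    (hC1 : ∑' n : ℕ, ENNReal.ofReal (1 / ((n + 1 : ℕ) : ℝ) ^ (2 - p / 2)) *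
      envelopeNorm p (varDefect F₀ μ T X₀ σ (n + 1)) μ < ∞)
    (hC2 : ∑' n : ℕ, ENNReal.ofReal (1 / ((n + 1 : ℕ) : ℝ) ^ (2 / p)) *
      eLpNorm (varDefect F₀ μ T X₀ σ (n + 1)) (ENNReal.ofReal (p / 2)) μ < ∞) :
    ∃ C : ℝ, 0 ≤ C ∧ ∀ (n : ℕ) (g g₁ g₂ : ℝ → ℝ) (ψ : ℕ → ℝ → ℝ) (κ : ℝ), 1 ≤ n →
      (∀ x, HasDerivAt g (g₁ x) x) → (∀ x, HasDerivAt g₁ (g₂ x) x) → Measurable g₂ →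
      (∀ t, Measurable (ψ t)) → (∀ t u, 0 ≤ ψ t u) →
      (∀ t u v, 0 ≤ u → u ≤ v → ψ t u ≤ ψ t v) →
      (∀ s t u, 1 ≤ s → s ≤ t → 0 ≤ u → ψ t u ≤ ψ s u) →
      (∀ s, s < n → ∀ x u,
        |gaussSmooth (σ * √s) g₂ (x + u) - gaussSmooth (σ * √s) g₂ x| ≤ ψ (s + 1) |u|) →
      (∀ u, 0 ≤ u → ∑ t ∈ Finset.Ioc 0 n, ψ t u ≤ κ * (1 + u ^ (p - 2))) →
      |∫ ω, g (partialSum (shiftSeq T.toEquiv X₀) n ω) ∂μ - gaussSmooth (σ * √n) g 0| ≤ κ * C := by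
  have hp := h.two_lt
  obtain ⟨K₀, K₁, hK₀, hK₁, hblock⟩ := h.exists_block_bound hC1 hC2
  obtain ⟨D, hD0, hD⟩ := h.exists_normalApprox hC1 hC2
  obtain ⟨B, hB0, hBK, hB⟩ := hblock D hD0
  refine ⟨_, ?_, fun n g g₁ g₂ ψ κ hn hg hg₁ hg₂ hψm hψ0 hψmono hψanti hmod hκ =>
    h.abs_integral_sub_gaussSmooth_le hn hg hg₁ hg₂ hψm hψ0 hψmono hψanti hmod hκ hB0 hBK
      fun j m hm hmn => hB j m hm ((hD m).mono ?_)⟩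
  · have h1 : 0 ≤ ∫ ω, (1 + |X₀ ω| ^ (p - 2)) * X₀ ω ^ 2 ∂μ :=
      integral_nonneg fun ω => by positivity
    have h2 : 0 ≤ ∫ y, (1 + |σ * y| ^ (p - 2)) * (σ * y) ^ 2 ∂gaussianReal 0 1 :=
      integral_nonneg fun y => by positivity
    positivity
  · gcongr
    exact_mod_cast hm

end StationaryMDS

/-! ### Moduli of continuity of second derivatives of smoothed functions -/

theorem abs_sub_le_min_of_deriv_le {F F' : ℝ → ℝ} (hF : ∀ x, HasDerivAt F (F' x) x) {A B : ℝ}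
    (hA : ∀ x, |F x| ≤ A) (hB : ∀ x, |F' x| ≤ B) (x u : ℝ) :
    |F (x + u) - F x| ≤ min (B * |u|) (2 * A) := by
  refine le_min ?_ ?_
  · have := abs_sub_zero_le_of_deriv_le (g := fun v => F (x + v)) (g' := fun v => F' (x + v))
      (fun v => (hF (x + v)).comp_const_add x v) (u := u) (C := B) fun v _ => hB _
    simpa using this
  · have h1 := hA (x + u)
    have h2 := hA x
    have := abs_sub (F (x + u)) (F x)
    linarith

theorem mul_sqrt_rpow {σ : ℝ} (hσ : 0 ≤ σ) (t q : ℝ) (ht : 0 ≤ t) :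
    (σ * √t) ^ q = σ ^ q * t ^ (q / 2) := by
  rw [Real.mul_rpow hσ (Real.sqrt_nonneg _), Real.sqrt_eq_rpow, ← Real.rpow_mul ht]
  ring_nf

/-- `f` is well approximated by its smoothing at scale `σ`, whose further smoothings have
second derivatives with modulus of continuity of order `r - 2`. -/
structure SmoothingBound (σ r c : ℝ) (f g₁ g₂ : ℝ → ℝ) : Prop where
  continuous : Continuous f
  abs_sub_le : ∀ x, |gaussSmooth σ f x - f x| ≤ c
  hasDerivAt : ∀ x, HasDerivAt (gaussSmooth σ f) (g₁ x) x
  hasDerivAt' : ∀ x, HasDerivAt g₁ (g₂ x) x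
  measurable : Measurable g₂
  modulus : ∀ (s : ℕ) (x u : ℝ), |gaussSmooth (σ * √s) g₂ (x + u) - gaussSmooth (σ * √s) g₂ x| ≤
    c * min (((s + 1 : ℕ) : ℝ) ^ ((r - 3) / 2) * |u|) (((s + 1 : ℕ) : ℝ) ^ ((r - 2) / 2))

theorem min_modulus_le {c σ r t u : ℝ} (hc : 0 ≤ c) (hσ : 0 < σ) (ht : 0 ≤ t) (hu : 0 ≤ u)
    {C : ℝ} (h1 : c * σ ^ (r - 3) ≤ C) (h2 : 2 * (c * σ ^ (r - 2)) ≤ C) :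
    min (c * (σ * √t) ^ (r - 3) * u) (2 * (c * (σ * √t) ^ (r - 2))) ≤
      C * min (t ^ ((r - 3) / 2) * u) (t ^ ((r - 2) / 2)) := by
  have hC : 0 ≤ C := le_trans (by positivity) h1
  rw [mul_sqrt_rpow hσ.le t _ ht, mul_sqrt_rpow hσ.le t _ ht, mul_min_of_nonneg _ _ hC]
  refine min_le_min ?_ ?_
  · calc c * (σ ^ (r - 3) * t ^ ((r - 3) / 2)) * u
        = c * σ ^ (r - 3) * (t ^ ((r - 3) / 2) * u) := by ring
      _ ≤ _ := by gcongr
  · calc 2 * (c * (σ ^ (r - 2) * t ^ ((r - 2) / 2)))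
        = 2 * (c * σ ^ (r - 2)) * t ^ ((r - 2) / 2) := by ring
      _ ≤ _ := by gcongr

/-- Smoothing once at scale `σ` costs a bounded error and regularizes even the last Lindeberg step,
`s = 0`: after `s` further steps the total scale is `σ√(s+1)`, where the second and third
derivatives are of order `(s+1) ^ ((r-2)/2)` and `(s+1) ^ ((r-3)/2)`. -/
theorem exists_smoothingBound_of_holder {σ r : ℝ} (hσ : 0 < σ) (hr : 0 < r) :
    ∃ C : ℝ, 0 ≤ C ∧ ∀ f : ℝ → ℝ, (∀ x y, |f x - f y| ≤ |x - y| ^ r) →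
      ∃ g₁ g₂, SmoothingBound σ r C f g₁ g₂ := by
  obtain ⟨c, hc0, hc⟩ := exists_gaussSmooth_deriv_bounds hr
  set m := σ ^ r * ∫ y, |y| ^ r ∂gaussianReal 0 1 with hm
  have hm0 : 0 ≤ m := mul_nonneg (by positivity) (integral_nonneg fun y => by positivity)
  have hq1 : 0 ≤ c * σ ^ (r - 3) := by positivity
  have hq2 : 0 ≤ 2 * (c * σ ^ (r - 2)) := by positivity
  refine ⟨m + c * σ ^ (r - 3) + 2 * (c * σ ^ (r - 2)), by positivity, fun f hf => ?_⟩
  have hfc := continuous_of_holder hr hf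
  have hfg := expGrowth_of_holder hr hf
  obtain ⟨a₁, a₂, a₃, ha₁, ha₂, ha₃, hb₁, hb₂, hb₃⟩ := hc f hf σ hσ
  have ha₁m : Measurable a₁ :=
    (continuous_iff_continuousAt.2 fun x => (ha₂ x).continuousAt).measurable
  have ha₂m : Measurable a₂ :=
    (continuous_iff_continuousAt.2 fun x => (ha₃ x).continuousAt).measurable
  have hg₁ : ExpGrowth a₁ := expGrowth_of_abs_le_pow (A := c * σ ^ (r - 1)) (k := 0)
    (by positivity) fun x => by simpa using hb₁ x
  have hg₂ : ExpGrowth a₂ := expGrowth_of_abs_le_pow (A := c * σ ^ (r - 2)) (k := 0)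
    (by positivity) fun x => by simpa using hb₂ x
  refine ⟨a₁, a₂, hfc, fun x => ?_, ha₁, ha₂, ha₂m, fun s x u => ?_⟩
  · refine (abs_gaussSmooth_sub_self_le hr hf σ x).trans ?_
    rw [abs_of_pos hσ]
    linarith
  · have hs' : 0 < σ * √((s + 1 : ℕ) : ℝ) := by positivity
    obtain ⟨d₁, d₂, d₃, hd₁, hd₂, hd₃, he₁, he₂, he₃⟩ := hc f hf _ hs'
    have hsg : gaussSmooth (σ * √s) (gaussSmooth σ f) = gaussSmooth (σ * √((s + 1 : ℕ) : ℝ)) f := by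
      have := gaussSmooth_sqrt_add hfc.measurable hfg hσ.le s 1
      simpa using this
    -- The semigroup identity `hsg` is differentiated: by uniqueness of derivatives, smoothing the
    -- derivatives of `gaussSmooth σ f` gives those of the smoothing at the total scale.
    have e1 : gaussSmooth (σ * √s) a₁ = d₁ := funext fun x => by
      have h1 := hasDerivAt_gaussSmooth ha₁ ha₁m (expGrowth_gaussSmooth hfg σ) hg₁ (σ * √s) x
      rw [hsg] at h1
      exact h1.unique (hd₁ x)
    have e2 : gaussSmooth (σ * √s) a₂ = d₂ := funext fun x => by
      have h1 := hasDerivAt_gaussSmooth ha₂ ha₂m hg₁ hg₂ (σ * √s) x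
      rw [e1] at h1
      exact h1.unique (hd₂ x)
    rw [e2]
    exact (abs_sub_le_min_of_deriv_le hd₃ he₂ he₃ x u).trans
      (min_modulus_le hc0 hσ (by positivity) (abs_nonneg u) (by linarith) (by linarith))

/-- The derivative bounds are applied to `f'`, of Hölder exponent `r - 1`, so one derivative fewer
is needed and the same powers of the scale result. -/
theorem exists_smoothingBound_of_deriv_holder {σ r : ℝ} (hσ : 0 < σ) (hr : 1 < r) :
    ∃ C : ℝ, 0 ≤ C ∧ ∀ f f' : ℝ → ℝ, (∀ x, HasDerivAt f (f' x) x) →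
      (∀ x y, |f' x - f' y| ≤ |x - y| ^ (r - 1)) → ∃ g₁ g₂, SmoothingBound σ r C f g₁ g₂ := by
  have hr1 : 0 < r - 1 := by linarith
  obtain ⟨c, hc0, hc⟩ := exists_gaussSmooth_deriv_bounds hr1
  set m := σ ^ r * ∫ y, |y| ^ r ∂gaussianReal 0 1 with hm
  have hm0 : 0 ≤ m := mul_nonneg (by positivity) (integral_nonneg fun y => by positivity)
  have hq1 : 0 ≤ c * σ ^ (r - 3) := by positivity
  have hq2 : 0 ≤ 2 * (c * σ ^ (r - 2)) := by positivity
  have r1 : r - 1 - 1 = r - 2 := by ring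
  have r2 : r - 1 - 2 = r - 3 := by ring
  refine ⟨m + c * σ ^ (r - 3) + 2 * (c * σ ^ (r - 2)), by positivity, fun f f' hd hf => ?_⟩
  have hfc : Continuous f := continuous_iff_continuousAt.2 fun x => (hd x).continuousAt
  have hfg := expGrowth_of_deriv_holder hr1 hd hf
  have hfc' := continuous_of_holder hr1 hf
  have hfg' := expGrowth_of_holder hr1 hf
  obtain ⟨a₁, a₂, a₃, ha₁, ha₂, ha₃, hb₁, hb₂, hb₃⟩ := hc f' hf σ hσ
  have ha₁m : Measurable a₁ :=
    (continuous_iff_continuousAt.2 fun x => (ha₂ x).continuousAt).measurable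
  have hg₁ : ExpGrowth a₁ := expGrowth_of_abs_le_pow (A := c * σ ^ (r - 1 - 1)) (k := 0)
    (by positivity) fun x => by simpa using hb₁ x
  refine ⟨gaussSmooth σ f', a₁, hfc, fun x => ?_,
    hasDerivAt_gaussSmooth hd hfc'.measurable hfg hfg' σ, ha₁, ha₁m, fun s x u => ?_⟩
  · refine (abs_gaussSmooth_sub_self_le_of_deriv hr1 hd hf σ x).trans ?_
    rw [abs_of_pos hσ, sub_add_cancel]
    linarith
  · have hs' : 0 < σ * √((s + 1 : ℕ) : ℝ) := by positivity
    obtain ⟨d₁, d₂, d₃, hd₁, hd₂, hd₃, he₁, he₂, he₃⟩ := hc f' hf _ hs'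
    rw [r1] at he₁
    rw [r2] at he₂
    have hsg : gaussSmooth (σ * √s) (gaussSmooth σ f') =
        gaussSmooth (σ * √((s + 1 : ℕ) : ℝ)) f' := by
      have := gaussSmooth_sqrt_add hfc'.measurable hfg' hσ.le s 1
      simpa using this
    have e1 : gaussSmooth (σ * √s) a₁ = d₁ := funext fun x => by
      have h1 := hasDerivAt_gaussSmooth ha₁ ha₁m (expGrowth_gaussSmooth hfg' σ) hg₁ (σ * √s) x
      rw [hsg] at h1
      exact h1.unique (hd₁ x)
    rw [e1]
    exact (abs_sub_le_min_of_deriv_le hd₂ he₁ he₂ x u).trans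
      (min_modulus_le hc0 hσ (by positivity) (abs_nonneg u) (by linarith) (by linarith))

/-- Interpolation between the two parts of the modulus of continuity. -/
theorem min_le_rpow_mul_rpow {s u r p : ℝ} (hs : 0 < s) (hu : 0 ≤ u) (hp : 2 < p) (hp3 : p ≤ 3) :
    min (s ^ (r - 3) * u) (s ^ (r - 2)) ≤ s ^ (r - p) * u ^ (p - 2) := by
  rcases le_or_gt u s with h | h
  · refine (min_le_left _ _).trans ?_
    rcases hu.eq_or_lt with rfl | hu0
    · rw [mul_zero]
      positivity
    calc s ^ (r - 3) * u = s ^ (r - p) * (s ^ (p - 3) * u) := by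
          rw [← mul_assoc, ← Real.rpow_add hs]
          ring_nf
      _ ≤ s ^ (r - p) * (u ^ (p - 3) * u) := by
          gcongr ?_ * (?_ * ?_)
          exact Real.rpow_le_rpow_of_nonpos hu0 h (by linarith)
      _ = s ^ (r - p) * u ^ (p - 2) := by
          rw [← Real.rpow_add_one hu0.ne']
          ring_nf
  · refine (min_le_right _ _).trans ?_
    calc s ^ (r - 2) = s ^ (r - p) * s ^ (p - 2) := by
          rw [← Real.rpow_add hs]
          ring_nf
      _ ≤ _ := by gcongr

/-- The modulus of continuity of the smoothings of a Hölder function of order `r - 2`. -/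
theorem exists_modulus_of_holder {σ r p : ℝ} (hσ : 0 < σ) (hr : 2 < r) (hrp : r ≤ p)
    (hp3 : p ≤ 3) :
    ∃ C : ℝ, 0 ≤ C ∧ ∀ g : ℝ → ℝ, (∀ x y, |g x - g y| ≤ |x - y| ^ (r - 2)) →
      ∀ (s : ℕ) (x u : ℝ), |gaussSmooth (σ * √s) g (x + u) - gaussSmooth (σ * √s) g x| ≤
        C * (((s + 1 : ℕ) : ℝ) ^ ((r - p) / 2) * (1 + |u| ^ (p - 2))) := by
  have hr2 : 0 < r - 2 := by linarith
  obtain ⟨c, hc0, hc⟩ := exists_gaussSmooth_deriv_bounds hr2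
  -- The term `1` covers `s = 0` and `|u| > √s`, where the Hölder bound of `g` itself is used. The
  -- power of `2` passes from `s` to `s + 1`, as `s ≥ (s + 1) / 2` for `s ≥ 1`.
  set C := (c * σ ^ (r - 3) + 1) * 2 ^ ((p - r) / 2) with hC
  have h2 : (1 : ℝ) ≤ 2 ^ ((p - r) / 2) := Real.one_le_rpow one_le_two (by linarith)
  have hcσ : 0 ≤ c * σ ^ (r - 3) := by positivity
  have hC1 : 1 ≤ C := by nlinarith
  refine ⟨C, by linarith, fun g hg s x u => ?_⟩
  have hgm := (continuous_of_holder hr2 hg).measurable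
  have hgg := expGrowth_of_holder hr2 hg
  have hmod : |gaussSmooth (σ * √s) g (x + u) - gaussSmooth (σ * √s) g x| ≤ |u| ^ (r - 2) := by
    refine abs_gaussSmooth_sub_le hgm hgg _ fun z => (hg _ _).trans (le_of_eq ?_)
    ring_nf
  have hu0 := abs_nonneg u
  have hup : 0 ≤ |u| ^ (p - 2) := by positivity
  rcases Nat.eq_zero_or_pos s with rfl | hs
  · refine hmod.trans ?_
    have : |u| ^ (r - 2) ≤ 1 + |u| ^ (p - 2) := by
      rcases le_or_gt |u| 1 with h | h
      · have := Real.rpow_le_one hu0 h hr2.le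
        linarith
      · have := Real.rpow_le_rpow_of_exponent_le h.le (by linarith : r - 2 ≤ p - 2)
        linarith
    simp only [zero_add, Nat.cast_one, Real.one_rpow, one_mul]
    nlinarith
  · have hs0 : (0 : ℝ) < s := by exact_mod_cast hs
    have hsq : 0 < √(s : ℝ) := Real.sqrt_pos.2 hs0
    obtain ⟨d₁, d₂, d₃, hd₁, hd₂, hd₃, he₁, he₂, he₃⟩ := hc g hg (σ * √s) (by positivity)
    have hlip : |gaussSmooth (σ * √s) g (x + u) - gaussSmooth (σ * √s) g x| ≤
        c * (σ * √s) ^ (r - 2 - 1) * |u| := by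
      have := abs_sub_zero_le_of_deriv_le (g := fun v => gaussSmooth (σ * √s) g (x + v))
        (g' := fun v => d₁ (x + v)) (fun v => (hd₁ (x + v)).comp_const_add x v) (u := u)
        (C := c * (σ * √s) ^ (r - 2 - 1)) fun v _ => he₁ _
      simpa using this
    have hkey : |gaussSmooth (σ * √s) g (x + u) - gaussSmooth (σ * √s) g x| ≤
        (c * σ ^ (r - 3) + 1) * (√(s : ℝ) ^ (r - p) * |u| ^ (p - 2)) := by
      have hnn : 0 ≤ √(s : ℝ) ^ (r - p) * |u| ^ (p - 2) := by positivity
      rcases le_or_gt |u| √(s : ℝ) with h | h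
      · refine hlip.trans ?_
        have h3 := min_le_rpow_mul_rpow (r := r) hsq hu0 (by linarith : 2 < p) hp3
        rw [min_eq_left] at h3
        · rw [show r - 2 - 1 = r - 3 by ring, Real.mul_rpow hσ.le hsq.le]
          calc c * (σ ^ (r - 3) * √(s : ℝ) ^ (r - 3)) * |u|
              = c * σ ^ (r - 3) * (√(s : ℝ) ^ (r - 3) * |u|) := by ring
            _ ≤ c * σ ^ (r - 3) * (√(s : ℝ) ^ (r - p) * |u| ^ (p - 2)) := by gcongr
            _ ≤ _ := by linarith
        · calc √(s : ℝ) ^ (r - 3) * |u| ≤ √(s : ℝ) ^ (r - 3) * √(s : ℝ) := by gcongr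
            _ = √(s : ℝ) ^ (r - 2) := by
              rw [← Real.rpow_add_one hsq.ne']
              ring_nf
      · refine hmod.trans ?_
        have hupos : 0 < |u| := hsq.trans h
        calc |u| ^ (r - 2) = |u| ^ (r - p) * |u| ^ (p - 2) := by
              rw [← Real.rpow_add hupos]
              ring_nf
          _ ≤ √(s : ℝ) ^ (r - p) * |u| ^ (p - 2) := by
              gcongr ?_ * _
              exact Real.rpow_le_rpow_of_nonpos hsq h.le (by linarith)
          _ ≤ _ := by nlinarith
    refine hkey.trans ?_
    have hsr : √(s : ℝ) ^ (r - p) ≤ 2 ^ ((p - r) / 2) * ((s + 1 : ℕ) : ℝ) ^ ((r - p) / 2) := by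
      have e1 : √(s : ℝ) ^ (r - p) = (s : ℝ) ^ ((r - p) / 2) := by
        rw [Real.sqrt_eq_rpow, ← Real.rpow_mul hs0.le]
        ring_nf
      have e2 : (2 : ℝ) ^ ((p - r) / 2) = (2⁻¹ : ℝ) ^ ((r - p) / 2) := by
        rw [Real.inv_rpow zero_le_two, ← Real.rpow_neg zero_le_two]
        ring_nf
      rw [e1, e2, ← Real.mul_rpow (by norm_num) (by positivity)]
      refine Real.rpow_le_rpow_of_nonpos (by positivity) ?_ (by linarith)
      have : (1 : ℝ) ≤ s := by exact_mod_cast hs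
      push_cast
      linarith
    calc (c * σ ^ (r - 3) + 1) * (√(s : ℝ) ^ (r - p) * |u| ^ (p - 2))
        ≤ (c * σ ^ (r - 3) + 1) * (2 ^ ((p - r) / 2) * ((s + 1 : ℕ) : ℝ) ^ ((r - p) / 2) *
          (1 + |u| ^ (p - 2))) := by
          gcongr
          linarith
      _ = _ := by rw [hC]; ring

/-! ### From moduli of continuity to bounds for unnormalized sums -/

theorem abs_integral_sub_integral_le_of_abs_sub_le {Ω : Type*} [MeasurableSpace Ω] {ν : Measure Ω}
    [IsProbabilityMeasure ν] {f g : Ω → ℝ} {c : ℝ} (hf : Measurable f) (hg : Measurable g)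
    (h : ∀ ω, |g ω - f ω| ≤ c) : |∫ ω, g ω ∂ν - ∫ ω, f ω ∂ν| ≤ c := by
  have hd : Integrable (fun ω => g ω - f ω) ν :=
    (integrable_const c).mono' (by fun_prop) (ae_of_all _ h)
  have hc : 0 ≤ c := by
    obtain ⟨ω⟩ := nonempty_of_isProbabilityMeasure ν
    exact (abs_nonneg _).trans (h ω)
  by_cases hi : Integrable f ν
  · have hgi : Integrable g ν := (hd.add hi).congr (ae_of_all _ fun ω => by simp)
    rw [← integral_sub hgi hi]
    refine (abs_integral_le_integral_abs).trans ((integral_mono hd.abs (integrable_const c)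
      h).trans (le_of_eq (by simp)))
  -- Functions at bounded distance are integrable together; otherwise both integrals take the
  -- default value `0`.
  · have hgi : ¬ Integrable g ν := fun hgi =>
      hi ((hgi.sub hd).congr (ae_of_all _ fun ω => by simp))
    rw [integral_undef hi, integral_undef hgi]
    simpa using hc

namespace StationaryMDS

variable {Ω : Type*} {F₀ : MeasurableSpace Ω} [mΩ : MeasurableSpace Ω] {μ : Measure Ω}
  {T : Ω ≃ᵐ Ω} {X₀ : Ω → ℝ} {σ p : ℝ} [IsProbabilityMeasure μ]

/-- Replacing `f` by its smoothing costs `c` under the law of `S_n` and once more under the normal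
law. -/
theorem abs_integral_sub_le_of_smoothing (h : StationaryMDS F₀ μ T X₀ σ p) {r c : ℝ}
    {f g₁ g₂ : ℝ → ℝ} (hb : SmoothingBound σ r c f g₁ g₂) {n : ℕ} {E : ℝ}
    (hE : |∫ ω, gaussSmooth σ f (partialSum (shiftSeq T.toEquiv X₀) n ω) ∂μ -
      gaussSmooth (σ * √n) (gaussSmooth σ f) 0| ≤ E) :
    |∫ ω, f (partialSum (shiftSeq T.toEquiv X₀) n ω) ∂μ - gaussSmooth (σ * √n) f 0| ≤
      E + 2 * c := by
  have hfm := hb.continuous.measurable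
  have hgm := measurable_gaussSmooth hfm σ
  have hS := h.measurable_partialSum n
  have h1 := abs_integral_sub_integral_le_of_abs_sub_le (ν := μ) (hfm.comp hS) (hgm.comp hS)
    fun ω => hb.abs_sub_le _
  have h2 : |gaussSmooth (σ * √n) (gaussSmooth σ f) 0 - gaussSmooth (σ * √n) f 0| ≤ c := by
    have hl : Measurable fun y : ℝ => 0 + σ * √n * y := by fun_prop
    exact abs_integral_sub_integral_le_of_abs_sub_le (hfm.comp hl) (hgm.comp hl)
      fun y => hb.abs_sub_le _
  simp only [Function.comp_apply] at h1
  rw [abs_le] at *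
  constructor <;> linarith [hE.1, hE.2, h1.1, h1.2, h2.1, h2.2]

theorem exists_le_sum_of_modulus (h : StationaryMDS F₀ μ T X₀ σ p)
    (hC1 : ∑' n : ℕ, ENNReal.ofReal (1 / ((n + 1 : ℕ) : ℝ) ^ (2 - p / 2)) *
      envelopeNorm p (varDefect F₀ μ T X₀ σ (n + 1)) μ < ∞)
    (hC2 : ∑' n : ℕ, ENNReal.ofReal (1 / ((n + 1 : ℕ) : ℝ) ^ (2 / p)) *
      eLpNorm (varDefect F₀ μ T X₀ σ (n + 1)) (ENNReal.ofReal (p / 2)) μ < ∞) {r : ℝ} (hr : r ≤ p)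
    {c : ℝ} (hc : 0 ≤ c) :
    ∃ C : ℝ, 0 ≤ C ∧ ∀ (n : ℕ) (g g₁ g₂ : ℝ → ℝ), 1 ≤ n →
      (∀ x, HasDerivAt g (g₁ x) x) → (∀ x, HasDerivAt g₁ (g₂ x) x) → Measurable g₂ →
      (∀ (s : ℕ) (x u : ℝ), |gaussSmooth (σ * √s) g₂ (x + u) - gaussSmooth (σ * √s) g₂ x| ≤
        c * (((s + 1 : ℕ) : ℝ) ^ ((r - p) / 2) * (1 + |u| ^ (p - 2)))) →
      |∫ ω, g (partialSum (shiftSeq T.toEquiv X₀) n ω) ∂μ - gaussSmooth (σ * √n) g 0| ≤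
        C * ∑ t ∈ Finset.Ioc 0 n, (t : ℝ) ^ ((r - p) / 2) := by
  have hp := h.two_lt
  obtain ⟨C, hC0, hC⟩ := h.exists_abs_integral_sub_gaussSmooth_le hC1 hC2
  refine ⟨c * C, by positivity, fun n g g₁ g₂ hn hg hg₁ hg₂ hmod => ?_⟩
  refine (hC n g g₁ g₂ (fun t u => c * ((t : ℝ) ^ ((r - p) / 2) * (1 + |u| ^ (p - 2))))
    (c * ∑ t ∈ Finset.Ioc 0 n, (t : ℝ) ^ ((r - p) / 2)) hn hg hg₁ hg₂ (fun t => by fun_prop)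
    (fun t u => by positivity) (fun t u v hu huv => ?_) (fun s t u hs hst hu => ?_)
    (fun s _ x u => ?_) (fun u hu => ?_)).trans (le_of_eq (by ring))
  · rw [abs_of_nonneg hu, abs_of_nonneg (hu.trans huv)]
    gcongr
  · have hs0 : (0 : ℝ) < s := by exact_mod_cast hs
    gcongr c * (?_ * _)
    exact Real.rpow_le_rpow_of_nonpos hs0 (by exact_mod_cast hst) (by linarith)
  · rw [abs_abs]
    exact hmod s x u
  · rw [abs_of_nonneg hu, ← Finset.mul_sum, ← Finset.sum_mul, mul_assoc]

theorem exists_le_sum_of_smoothing (h : StationaryMDS F₀ μ T X₀ σ p)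
    (hC1 : ∑' n : ℕ, ENNReal.ofReal (1 / ((n + 1 : ℕ) : ℝ) ^ (2 - p / 2)) *
      envelopeNorm p (varDefect F₀ μ T X₀ σ (n + 1)) μ < ∞)
    (hC2 : ∑' n : ℕ, ENNReal.ofReal (1 / ((n + 1 : ℕ) : ℝ) ^ (2 / p)) *
      eLpNorm (varDefect F₀ μ T X₀ σ (n + 1)) (ENNReal.ofReal (p / 2)) μ < ∞) {r : ℝ} (hr : r ≤ p)
    {c : ℝ} (hc : 0 ≤ c) :
    ∃ C : ℝ, 0 ≤ C ∧ ∀ (n : ℕ) (f g₁ g₂ : ℝ → ℝ), 1 ≤ n → SmoothingBound σ r c f g₁ g₂ →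
      |∫ ω, f (partialSum (shiftSeq T.toEquiv X₀) n ω) ∂μ - gaussSmooth (σ * √n) f 0| ≤
        C * ∑ t ∈ Finset.Ioc 0 n, (t : ℝ) ^ ((r - p) / 2) := by
  obtain ⟨C, hC0, hC⟩ := h.exists_le_sum_of_modulus hC1 hC2 hr hc
  refine ⟨C + 2 * c, by positivity, fun n f g₁ g₂ hn hb => ?_⟩
  refine (h.abs_integral_sub_le_of_smoothing hb (hC n _ g₁ g₂ hn hb.hasDerivAt hb.hasDerivAt'
    hb.measurable fun s x u => (hb.modulus s x u).trans ?_)).trans ?_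
  · have ht : (0 : ℝ) < ((s + 1 : ℕ) : ℝ) := by positivity
    have e : ∀ q : ℝ, √((s + 1 : ℕ) : ℝ) ^ q = ((s + 1 : ℕ) : ℝ) ^ (q / 2) := fun q => by
      rw [Real.sqrt_eq_rpow, ← Real.rpow_mul ht.le]
      ring_nf
    have := min_le_rpow_mul_rpow (s := √((s + 1 : ℕ) : ℝ)) (r := r) (Real.sqrt_pos.2 ht)
      (abs_nonneg u) h.two_lt h.le_three
    rw [e, e, e] at this
    gcongr
    refine this.trans ?_
    gcongr
    linarith
  -- The term `t = 1` equals `1`, so the smoothing error `2 * c` is absorbed by the sum.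
  · have h1 : 1 ≤ ∑ t ∈ Finset.Ioc 0 n, (t : ℝ) ^ ((r - p) / 2) := by
      have := Finset.single_le_sum (f := fun t : ℕ => (t : ℝ) ^ ((r - p) / 2))
        (fun t _ => by positivity) (Finset.mem_Ioc.2 ⟨one_pos, hn⟩)
      simpa using this
    nlinarith

/-- At `r = p - 2` the interpolated modulus is of order `1 / t` and would sum to a logarithm. The
minimum is kept instead, and `exists_sum_min_le` sums it uniformly in `n`. -/
theorem exists_le_of_smoothing (h : StationaryMDS F₀ μ T X₀ σ p)
    (hC1 : ∑' n : ℕ, ENNReal.ofReal (1 / ((n + 1 : ℕ) : ℝ) ^ (2 - p / 2)) *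
      envelopeNorm p (varDefect F₀ μ T X₀ σ (n + 1)) μ < ∞)
    (hC2 : ∑' n : ℕ, ENNReal.ofReal (1 / ((n + 1 : ℕ) : ℝ) ^ (2 / p)) *
      eLpNorm (varDefect F₀ μ T X₀ σ (n + 1)) (ENNReal.ofReal (p / 2)) μ < ∞) (hp3 : p < 3)
    {c : ℝ} (hc : 0 ≤ c) :
    ∃ C : ℝ, 0 ≤ C ∧ ∀ (n : ℕ) (f g₁ g₂ : ℝ → ℝ), 1 ≤ n → SmoothingBound σ (p - 2) c f g₁ g₂ →
      |∫ ω, f (partialSum (shiftSeq T.toEquiv X₀) n ω) ∂μ - gaussSmooth (σ * √n) f 0| ≤ C := by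
  have hp := h.two_lt
  obtain ⟨C, hC0, hC⟩ := h.exists_abs_integral_sub_gaussSmooth_le hC1 hC2
  obtain ⟨A, hA0, hA⟩ := exists_sum_min_le hp hp3
  refine ⟨c * A * C + 2 * c, by positivity, fun n f g₁ g₂ hn hb => ?_⟩
  refine h.abs_integral_sub_le_of_smoothing hb (hC n _ g₁ g₂
    (fun t u => c * min ((t : ℝ) ^ ((p - 5) / 2) * |u|) ((t : ℝ) ^ ((p - 4) / 2))) (c * A) hn
    hb.hasDerivAt hb.hasDerivAt' hb.measurable (fun t => by fun_prop)
    (fun t u => by positivity) (fun t u v hu huv => ?_) (fun s t u hs hst hu => ?_)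
    (fun s _ x u => ?_) (fun u hu => ?_))
  · rw [abs_of_nonneg hu, abs_of_nonneg (hu.trans huv)]
    gcongr
  · have hs0 : (0 : ℝ) < s := by exact_mod_cast hs
    have hst' : (s : ℝ) ≤ t := by exact_mod_cast hst
    refine mul_le_mul_of_nonneg_left (min_le_min (mul_le_mul_of_nonneg_right ?_ (abs_nonneg u)) ?_)
      hc
    · exact Real.rpow_le_rpow_of_nonpos hs0 hst' (by linarith)
    · exact Real.rpow_le_rpow_of_nonpos hs0 hst' (by linarith)
  · rw [abs_abs]
    refine (hb.modulus s x u).trans (le_of_eq ?_)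
    rw [show p - 2 - 3 = p - 5 by ring, show p - 2 - 2 = p - 4 by ring]
  · rw [abs_of_nonneg hu, ← Finset.mul_sum, mul_assoc]
    gcongr
    exact hA u hu n

end StationaryMDS

/-! ### Zolotarev classes -/

theorem continuous_of_mem_zolotarevClass {r : ℝ} {f : ℝ → ℝ} (hf : f ∈ zolotarevClass r) :
    Continuous f := by
  obtain ⟨l, -, -, hc, -⟩ := hf
  exact hc.continuous

theorem holder_of_mem_zolotarevClass {r : ℝ} {f : ℝ → ℝ} (hf : f ∈ zolotarevClass r) {k : ℕ}
    (hk : (k : ℝ) < r) (hk' : r ≤ k + 1) :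
    ContDiff ℝ k f ∧ ∀ x y, |iteratedDeriv k f x - iteratedDeriv k f y| ≤ |x - y| ^ (r - k) := by
  obtain ⟨l, hl, hl', hc, hh⟩ := hf
  have h1 : l < k + 1 := by exact_mod_cast hl.trans_le hk'
  have h2 : k < l + 1 := by exact_mod_cast hk.trans_le hl'
  obtain rfl : l = k := by omega
  exact ⟨hc, hh⟩

/-- The Hölder condition on the `l`-th derivative is homogeneous of total degree `r`. Hence
normalization by `√n` multiplies the distance by `n ^ (-r/2)`. -/
theorem mem_zolotarevClass_scale {r : ℝ} {f : ℝ → ℝ} (hf : f ∈ zolotarevClass r) {a : ℝ}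
    (ha : 0 < a) : (fun x => a ^ (-r) * f (a * x)) ∈ zolotarevClass r := by
  obtain ⟨l, hl, hl', hc, hh⟩ := hf
  refine ⟨l, hl, hl', contDiff_const.mul (hc.comp (contDiff_const.mul contDiff_id)),
    fun x y => ?_⟩
  have e : ∀ x, iteratedDeriv l (fun x => a ^ (-r) * f (a * x)) x =
      a ^ (-r) * (a ^ l * iteratedDeriv l f (a * x)) := fun x => by
    rw [iteratedDeriv_const_mul_field, iteratedDeriv_comp_const_mul hc]
  rw [e, e, ← mul_sub, ← mul_sub, ← mul_assoc, abs_mul, abs_of_pos (by positivity)]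
  calc a ^ (-r) * a ^ l * |iteratedDeriv l f (a * x) - iteratedDeriv l f (a * y)|
      ≤ a ^ (-r) * a ^ l * |a * x - a * y| ^ (r - l) := by
        gcongr
        exact hh _ _
    _ = (a ^ (-r) * a ^ (l : ℝ) * a ^ (r - l)) * |x - y| ^ (r - l) := by
        rw [← mul_sub, abs_mul, abs_of_pos ha, Real.mul_rpow ha.le (abs_nonneg _),
          Real.rpow_natCast]
        ring
    _ = |x - y| ^ (r - l) := by
        rw [← Real.rpow_add ha, ← Real.rpow_add ha]
        simp

/-- A bound for the Zolotarev distance of the laws of `n ^ (-1/2) Y` and `N(0, σ ^ 2)`, from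
unscaled test functions. -/
theorem zolotarevDist_map_le {Ω : Type*} [MeasurableSpace Ω] {μ : Measure Ω} {Y : Ω → ℝ}
    (hY : Measurable Y) {σ r E : ℝ} {n : ℕ} (hn : 1 ≤ n)
    (h : ∀ f ∈ zolotarevClass r, |∫ ω, f (Y ω) ∂μ - gaussSmooth (σ * √n) f 0| ≤ E) :
    zolotarevDist r (μ.map fun ω => (n : ℝ) ^ (-(1 / 2) : ℝ) * Y ω)
      (gaussianReal 0 (σ ^ 2).toNNReal) ≤ (((n : ℝ) ^ (-(r / 2)) * E : ℝ) : EReal) := by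
  have hn0 : (0 : ℝ) < n := by exact_mod_cast hn
  set a : ℝ := (n : ℝ) ^ (-(1 / 2) : ℝ) with ha
  have ha0 : 0 < a := by positivity
  have har : a ^ (-r) = (n : ℝ) ^ (r / 2) := by
    rw [ha, ← Real.rpow_mul hn0.le]
    ring_nf
  have han : a * √n = 1 := by
    rw [ha, Real.sqrt_eq_rpow, ← Real.rpow_add hn0]
    norm_num
  refine iSup₂_le fun f hf => ?_
  rw [EReal.coe_le_coe_iff]
  have hfc := continuous_of_mem_zolotarevClass hf
  have h1 := h _ (mem_zolotarevClass_scale hf ha0)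
  have e1 : ∫ x, f x ∂(μ.map fun ω => a * Y ω) = ∫ ω, f (a * Y ω) ∂μ :=
    integral_map (by fun_prop) hfc.aestronglyMeasurable
  have e2 : ∫ x, f x ∂gaussianReal 0 (σ ^ 2).toNNReal = ∫ y, f (σ * y) ∂gaussianReal 0 1 := by
    have h2 := gaussianReal_map_const_mul (μ := 0) (v := 1) σ
    have h3 : NNReal.mk (σ ^ 2) (sq_nonneg σ) * 1 = (σ ^ 2).toNNReal := by
      rw [mul_one, Real.toNNReal_of_nonneg (sq_nonneg σ)]
    rw [h3, mul_zero] at h2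
    rw [← h2, integral_map (by fun_prop) hfc.aestronglyMeasurable]
  have e3 : gaussSmooth (σ * √n) (fun x => a ^ (-r) * f (a * x)) 0 =
      a ^ (-r) * ∫ y, f (σ * y) ∂gaussianReal 0 1 := by
    rw [gaussSmooth, integral_const_mul]
    congr 2
    ext y
    congr 1
    calc a * (0 + σ * √n * y) = (a * √n) * (σ * y) := by ring
      _ = σ * y := by rw [han, one_mul]
  rw [integral_const_mul, e3, ← mul_sub, har] at h1
  rw [e1, e2, Real.rpow_neg hn0.le, inv_mul_eq_div, le_div_iff₀ (by positivity), mul_comm]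
  exact (le_abs_self _).trans h1

namespace StationaryMDS

variable {Ω : Type*} {F₀ : MeasurableSpace Ω} [mΩ : MeasurableSpace Ω] {μ : Measure Ω}
  {T : Ω ≃ᵐ Ω} {X₀ : Ω → ℝ} {σ p : ℝ} [IsProbabilityMeasure μ]

/-- The cases `r ≤ 1`, `1 < r ≤ 2`, `r > 2` correspond to `l = 0, 1, 2`. In the first two the test
function need not be `C²` and is first smoothed at scale `σ`; in the last its second derivative is
already Hölder. -/
theorem exists_le_sum_of_mem_zolotarevClass (h : StationaryMDS F₀ μ T X₀ σ p)
    (hC1 : ∑' n : ℕ, ENNReal.ofReal (1 / ((n + 1 : ℕ) : ℝ) ^ (2 - p / 2)) *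
      envelopeNorm p (varDefect F₀ μ T X₀ σ (n + 1)) μ < ∞)
    (hC2 : ∑' n : ℕ, ENNReal.ofReal (1 / ((n + 1 : ℕ) : ℝ) ^ (2 / p)) *
      eLpNorm (varDefect F₀ μ T X₀ σ (n + 1)) (ENNReal.ofReal (p / 2)) μ < ∞) {r : ℝ} (hr0 : 0 < r)
    (hr : r ≤ p) :
    ∃ C : ℝ, 0 ≤ C ∧ ∀ n : ℕ, 1 ≤ n → ∀ f ∈ zolotarevClass r,
      |∫ ω, f (partialSum (shiftSeq T.toEquiv X₀) n ω) ∂μ - gaussSmooth (σ * √n) f 0| ≤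
        C * ∑ t ∈ Finset.Ioc 0 n, (t : ℝ) ^ ((r - p) / 2) := by
  have hσ := h.sigma_pos
  have hp3 := h.le_three
  rcases le_or_gt r 1 with hr1 | hr1
  · obtain ⟨c, hc0, hc⟩ := exists_smoothingBound_of_holder hσ hr0
    obtain ⟨C, hC0, hC⟩ := h.exists_le_sum_of_smoothing hC1 hC2 hr hc0
    refine ⟨C, hC0, fun n hn f hf => ?_⟩
    obtain ⟨-, hh⟩ := holder_of_mem_zolotarevClass hf (k := 0) (by simpa) (by simpa)
    simp only [iteratedDeriv_zero, Nat.cast_zero, sub_zero] at hh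
    obtain ⟨g₁, g₂, hb⟩ := hc f hh
    exact hC n f g₁ g₂ hn hb
  rcases le_or_gt r 2 with hr2 | hr2
  · obtain ⟨c, hc0, hc⟩ := exists_smoothingBound_of_deriv_holder hσ hr1
    obtain ⟨C, hC0, hC⟩ := h.exists_le_sum_of_smoothing hC1 hC2 hr hc0
    refine ⟨C, hC0, fun n hn f hf => ?_⟩
    obtain ⟨hd, hh⟩ := holder_of_mem_zolotarevClass hf (k := 1) (by simpa)
      (by push_cast; linarith)
    simp only [iteratedDeriv_one, Nat.cast_one] at hh hd
    obtain ⟨g₁, g₂, hb⟩ := hc f (deriv f)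
      (fun x => (hd.differentiable one_ne_zero x).hasDerivAt) hh
    exact hC n f g₁ g₂ hn hb
  · obtain ⟨c, hc0, hc⟩ := exists_modulus_of_holder hσ hr2 hr hp3
    obtain ⟨C, hC0, hC⟩ := h.exists_le_sum_of_modulus hC1 hC2 hr hc0
    refine ⟨C, hC0, fun n hn f hf => ?_⟩
    obtain ⟨hd, hh⟩ := holder_of_mem_zolotarevClass hf (k := 2) (by simpa)
      (by push_cast; linarith)
    have h2 : iteratedDeriv 2 f = deriv (deriv f) := by
      rw [iteratedDeriv_succ, iteratedDeriv_one]
    rw [h2] at hh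
    simp only [Nat.cast_ofNat] at hh hd
    have hd' : ContDiff ℝ 1 (deriv f) := by
      have := (contDiff_succ_iff_deriv (n := 1) (f := f)).1 (by simpa [one_add_one_eq_two] using hd)
      exact this.2.2
    exact hC n f (deriv f) (deriv (deriv f)) hn
      (fun x => (hd.differentiable two_ne_zero x).hasDerivAt)
      (fun x => (hd'.differentiable one_ne_zero x).hasDerivAt)
      (continuous_of_holder (by linarith) hh).measurable (hc _ hh)

theorem exists_le_of_mem_zolotarevClass (h : StationaryMDS F₀ μ T X₀ σ p)
    (hC1 : ∑' n : ℕ, ENNReal.ofReal (1 / ((n + 1 : ℕ) : ℝ) ^ (2 - p / 2)) *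
      envelopeNorm p (varDefect F₀ μ T X₀ σ (n + 1)) μ < ∞)
    (hC2 : ∑' n : ℕ, ENNReal.ofReal (1 / ((n + 1 : ℕ) : ℝ) ^ (2 / p)) *
      eLpNorm (varDefect F₀ μ T X₀ σ (n + 1)) (ENNReal.ofReal (p / 2)) μ < ∞) (hp3 : p < 3) :
    ∃ C : ℝ, 0 ≤ C ∧ ∀ n : ℕ, 1 ≤ n → ∀ f ∈ zolotarevClass (p - 2),
      |∫ ω, f (partialSum (shiftSeq T.toEquiv X₀) n ω) ∂μ - gaussSmooth (σ * √n) f 0| ≤ C := by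
  have hp := h.two_lt
  obtain ⟨c, hc0, hc⟩ := exists_smoothingBound_of_holder h.sigma_pos (by linarith : 0 < p - 2)
  obtain ⟨C, hC0, hC⟩ := h.exists_le_of_smoothing hC1 hC2 hp3 hc0
  refine ⟨C, hC0, fun n hn f hf => ?_⟩
  obtain ⟨-, hh⟩ := holder_of_mem_zolotarevClass hf (k := 0) (by simpa) (by norm_num; linarith)
  simp only [iteratedDeriv_zero, Nat.cast_zero, sub_zero] at hh
  obtain ⟨g₁, g₂, hb⟩ := hc f hh
  exact hC n f g₁ g₂ hn hb

theorem exists_zolotarevDist_le (h : StationaryMDS F₀ μ T X₀ σ p)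
    (hC1 : ∑' n : ℕ, ENNReal.ofReal (1 / ((n + 1 : ℕ) : ℝ) ^ (2 - p / 2)) *
      envelopeNorm p (varDefect F₀ μ T X₀ σ (n + 1)) μ < ∞)
    (hC2 : ∑' n : ℕ, ENNReal.ofReal (1 / ((n + 1 : ℕ) : ℝ) ^ (2 / p)) *
      eLpNorm (varDefect F₀ μ T X₀ σ (n + 1)) (ENNReal.ofReal (p / 2)) μ < ∞) {r : ℝ}
    (hr : p - 2 ≤ r) (hrp : r ≤ p) (hne : (r, p) ≠ (1, 3)) :
    ∃ C : ℝ, ∀ n : ℕ, 1 ≤ n → zolotarevDist r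
      (μ.map (fun ω => (n : ℝ) ^ (-(1 / 2) : ℝ) * partialSum (shiftSeq T.toEquiv X₀) n ω))
      (gaussianReal 0 (σ ^ 2).toNNReal) ≤ ((C * (n : ℝ) ^ (1 - p / 2) : ℝ) : EReal) := by
  have hp := h.two_lt
  have hp3 := h.le_three
  -- For `r > p - 2` the exponent `(p - r) / 2` is less than `1` and the sum is of order `n ^ (1 -
  -- (p - r) / 2)`, which `n ^ (-r/2)` turns into `n ^ (1 - p/2)`. For `r = p - 2` the excluded pair
  -- forces `p < 3`.
  rcases hr.eq_or_lt with rfl | hr'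
  · have hp3' : p < 3 := lt_of_le_of_ne hp3 fun h3 => hne (by rw [h3]; norm_num)
    obtain ⟨C, hC0, hC⟩ := h.exists_le_of_mem_zolotarevClass hC1 hC2 hp3'
    refine ⟨C, fun n hn => ?_⟩
    refine (zolotarevDist_map_le (h.measurable_partialSum n) hn (hC n hn)).trans (le_of_eq ?_)
    rw [mul_comm, show -((p - 2) / 2) = 1 - p / 2 by ring]
  · obtain ⟨C, hC0, hC⟩ := h.exists_le_sum_of_mem_zolotarevClass hC1 hC2
      (by linarith : 0 < r) hrp
    refine ⟨C * (1 - (p - r) / 2)⁻¹, fun n hn => ?_⟩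
    have hn0 : (0 : ℝ) < n := by exact_mod_cast hn
    refine (zolotarevDist_map_le (h.measurable_partialSum n) hn (hC n hn)).trans ?_
    rw [EReal.coe_le_coe_iff]
    have h1 := sum_Ioc_rpow_neg_le (a := (p - r) / 2) (by linarith) (by linarith) n
    rw [show -((p - r) / 2) = (r - p) / 2 by ring] at h1
    calc (n : ℝ) ^ (-(r / 2)) * (C * ∑ t ∈ Finset.Ioc 0 n, (t : ℝ) ^ ((r - p) / 2))
        ≤ (n : ℝ) ^ (-(r / 2)) * (C * ((1 - (p - r) / 2)⁻¹ * (n : ℝ) ^ (1 - (p - r) / 2))) := by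
          gcongr
      _ = C * (1 - (p - r) / 2)⁻¹ * ((n : ℝ) ^ (-(r / 2)) * (n : ℝ) ^ (1 - (p - r) / 2)) := by
          ring
      _ = _ := by
          rw [← Real.rpow_add hn0]
          ring_nf

theorem exists_zolotarevDist_le_log (h : StationaryMDS F₀ μ T X₀ σ 3)
    (hC1 : ∑' n : ℕ, ENNReal.ofReal (1 / ((n + 1 : ℕ) : ℝ) ^ (2 - (3 : ℝ) / 2)) *
      envelopeNorm 3 (varDefect F₀ μ T X₀ σ (n + 1)) μ < ∞)
    (hC2 : ∑' n : ℕ, ENNReal.ofReal (1 / ((n + 1 : ℕ) : ℝ) ^ (2 / (3 : ℝ))) *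
      eLpNorm (varDefect F₀ μ T X₀ σ (n + 1)) (ENNReal.ofReal (3 / 2)) μ < ∞) :
    ∃ C : ℝ, ∀ n : ℕ, 2 ≤ n → zolotarevDist 1
      (μ.map (fun ω => (n : ℝ) ^ (-(1 / 2) : ℝ) * partialSum (shiftSeq T.toEquiv X₀) n ω))
      (gaussianReal 0 (σ ^ 2).toNNReal) ≤
        ((C * ((n : ℝ) ^ (-(1 / 2) : ℝ) * Real.log n) : ℝ) : EReal) := by
  obtain ⟨C, hC0, hC⟩ := h.exists_le_sum_of_mem_zolotarevClass hC1 hC2 one_pos (by norm_num)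
  -- The sum is harmonic, at most `1 + log n`, and `1 ≤ log n / log 2` since `n ≥ 2`.
  refine ⟨C * ((Real.log 2)⁻¹ + 1), fun n hn => ?_⟩
  refine (zolotarevDist_map_le (h.measurable_partialSum n) (by omega) (hC n (by omega))).trans ?_
  rw [EReal.coe_le_coe_iff]
  have hl2 : 0 < Real.log 2 := Real.log_pos one_lt_two
  have h1 : ∑ t ∈ Finset.Ioc 0 n, (t : ℝ) ^ ((1 - 3 : ℝ) / 2) ≤ 1 + Real.log n := by
    have h2 := harmonic_le_one_add_log n
    rw [sum_Ioc_zero_eq_sum_range]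
    refine le_trans (le_of_eq ?_) h2
    rw [harmonic]
    push_cast
    refine Finset.sum_congr rfl fun k _ => ?_
    rw [show (1 - 3 : ℝ) / 2 = -1 by norm_num, Real.rpow_neg_one]
  have h3 : 1 ≤ (Real.log 2)⁻¹ * Real.log n := by
    rw [inv_mul_eq_div, le_div_iff₀ hl2, one_mul]
    exact Real.log_le_log two_pos (by exact_mod_cast hn)
  calc (n : ℝ) ^ (-((1 : ℝ) / 2)) * (C * ∑ t ∈ Finset.Ioc 0 n, (t : ℝ) ^ ((1 - 3 : ℝ) / 2))
      ≤ (n : ℝ) ^ (-((1 : ℝ) / 2)) * (C * ((Real.log 2)⁻¹ * Real.log n + Real.log n)) := by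
        gcongr
        linarith
    _ = _ := by ring

end StationaryMDS

/-! ### The degenerate case and the theorem -/

theorem zolotarevDist_self_le_zero (r : ℝ) (ν : Measure ℝ) : zolotarevDist r ν ν ≤ 0 :=
  iSup₂_le fun f _ => by simp

/-- If the martingale differences vanish, so do the normalized sums. -/
theorem map_partialSum_eq_of_ae_eq_zero {Ω : Type*} [MeasurableSpace Ω] {μ : Measure Ω}
    [IsProbabilityMeasure μ] {T : Ω ≃ᵐ Ω} (hT : MeasurePreserving T μ μ) {X₀ : Ω → ℝ}
    (hX : X₀ =ᵐ[μ] 0) (a : ℝ) (n : ℕ) :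
    μ.map (fun ω => a * partialSum (shiftSeq T.toEquiv X₀) n ω) = gaussianReal 0 0 := by
  have h1 : ∀ k : ℤ, ∀ᵐ ω ∂μ, shiftSeq T.toEquiv X₀ k ω = 0 := fun k =>
    (measurePreserving_zpow hT k).quasiMeasurePreserving.ae hX
  have h2 : (fun ω => a * partialSum (shiftSeq T.toEquiv X₀) n ω) =ᵐ[μ] fun _ => 0 := by
    filter_upwards [ae_all_iff.2 h1] with ω hω
    simp [partialSum, hω]
  rw [Measure.map_congr h2, Measure.map_const, gaussianReal_zero_var]
  simp

theorem mainTheorem1 {Ω : Type*} (F₀ : MeasurableSpace Ω) [mΩ : MeasurableSpace Ω]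
    (μ : Measure Ω) [IsProbabilityMeasure μ]
    (T : Ω ≃ᵐ Ω) (hT : MeasurePreserving T μ μ)
    (hF₀ : F₀ ≤ mΩ) (hF₀T : F₀ ≤ F₀.comap T)
    (X₀ : Ω → ℝ)
    (hX : IsMartingaleDiffSeq μ (shiftFiltration T.toEquiv F₀) (shiftSeq T.toEquiv X₀))
    (σ : ℝ) (hσ : σ = √(Var[X₀; μ]))
    (p : ℝ) (hp : p ∈ Set.Ioc (2 : ℝ) 3)
    (hXp : MemLp X₀ (ENNReal.ofReal p) μ)
    (hC1 : ∑' n : ℕ, ENNReal.ofReal (1 / ((n + 1 : ℕ) : ℝ) ^ (2 - p / 2)) *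
      envelopeNorm p (fun ω =>
        (μ[fun ω' => partialSum (shiftSeq T.toEquiv X₀) (n + 1) ω' ^ 2 / ((n + 1 : ℕ) : ℝ) | F₀]) ω
          - σ ^ 2) μ < ∞)
    (hC2 : ∑' n : ℕ, ENNReal.ofReal (1 / ((n + 1 : ℕ) : ℝ) ^ (2 / p)) *
      eLpNorm (fun ω =>
        (μ[fun ω' => partialSum (shiftSeq T.toEquiv X₀) (n + 1) ω' ^ 2 / ((n + 1 : ℕ) : ℝ) | F₀]) ω
          - σ ^ 2) (ENNReal.ofReal (p / 2)) μ < ∞) :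
    (∀ r ∈ Set.Icc (p - 2) p, (r, p) ≠ (1, 3) →
      ∃ C : ℝ, ∀ n : ℕ, 1 ≤ n →
        zolotarevDist r
            (μ.map (fun ω => (n : ℝ) ^ (-(1 / 2) : ℝ) * partialSum (shiftSeq T.toEquiv X₀) n ω))
            (gaussianReal 0 (σ ^ 2).toNNReal)
          ≤ ((C * (n : ℝ) ^ (1 - p / 2) : ℝ) : EReal)) ∧
    (p = 3 →
      ∃ C : ℝ, ∀ n : ℕ, 2 ≤ n →
        zolotarevDist 1
            (μ.map (fun ω => (n : ℝ) ^ (-(1 / 2) : ℝ) * partialSum (shiftSeq T.toEquiv X₀) n ω))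
            (gaussianReal 0 (σ ^ 2).toNNReal)
          ≤ ((C * ((n : ℝ) ^ (-(1 / 2) : ℝ) * Real.log n) : ℝ) : EReal)) := by
  obtain ⟨hp2, hp3⟩ := hp
  have hX₀m : Measurable X₀ := (hX.adapted 0).mono
    ((MeasurableSpace.comap_mono hF₀).trans (measurePreserving_zpow hT 0).measurable.comap_le)
    le_rfl
  have hle : shiftFiltration T.toEquiv F₀ (0 - 1) ≤ mΩ :=
    (MeasurableSpace.comap_mono hF₀).trans (measurePreserving_zpow hT (0 - 1)).measurable.comap_le
  have hX2 : MemLp X₀ 2 μ :=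
    hXp.mono_exponent (by rw [← ENNReal.ofReal_ofNat]; exact ENNReal.ofReal_le_ofReal hp2.le)
  have hmean : ∫ ω, X₀ ω ∂μ = 0 := by
    have h1 := integral_condExp (μ := μ) (f := shiftSeq T.toEquiv X₀ 0) hle
    rw [integral_congr_ae (hX.condExp_eq_zero 0)] at h1
    simp only [Pi.zero_apply, integral_zero] at h1
    exact h1.symm
  have hvar : Var[X₀; μ] = ∫ ω, X₀ ω ^ 2 ∂μ :=
    variance_of_integral_eq_zero hX₀m.aemeasurable hmean
  have hσ2 : ∫ ω, X₀ ω ^ 2 ∂μ = σ ^ 2 := by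
    rw [hσ, Real.sq_sqrt (variance_nonneg _ _), hvar]
  -- The Lindeberg argument smooths at scale `σ` and needs `σ > 0`. If `σ = 0`, then `X₀ = 0` almost
  -- surely and both laws are the Dirac mass at `0`.
  rcases (show 0 ≤ σ from hσ ▸ Real.sqrt_nonneg _).eq_or_lt with hσ0 | hσ0
  · have hX0 : X₀ =ᵐ[μ] 0 := by
      rw [← hσ0, zero_pow two_ne_zero,
        integral_eq_zero_iff_of_nonneg (fun ω => sq_nonneg _) hX2.integrable_sq] at hσ2
      filter_upwards [hσ2] with ω hω
      simpa using hω
    have key : ∀ (r : ℝ) (n : ℕ), zolotarevDist r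
        (μ.map (fun ω => (n : ℝ) ^ (-(1 / 2) : ℝ) * partialSum (shiftSeq T.toEquiv X₀) n ω))
        (gaussianReal 0 (σ ^ 2).toNNReal) ≤ 0 := fun r n => by
      rw [map_partialSum_eq_of_ae_eq_zero hT hX0, ← hσ0]
      simpa using zolotarevDist_self_le_zero r (gaussianReal 0 0)
    exact ⟨fun r _ _ => ⟨0, fun n _ => by simpa using key r n⟩,
      fun _ => ⟨0, fun n _ => by simpa using key 1 n⟩⟩
  · have h : StationaryMDS F₀ μ T X₀ σ p := ⟨hT, hF₀, hF₀T, hX, hσ2, hσ0, hp2, hp3, hXp⟩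
    refine ⟨fun r hr hne => h.exists_zolotarevDist_le hC1 hC2 hr.1 hr.2 hne, fun h3 => ?_⟩
    subst h3
    exact h.exists_zolotarevDist_le_log hC1 hC2
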